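/- Let $\alpha,\beta,s\in\mathbb R$ with $\alpha\notin\{0,4\}$ and consider the modified Majda–Biello system $$u_t+u_{xxx}=-vv_x,\qquad v_t+\alpha v_{xxx}+\beta v_x=-(uv)_x,\qquad (u,v)|_{t=0}=(u_0,v_0)\in H^s(\mathbb R)\times H^s(\mathbb R),\qquad x\in\mathbb R.$$ For an integer $k\ge 1$, call the system $C^k$ locally well-posed in $H^s\times H^s$ if there are $T>0$, a ball $B$ about the origin of $H^s(\mathbb R)\times H^s(\mathbb R)$ and a map $\Phi:B\to C([0,T];H^s(\mathbb R)\times H^s(\mathbb R))$ of class $C^k$ (over $\mathbb R$) that is the solution map of the system: for every $(u_0,v_0)\in B$ with $u_0,v_0\in H^\infty(\mathbb R)=\bigcap_{\sigma}H^{\sigma}(\mathbb R)$, the curve $\Phi(u_0,v_0)$ is the unique smooth solution on $[0,T]$, in the class $C([0,T];H^\infty\times H^\infty)$, with initial data $(u_0,v_0)$. (For rough data in $B$ the solution is then the limit of the smooth solutions.) (a) If $\alpha\in(0,4)\setminus\{1\}$ then, for every $\beta\in\mathbb R$ and every $s<0$, the system fails to be $C^2$ locally well-posed in $H^s\times H^s$.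 (b) If $\alpha<0$, $\alpha>4$ or $\alpha=1$ then, for every $\beta\in\mathbb R$ and every $s<-\tfrac34$, the system fails to be $C^3$ locally well-posed in $H^s\times H^s$. Both assertions hold with $H^s(\mathbb R)$ understood as the space of complex-valued distributions and also with $H^s(\mathbb R)$ understood as the space of real-valued distributions. -/

import Mathlib

open MeasureTheory Set Filter Topology
open scoped SchwartzMap ContDiff

noncomputable section

namespace MajdaBiello

/-- The tempered distributions on the line that lie in the `L²`-based Sobolev class of order `s`
(Mathlib's `MemSobolev`), as a complex vector space. -/
def sobolevSubmodule (s : ℝ) : Submodule ℂ 𝓢'(ℝ, ℂ) where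
  carrier := {f | TemperedDistribution.MemSobolev s 2 f}
  zero_mem' := TemperedDistribution.memSobolev_fun_zero ℝ ℂ s 2
  add_mem' hf hg := hf.add hg
  smul_mem' c _ hf := hf.smul c

/-- The Sobolev space `H^s(ℝ)` of complex-valued tempered distributions. It is a type of its own,
because it carries the Sobolev norm below and not the topology of the tempered distributions. -/
def Sobolev (s : ℝ) : Type := sobolevSubmodule s

namespace Sobolev

variable {s : ℝ}

/-- The tempered distribution underlying an element of `H^s(ℝ)`. -/
def toDistribution (f : Sobolev s) : 𝓢'(ℝ, ℂ) := Subtype.val f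

instance : AddCommGroup (Sobolev s) := inferInstanceAs (AddCommGroup (sobolevSubmodule s))

instance : Module ℂ (Sobolev s) := inferInstanceAs (Module ℂ (sobolevSubmodule s))

theorem toDistribution_add (f g : Sobolev s) :
    (f + g).toDistribution = f.toDistribution + g.toDistribution := rfl

theorem toDistribution_smul (c : ℂ) (f : Sobolev s) :
    (c • f).toDistribution = c • f.toDistribution := rfl

theorem toDistribution_injective :
    Function.Injective (toDistribution : Sobolev s → 𝓢'(ℝ, ℂ)) := Subtype.val_injective

theorem toTemperedDistribution_injective :
    Function.Injective (Lp.toTemperedDistributionCLM ℂ (volume : Measure ℝ) 2) :=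
  LinearMap.ker_eq_bot.1 Lp.ker_toTemperedDistributionCLM_eq_bot

/-- The `L²` function `⟨D⟩^s f` for `f ∈ H^s(ℝ)`. -/
def besselL2 (f : Sobolev s) : Lp ℂ 2 (volume : Measure ℝ) := Classical.choose f.2

theorem besselL2_spec (f : Sobolev s) :
    TemperedDistribution.besselPotential ℝ ℂ s f.toDistribution =
      Lp.toTemperedDistributionCLM ℂ (volume : Measure ℝ) 2 f.besselL2 :=
  Classical.choose_spec f.2

/-- The map `f ↦ ⟨D⟩^s f` from `H^s(ℝ)` to `L²(ℝ)`. -/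
def besselLinear (s : ℝ) : Sobolev s →ₗ[ℂ] Lp ℂ 2 (volume : Measure ℝ) where
  toFun := besselL2
  map_add' f g := toTemperedDistribution_injective <| by
    rw [map_add, ← besselL2_spec, ← besselL2_spec, ← besselL2_spec, toDistribution_add, map_add]
  map_smul' c f := toTemperedDistribution_injective <| by
    rw [RingHom.id_apply, map_smul, ← besselL2_spec, ← besselL2_spec, toDistribution_smul,
      map_smul]

theorem besselLinear_injective (s : ℝ) : Function.Injective (besselLinear s) := by
  intro f g h
  apply toDistribution_injective
  have h2 : TemperedDistribution.besselPotential ℝ ℂ s f.toDistribution =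
      TemperedDistribution.besselPotential ℝ ℂ s g.toDistribution := by
    rw [besselL2_spec, besselL2_spec]
    exact congrArg _ h
  have h3 := congrArg (TemperedDistribution.besselPotential ℝ ℂ (-s)) h2
  simpa [TemperedDistribution.besselPotential_besselPotential_apply] using h3

/-- The Sobolev norm `‖f‖_{H^s} = ‖⟨D⟩^s f‖_{L²}`. -/
instance : NormedAddCommGroup (Sobolev s) :=
  NormedAddCommGroup.induced (Sobolev s) (Lp ℂ 2 (volume : Measure ℝ)) (besselLinear s)
    (besselLinear_injective s)

instance : NormedSpace ℂ (Sobolev s) :=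
  NormedSpace.induced ℂ (Sobolev s) (Lp ℂ 2 (volume : Measure ℝ)) (besselLinear s)

/-- `f` belongs to `H^∞(ℝ)`, the intersection of all Sobolev spaces. -/
def IsSmooth (f : Sobolev s) : Prop :=
  ∀ r : ℝ, TemperedDistribution.MemSobolev r 2 f.toDistribution

/-- The distribution `f` is given by integration against the function `g` (used only for
`g ∈ L²(ℝ)`, where the integral converges). -/
def IsGivenBy (f : Sobolev s) (g : ℝ → ℂ) : Prop :=
  ∀ φ : 𝓢(ℝ, ℂ), f.toDistribution φ = ∫ x, φ x * g x

/-- The real subspace of real-valued elements of `H^s(ℝ)`: those that take real values on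
real-valued test functions. -/
def realValued (s : ℝ) : Submodule ℝ (Sobolev s) where
  carrier := {f | ∀ φ : 𝓢(ℝ, ℂ), (∀ x, (φ x).im = 0) → (f.toDistribution φ).im = 0}
  zero_mem' φ _ := Complex.zero_im
  add_mem' {f g} hf hg φ hφ := by
    change (f.toDistribution φ + g.toDistribution φ).im = 0
    rw [Complex.add_im, hf φ hφ, hg φ hφ, add_zero]
  smul_mem' c f hf φ hφ := by
    change ((c : ℂ) • f.toDistribution φ).im = 0
    simp [hf φ hφ]

end Sobolev

/-- `w` is a curve in `C([0,T]; H^∞(ℝ))`: every `w t` is smooth, and each space derivative is in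
`L²(ℝ)` and depends continuously on `t ∈ [0,T]` in the norm of `L²(ℝ)`. -/
structure IsSmoothCurve (T : ℝ) (w : ℝ → ℝ → ℂ) : Prop where
  contDiff : ∀ t ∈ Icc 0 T, ContDiff ℝ ∞ (w t)
  memLp : ∀ t ∈ Icc 0 T, ∀ n : ℕ, MemLp (iteratedDeriv n (w t)) 2 volume
  tendsto : ∀ t ∈ Icc 0 T, ∀ n : ℕ,
    Tendsto (fun τ => eLpNorm (iteratedDeriv n (w τ) - iteratedDeriv n (w t)) 2 volume)
      (𝓝[Icc 0 T] t) (𝓝 0)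

/-- `u t x`, `v t x` is a smooth solution on `[0,T] × ℝ`, in the class `C([0,T]; H^∞(ℝ))`, of
`u_t + u_xxx = - v v_x`, `v_t + α v_xxx + β v_x = - (u v)_x`. -/
structure IsSmoothSolution (α β T : ℝ) (u v : ℝ → ℝ → ℂ) : Prop where
  contDiffOn_u : ContDiffOn ℝ ∞ (fun p : ℝ × ℝ => u p.1 p.2) (Icc 0 T ×ˢ univ)
  contDiffOn_v : ContDiffOn ℝ ∞ (fun p : ℝ × ℝ => v p.1 p.2) (Icc 0 T ×ˢ univ)
  curve_u : IsSmoothCurve T u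
  curve_v : IsSmoothCurve T v
  eq_u : ∀ t ∈ Icc 0 T, ∀ x : ℝ,
    derivWithin (fun τ => u τ x) (Icc 0 T) t + iteratedDeriv 3 (u t) x
      = - (v t x * deriv (v t) x)
  eq_v : ∀ t ∈ Icc 0 T, ∀ x : ℝ,
    derivWithin (fun τ => v τ x) (Icc 0 T) t + α * iteratedDeriv 3 (v t) x + β * deriv (v t) x
      = - deriv (fun y => u t y * v t y) x

/-- The continuous curve `w : [0,T] → H^s × H^s` (with both components in the real subspace `X` of
`H^s`) is given by a smooth solution of the system. -/
def SolvesSmoothly {s : ℝ} {X : Submodule ℝ (Sobolev s)} (α β : ℝ) {T : ℝ}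
    (w : C(Icc (0 : ℝ) T, X × X)) : Prop :=
  ∃ u v : ℝ → ℝ → ℂ, IsSmoothSolution α β T u v ∧
    ∀ t : Icc (0 : ℝ) T, (w t).1.1.IsGivenBy (u t) ∧ (w t).2.1.IsGivenBy (v t)

/-- The system is locally well-posed with a `C^k` solution map, for data in `X × X ⊆ H^s × H^s`:
there are a time `T > 0`, a ball about the origin in `X × X` and a map `Φ` from data to curves in
`C([0,T]; X × X)` which is of class `C^k` on the ball and is the solution map of the system, that
is, for smooth data `d` in the ball the curve `Φ d` is the unique smooth solution that starts
at `d`. For rough data in the ball, for which the products in the system need not make sense, the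
solution `Φ d` is the limit in `C([0,T]; X × X)` of the solutions with smooth data tending to `d`.

Well-posedness is only asked for small data and differentiability over `ℝ`; this is the weakest
form of the notion, so its failure is the strongest. -/
def IsLocallyWellPosed {s : ℝ} (X : Submodule ℝ (Sobolev s)) (α β : ℝ) (k : ℕ) : Prop :=
  ∃ (T : ℝ) (hT : 0 < T) (r : ℝ) (Φ : X × X → C(Icc (0 : ℝ) T, X × X)), 0 < r ∧
    ContDiffOn ℝ k Φ (Metric.ball 0 r) ∧
    ∀ d ∈ Metric.ball (0 : X × X) r, d.1.1.IsSmooth → d.2.1.IsSmooth →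
      ∀ w : C(Icc (0 : ℝ) T, X × X),
        (w ⟨0, left_mem_Icc.2 hT.le⟩ = d ∧ SolvesSmoothly α β w) ↔ w = Φ d

end MajdaBiello

end

/-! A solution map of class C^k has k-th finite differences along ε ↦ εd at 0 of size at most C|ε|^k
‖d‖^k, with C independent of the datum d. After division by ε^k and the limit ε → 0, the k-th Taylor
coefficient of the solution, tested at time T against a linear packet with profile h, is bounded by
C ‖d‖_{H^s}^k ‖h‖_{H^{-s}}. The coefficient is an explicit oscillatory integral over frequencies,
and suitable data violate the bound.

The coefficient has to be identified for solutions whose existence is all that is given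
(`exists_quadratic_expansion`, `exists_cubic_expansion`). Real smooth data give real solutions,
since the conjugate curve solves the same problem and solutions are unique; for these ‖u‖² + ‖v‖² is
conserved in L². As the linear flow is also isometric, the squared distance between the solution and
its linear part reduces to a cross term (`energy_eq`), so that no Gronwall argument is needed. The
error constants depend on the profiles, which is harmless because ε → 0 is taken with the profiles
fixed.

For k = 2 and 0 < α < 4, α ≠ 1, frequencies N of u and M ∼ N of v, with N + M ∼ N, interact without
phase (`exists_resonant`). Bumps of width γ = N^{s-2} keep the phase negligible. The quadratic form
is then of size γ²N, while the bound permits N^s γ^{3/2}; their quotient is N^{-s/2}, which is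
unbounded for s < 0.

For k = 3, u(0) = 0 and v(0) has bumps of width γ at ±N. Three sign patterns of the cubic
interaction return to N. The derivative in the u equation cancels against the phase of the first
interaction, leaving the reciprocals of `resFactor`, whose sum is proportional to (5α - 8)/(α(α -
4)) and hence nonzero in the cases of (b). The form is of size γ³/N (`tendsto_integral_ampVVV`),
provided that Nγ² → 0 and N²γ → ∞, while the bound permits N^{2s}γ². A power γ = N^{-κ}
contradicting this exists exactly when s < -3/4. -/

noncomputable section

/-! ### Square integrable functions and the class H^∞. -/

namespace MajdaBiello

/-- The `L²` norm of a function on the line, as a real number. -/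
def l2 (f : ℝ → ℂ) : ℝ := (eLpNorm f 2 volume).toReal

theorem l2_nonneg (f : ℝ → ℂ) : 0 ≤ l2 f := ENNReal.toReal_nonneg

theorem l2_sq {f : ℝ → ℂ} (hf : MemLp f 2 volume) : l2 f ^ 2 = ∫ x, ‖f x‖ ^ 2 := by
  have h := hf.eLpNorm_eq_integral_rpow_norm (by norm_num) (by norm_num)
  have h0 : 0 ≤ ∫ x, ‖f x‖ ^ 2 := integral_nonneg fun x => by positivity
  rw [l2, h]
  simp only [ENNReal.toReal_ofNat, Real.rpow_ofNat]
  rw [ENNReal.toReal_ofReal (by positivity), ← Real.rpow_natCast, ← Real.rpow_mul h0]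
  norm_num

theorem l2_add_le {f g : ℝ → ℂ} (hf : MemLp f 2 volume) (hg : MemLp g 2 volume) :
    l2 (f + g) ≤ l2 f + l2 g := by
  rw [l2, l2, l2, ← ENNReal.toReal_add hf.2.ne hg.2.ne]
  exact ENNReal.toReal_mono (ENNReal.add_ne_top.2 ⟨hf.2.ne, hg.2.ne⟩)
    (eLpNorm_add_le hf.1 hg.1 (by norm_num))

theorem l2_smul (c : ℂ) (f : ℝ → ℂ) : l2 (c • f) = ‖c‖ * l2 f := by
  rw [l2, l2, eLpNorm_const_smul, ENNReal.toReal_mul]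
  simp

theorem l2_neg (f : ℝ → ℂ) : l2 (-f) = l2 f := by
  rw [l2, l2, eLpNorm_neg]

theorem l2_sub_le {f g : ℝ → ℂ} (hf : MemLp f 2 volume) (hg : MemLp g 2 volume) :
    l2 (f - g) ≤ l2 f + l2 g := by
  rw [sub_eq_add_neg, ← l2_neg g]
  exact l2_add_le hf hg.neg

theorem integral_norm_mul_le {f g : ℝ → ℂ} (hf : MemLp f 2 volume) (hg : MemLp g 2 volume) :
    ∫ x, ‖f x * g x‖ ≤ l2 f * l2 g := by
  have h : eLpNorm (fun x => f x * g x) 1 volume ≤ eLpNorm f 2 volume * eLpNorm g 2 volume := by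
    have := eLpNorm_le_eLpNorm_mul_eLpNorm_of_nnnorm (p := 2) (q := 2) (r := 1) hf.1 hg.1
      (fun a b : ℂ => a * b) 1 (.of_forall fun x => by simp)
    simpa using this
  have h1 : ∫ x, ‖f x * g x‖ = (eLpNorm (fun x => f x * g x) 1 volume).toReal := by
    rw [eLpNorm_one_eq_lintegral_enorm]
    exact integral_norm_eq_lintegral_enorm (hf.1.mul hg.1)
  rw [h1, l2, l2, ← ENNReal.toReal_mul]
  exact ENNReal.toReal_mono (ENNReal.mul_ne_top hf.2.ne hg.2.ne) h

theorem norm_integral_mul_le {f g : ℝ → ℂ} (hf : MemLp f 2 volume) (hg : MemLp g 2 volume) :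
    ‖∫ x, f x * g x‖ ≤ l2 f * l2 g :=
  (norm_integral_le_integral_norm _).trans (integral_norm_mul_le hf hg)

theorem integrable_mul_of_memLp {f g : ℝ → ℂ} (hf : MemLp f 2 volume) (hg : MemLp g 2 volume) :
    Integrable (fun x => f x * g x) := hf.integrable_mul hg

theorem memLp_mul_of_bdd {f g : ℝ → ℂ} {C : ℝ} (hf : MemLp f 2 volume) (hg : Continuous g)
    (hC : ∀ x, ‖g x‖ ≤ C) : MemLp (fun x => f x * g x) 2 volume :=
  MemLp.of_le_mul (c := C) hf (hf.1.mul hg.aestronglyMeasurable) (.of_forall fun x => by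
    rw [norm_mul, mul_comm]; gcongr; exact hC x)

theorem l2_mul_le_of_bdd {f g : ℝ → ℂ} {C : ℝ} (hf : MemLp f 2 volume)
    (hC : ∀ x, ‖g x‖ ≤ C) : l2 (fun x => f x * g x) ≤ C * l2 f := by
  have hC0 : 0 ≤ C := (norm_nonneg _).trans (hC 0)
  have h := eLpNorm_le_mul_eLpNorm_of_ae_le_mul (f := fun x => f x * g x) (g := f) (c := C)
    (μ := volume) (.of_forall fun x => by
      rw [norm_mul, mul_comm]; gcongr; exact hC x) 2
  rw [l2, l2, ← ENNReal.toReal_ofReal hC0, ← ENNReal.toReal_mul]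
  exact ENNReal.toReal_mono (ENNReal.mul_ne_top (by simp) hf.2.ne) h

/-- Functions all of whose derivatives are square integrable. -/
structure HInf (f : ℝ → ℂ) : Prop where
  contDiff : ContDiff ℝ ∞ f
  memLp : ∀ n : ℕ, MemLp (iteratedDeriv n f) 2 volume

namespace HInf

variable {f g b : ℝ → ℂ}

theorem memLp_zero (hf : HInf f) : MemLp f 2 volume := by simpa using hf.memLp 0

theorem deriv (hf : HInf f) : HInf (deriv f) where
  contDiff := (contDiff_infty_iff_deriv.1 hf.contDiff).2
  memLp n := by
    rw [← iteratedDeriv_succ']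
    exact hf.memLp (n + 1)

theorem hasDerivAt (hf : HInf f) (x : ℝ) : HasDerivAt f (_root_.deriv f x) x :=
  (hf.contDiff.differentiable (by simp)).differentiableAt.hasDerivAt

theorem continuous (hf : HInf f) : Continuous f := hf.contDiff.continuous

theorem integrable_mul (hf : HInf f) (hg : HInf g) : Integrable (fun x => f x * g x) :=
  integrable_mul_of_memLp hf.memLp_zero hg.memLp_zero

theorem add (hf : HInf f) (hg : HInf g) : HInf (f + g) where
  contDiff := hf.contDiff.add hg.contDiff
  memLp n := by
    have : iteratedDeriv n (f + g) = iteratedDeriv n f + iteratedDeriv n g := by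
      ext x
      exact iteratedDeriv_add (hf.contDiff.of_le (by exact_mod_cast le_top)).contDiffAt
        (hg.contDiff.of_le (by exact_mod_cast le_top)).contDiffAt
    rw [this]
    exact (hf.memLp n).add (hg.memLp n)

theorem const_smul (c : ℂ) (hf : HInf f) : HInf (c • f) where
  contDiff := contDiff_const.smul hf.contDiff
  memLp n := by
    have : iteratedDeriv n (c • f) = c • iteratedDeriv n f := by
      ext x
      exact iteratedDeriv_const_smul_field c f
    rw [this]
    exact (hf.memLp n).const_smul c

theorem neg (hf : HInf f) : HInf (-f) := by simpa using hf.const_smul (-1)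

theorem sub (hf : HInf f) (hg : HInf g) : HInf (f - g) := by
  rw [sub_eq_add_neg]
  exact hf.add hg.neg

theorem integral_mul_deriv (hf : HInf f) (hg : HInf g) :
    ∫ x, f x * _root_.deriv g x = -∫ x, _root_.deriv f x * g x :=
  integral_mul_deriv_eq_deriv_mul_of_integrable (fun x _ => hf.hasDerivAt x)
    (fun x _ => hg.hasDerivAt x)
    (hf.integrable_mul hg.deriv) (hf.deriv.integrable_mul hg) (hf.integrable_mul hg)

/-- Integrate the derivative of f² from -∞. The limit there is zero because f² and its derivative
are integrable. Working with f·f instead of |f|² stays within the bilinear pairing used throughout.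
-/
theorem norm_sq_le (hf : HInf f) (x : ℝ) : ‖f x‖ ^ 2 ≤ 2 * l2 f * l2 (_root_.deriv f) := by
  have hd : ∀ y, HasDerivAt (fun z => f z * f z)
      (_root_.deriv f y * f y + f y * _root_.deriv f y) y :=
    fun y => (hf.hasDerivAt y).mul (hf.hasDerivAt y)
  have hi1 := hf.deriv.integrable_mul hf
  have hi2 := hf.integrable_mul hf.deriv
  have hi : Integrable fun y => _root_.deriv f y * f y + f y * _root_.deriv f y := hi1.add hi2
  have h0 : Tendsto (fun z => f z * f z) atBot (𝓝 0) :=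
    tendsto_zero_of_hasDerivAt_of_integrableOn_Iic (a := 0) (fun x _ => hd x) hi.integrableOn
      (hf.integrable_mul hf).integrableOn
  have h1 := integral_Iic_of_hasDerivAt_of_tendsto' (a := x) (fun y _ => hd y) hi.integrableOn h0
  rw [sub_zero] at h1
  calc ‖f x‖ ^ 2 = ‖f x * f x‖ := by rw [norm_mul, sq]
    _ ≤ ∫ y in Iic x, ‖_root_.deriv f y * f y + f y * _root_.deriv f y‖ := by
        rw [← h1]; exact norm_integral_le_integral_norm _
    _ ≤ ∫ y, ‖_root_.deriv f y * f y + f y * _root_.deriv f y‖ :=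
        setIntegral_le_integral hi.norm (.of_forall fun y => norm_nonneg _)
    _ ≤ ∫ y, (‖_root_.deriv f y * f y‖ + ‖f y * _root_.deriv f y‖) :=
        integral_mono hi.norm (hi1.norm.add hi2.norm) fun y => norm_add_le _ _
    _ = (∫ y, ‖_root_.deriv f y * f y‖) + ∫ y, ‖f y * _root_.deriv f y‖ :=
        integral_add hi1.norm hi2.norm
    _ ≤ l2 (_root_.deriv f) * l2 f + l2 f * l2 (_root_.deriv f) :=
        add_le_add (integral_norm_mul_le hf.deriv.memLp_zero hf.memLp_zero)
          (integral_norm_mul_le hf.memLp_zero hf.deriv.memLp_zero)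
    _ = _ := by ring

theorem norm_le (hf : HInf f) (x : ℝ) : ‖f x‖ ≤ √(2 * l2 f * l2 (_root_.deriv f)) :=
  Real.le_sqrt_of_sq_le (hf.norm_sq_le x)

theorem deriv_mul_eq (hf : HInf f) (hg : HInf g) :
    _root_.deriv (fun x => f x * g x) =
      fun x => _root_.deriv f x * g x + f x * _root_.deriv g x := by
  ext x
  exact ((hf.hasDerivAt x).mul (hg.hasDerivAt x)).deriv

/-- Induction on the order of the derivative, over all pairs at once so that Leibniz's rule applies;
the base case bounds one factor uniformly by `norm_le`. -/
theorem mul (hf : HInf f) (hg : HInf g) : HInf fun x => f x * g x where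
  contDiff := hf.contDiff.mul hg.contDiff
  memLp n := by
    induction n generalizing f g with
    | zero =>
      rw [iteratedDeriv_zero]
      exact memLp_mul_of_bdd hf.memLp_zero hg.continuous hg.norm_le
    | succ n ih =>
      rw [iteratedDeriv_succ', deriv_mul_eq hf hg]
      have : iteratedDeriv n (fun x => _root_.deriv f x * g x + f x * _root_.deriv g x) =
          iteratedDeriv n (fun x => _root_.deriv f x * g x) +
          iteratedDeriv n (fun x => f x * _root_.deriv g x) := by
        ext x
        exact iteratedDeriv_add
          ((hf.deriv.contDiff.mul hg.contDiff).of_le (by exact_mod_cast le_top)).contDiffAt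
          ((hf.contDiff.mul hg.deriv.contDiff).of_le (by exact_mod_cast le_top)).contDiffAt
      rw [this]
      exact (ih hf.deriv hg).add (ih hf hg.deriv)

theorem iteratedDeriv_three : iteratedDeriv 3 f = _root_.deriv (_root_.deriv (_root_.deriv f)) := by
  rw [iteratedDeriv_succ', iteratedDeriv_succ', iteratedDeriv_succ', iteratedDeriv_zero]

theorem iteratedDeriv_three_hInf (hf : HInf f) : HInf (iteratedDeriv 3 f) := by
  rw [iteratedDeriv_three]
  exact hf.deriv.deriv.deriv

theorem integral_iteratedDeriv_three_mul (hf : HInf f) (hg : HInf g) :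
    ∫ x, f x * iteratedDeriv 3 g x = -∫ x, iteratedDeriv 3 f x * g x := by
  rw [iteratedDeriv_three, iteratedDeriv_three, hf.integral_mul_deriv hg.deriv.deriv,
    hf.deriv.integral_mul_deriv hg.deriv, hf.deriv.deriv.integral_mul_deriv hg]
  ring

theorem integral_mul_deriv_mul (hf : HInf f) (hb : HInf b) :
    ∫ x, (f x * _root_.deriv f x) * b x = -(1 / 2) * ∫ x, f x * f x * _root_.deriv b x := by
  have h := (hf.mul hf).integral_mul_deriv hb
  rw [h, deriv_mul_eq hf hf]
  have : ∀ x, (_root_.deriv f x * f x + f x * _root_.deriv f x) * b x =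
      2 * ((f x * _root_.deriv f x) * b x) := fun x => by ring
  simp_rw [this]
  rw [integral_const_mul]
  ring

end HInf

end MajdaBiello
end

/-! ### Time derivatives of L² pairings. -/

noncomputable section

namespace MajdaBiello

theorem integrable_prod_of_continuousOn {T C : ℝ} {F : ℝ → ℝ → ℂ}
    (hF : ContinuousOn (fun p : ℝ × ℝ => F p.1 p.2) (Icc 0 T ×ˢ univ))
    (hi : ∀ t ∈ Icc 0 T, Integrable (F t)) (hC : ∀ t ∈ Icc 0 T, ∫ x, ‖F t x‖ ≤ C)
    {t : ℝ} (ht : t ∈ Icc 0 T) :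
    Integrable (Function.uncurry F) ((volume.restrict (uIoc 0 t)).prod volume) := by
  have hsub : uIoc 0 t ⊆ Icc 0 T := by
    rw [uIoc_of_le ht.1]
    exact fun y hy => ⟨hy.1.le, hy.2.trans ht.2⟩
  have hm : AEStronglyMeasurable (Function.uncurry F)
      ((volume.restrict (uIoc 0 t)).prod volume) := by
    have := (hF.mono (prod_mono hsub subset_rfl)).aestronglyMeasurable (μ := volume.prod volume)
      (measurableSet_uIoc.prod MeasurableSet.univ)
    rwa [← Measure.prod_restrict, Measure.restrict_univ] at this
  rw [integrable_prod_iff hm]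
  refine ⟨(ae_restrict_iff' measurableSet_uIoc).2 (.of_forall fun τ hτ => hi τ (hsub hτ)), ?_⟩
  have : IsFiniteMeasure (volume.restrict (uIoc 0 t)) := ⟨by rw [uIoc_of_le ht.1]; simp⟩
  refine Integrable.of_bound hm.norm.integral_prod_right' C ?_
  refine (ae_restrict_iff' measurableSet_uIoc).2 (.of_forall fun τ hτ => ?_)
  rw [Real.norm_of_nonneg (integral_nonneg fun x => norm_nonneg _)]
  exact hC τ (hsub hτ)

theorem intervalIntegrable_integral_of_continuousOn {T C : ℝ} {F : ℝ → ℝ → ℂ}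
    (hF : ContinuousOn (fun p : ℝ × ℝ => F p.1 p.2) (Icc 0 T ×ˢ univ))
    (hi : ∀ t ∈ Icc 0 T, Integrable (F t)) (hC : ∀ t ∈ Icc 0 T, ∫ x, ‖F t x‖ ≤ C)
    {t : ℝ} (ht : t ∈ Icc 0 T) :
    IntervalIntegrable (fun τ => ∫ x, F τ x) volume 0 t := by
  rw [intervalIntegrable_iff]
  exact (integrable_prod_of_continuousOn hF hi hC ht).integral_prod_left

/-- `a` is a family of square integrable functions on the line, bounded in `L²` for `t ∈ [0,T]`,
with the time derivative `a'` of the same kind. -/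
structure TimeReg (T : ℝ) (a a' : ℝ → ℝ → ℂ) : Prop where
  cont : ContinuousOn (fun p : ℝ × ℝ => a p.1 p.2) (Icc 0 T ×ˢ univ)
  cont' : ContinuousOn (fun p : ℝ × ℝ => a' p.1 p.2) (Icc 0 T ×ˢ univ)
  hasDerivAt : ∀ t ∈ Ioo 0 T, ∀ x, HasDerivAt (fun τ => a τ x) (a' t x) t
  memLp : ∀ t ∈ Icc 0 T, MemLp (a t) 2 volume
  memLp' : ∀ t ∈ Icc 0 T, MemLp (a' t) 2 volume
  bound : ∃ C, ∀ t ∈ Icc 0 T, l2 (a t) ≤ C ∧ l2 (a' t) ≤ C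

theorem continuousOn_slice {T : ℝ} {F : ℝ → ℝ → ℂ}
    (hF : ContinuousOn (fun p : ℝ × ℝ => F p.1 p.2) (Icc 0 T ×ˢ univ)) (x : ℝ) :
    ContinuousOn (fun t => F t x) (Icc 0 T) :=
  hF.comp (f := fun t => (t, x)) (by fun_prop) fun t ht => ⟨ht, mem_univ _⟩

/-- The fundamental theorem of calculus at each fixed x, followed by Fubini. Differentiation under
the integral would need a majorant in x uniform in time; here L² bounds uniform in time suffice, and
the time derivative is needed only in the open interval. -/
theorem TimeReg.integral_mul_sub {T : ℝ} {a a' b b' : ℝ → ℝ → ℂ} (ha : TimeReg T a a')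
    (hb : TimeReg T b b') {t : ℝ} (ht : t ∈ Icc 0 T) :
    (∫ x, a t x * b t x) - ∫ x, a 0 x * b 0 x =
      ∫ τ in 0..t, ∫ x, (a' τ x * b τ x + a τ x * b' τ x) := by
  obtain ⟨A, hA⟩ := ha.bound
  obtain ⟨B, hB⟩ := hb.bound
  have h0 : (0 : ℝ) ∈ Icc 0 T := ⟨le_rfl, ht.1.trans ht.2⟩
  have hsub : Icc 0 t ⊆ Icc 0 T := Icc_subset_Icc_right ht.2
  have hi1 : ∀ τ ∈ Icc 0 T, Integrable fun x => a' τ x * b τ x := fun τ hτ =>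
    integrable_mul_of_memLp (ha.memLp' τ hτ) (hb.memLp τ hτ)
  have hi2 : ∀ τ ∈ Icc 0 T, Integrable fun x => a τ x * b' τ x := fun τ hτ =>
    integrable_mul_of_memLp (ha.memLp τ hτ) (hb.memLp' τ hτ)
  have hF : ContinuousOn (fun p : ℝ × ℝ => a' p.1 p.2 * b p.1 p.2 + a p.1 p.2 * b' p.1 p.2)
      (Icc 0 T ×ˢ univ) := (ha.cont'.mul hb.cont).add (ha.cont.mul hb.cont')
  have hint := integrable_prod_of_continuousOn (C := A * B + A * B)
    (F := fun τ x => a' τ x * b τ x + a τ x * b' τ x) hF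
    (fun τ hτ => (hi1 τ hτ).add (hi2 τ hτ)) (fun τ hτ => by
      have hA0 : 0 ≤ A := (l2_nonneg _).trans (hA τ hτ).1
      calc ∫ x, ‖a' τ x * b τ x + a τ x * b' τ x‖
          ≤ ∫ x, (‖a' τ x * b τ x‖ + ‖a τ x * b' τ x‖) :=
            integral_mono ((hi1 τ hτ).add (hi2 τ hτ)).norm
              ((hi1 τ hτ).norm.add (hi2 τ hτ).norm) fun x => norm_add_le _ _
        _ = (∫ x, ‖a' τ x * b τ x‖) + ∫ x, ‖a τ x * b' τ x‖ :=
            integral_add (hi1 τ hτ).norm (hi2 τ hτ).norm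
        _ ≤ l2 (a' τ) * l2 (b τ) + l2 (a τ) * l2 (b' τ) :=
            add_le_add (integral_norm_mul_le (ha.memLp' τ hτ) (hb.memLp τ hτ))
              (integral_norm_mul_le (ha.memLp τ hτ) (hb.memLp' τ hτ))
        _ ≤ A * B + A * B := by
            gcongr
            exacts [l2_nonneg _, (hA τ hτ).2, (hB τ hτ).1, l2_nonneg _, (hA τ hτ).1, (hB τ hτ).2])
    ht
  rw [intervalIntegral_integral_swap hint, ← integral_sub
    (integrable_mul_of_memLp (ha.memLp t ht) (hb.memLp t ht))
    (integrable_mul_of_memLp (ha.memLp 0 h0) (hb.memLp 0 h0))]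
  refine integral_congr_ae (.of_forall fun x => ?_)
  refine (intervalIntegral.integral_eq_sub_of_hasDerivAt_of_le (f := fun τ => a τ x * b τ x)
    ht.1 ?_ ?_ ?_).symm
  · exact ((continuousOn_slice ha.cont x).mul (continuousOn_slice hb.cont x)).mono hsub
  · intro τ hτ
    have hτ' : τ ∈ Ioo 0 T := ⟨hτ.1, hτ.2.trans_le ht.2⟩
    exact (ha.hasDerivAt τ hτ' x).mul (hb.hasDerivAt τ hτ' x)
  · refine ContinuousOn.intervalIntegrable ?_
    rw [uIcc_of_le ht.1]
    exact (continuousOn_slice (F := fun τ x => a' τ x * b τ x + a τ x * b' τ x) hF x).mono hsub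

end MajdaBiello
end

/-! ### Linear solutions with smooth, compactly supported Fourier transform. -/

noncomputable section

namespace MajdaBiello

open FourierTransform Convolution

/-- Smooth compactly supported functions of the frequency. -/
structure IsProfile (k : ℝ → ℂ) : Prop where
  contDiff : ContDiff ℝ ∞ k
  hasCompactSupport : HasCompactSupport k

namespace IsProfile

variable {k l : ℝ → ℂ}

theorem continuous (hk : IsProfile k) : Continuous k := hk.contDiff.continuous

theorem integrable (hk : IsProfile k) : Integrable k :=
  hk.continuous.integrable_of_hasCompactSupport hk.hasCompactSupport

theorem mul_left {m : ℝ → ℂ} (hk : IsProfile k) (hm : ContDiff ℝ ∞ m) :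
    IsProfile fun ξ => m ξ * k ξ :=
  ⟨hm.mul hk.contDiff, hk.hasCompactSupport.mul_left⟩

theorem memLp (hk : IsProfile k) : MemLp k 2 volume :=
  hk.continuous.memLp_of_hasCompactSupport hk.hasCompactSupport

/-- The Schwartz function given by a profile. -/
def toSchwartz (hk : IsProfile k) : 𝓢(ℝ, ℂ) := hk.hasCompactSupport.toSchwartzMap hk.contDiff

@[simp] theorem toSchwartz_apply (hk : IsProfile k) (ξ : ℝ) : hk.toSchwartz ξ = k ξ := rfl

theorem coe_toSchwartz (hk : IsProfile k) : (hk.toSchwartz : ℝ → ℂ) = k := rfl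

theorem coe_fourierInv (hk : IsProfile k) : ((𝓕⁻ hk.toSchwartz : 𝓢(ℝ, ℂ)) : ℝ → ℂ) = 𝓕⁻ k := by
  rw [SchwartzMap.fourierInv_coe, coe_toSchwartz]

end IsProfile

theorem hInf_schwartz (f : 𝓢(ℝ, ℂ)) : HInf f where
  contDiff := f.smooth ⊤
  memLp n := by
    have h : ∀ m : ℕ, ∃ g : 𝓢(ℝ, ℂ), iteratedDeriv m f = g := by
      intro m
      induction m with
      | zero => exact ⟨f, iteratedDeriv_zero⟩
      | succ m ih =>
        obtain ⟨g, hg⟩ := ih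
        exact ⟨SchwartzMap.derivCLM ℝ ℂ g, by
          ext x
          rw [iteratedDeriv_succ, hg, SchwartzMap.derivCLM_apply]⟩
    obtain ⟨g, hg⟩ := h n
    rw [hg]
    exact g.memLp 2

theorem l2_fourierInv {k : ℝ → ℂ} (hk : IsProfile k) : l2 (𝓕⁻ k) = l2 k := by
  have h1 : MemLp (𝓕⁻ k) 2 volume := by
    rw [← hk.coe_fourierInv]
    exact SchwartzMap.memLp _ 2 volume
  have h2 : l2 (𝓕⁻ k) ^ 2 = l2 k ^ 2 := by
    rw [l2_sq h1, l2_sq hk.memLp, ← hk.coe_fourierInv]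
    have := SchwartzMap.integral_norm_sq_fourier (𝓕⁻ hk.toSchwartz)
    rw [fourier_fourierInv_eq] at this
    exact this.symm
  exact (sq_eq_sq₀ (l2_nonneg _) (l2_nonneg _)).1 h2

theorem norm_fourierInv_le (k : ℝ → ℂ) (x : ℝ) : ‖𝓕⁻ k x‖ ≤ ∫ ξ, ‖k ξ‖ := by
  rw [Real.fourierInv_eq]
  refine (norm_integral_le_integral_norm _).trans (le_of_eq ?_)
  simp

theorem hasDerivAt_fourierInv {k : ℝ → ℂ} (hk : IsProfile k) (x : ℝ) :
    HasDerivAt (𝓕⁻ k) (𝓕⁻ (fun ξ : ℝ => (2 * Real.pi * Complex.I * ξ) * k ξ) x) x := by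
  have h1 : Integrable fun ξ : ℝ => ξ • k ξ := by
    have := (hk.mul_left (m := fun ξ => (ξ : ℂ)) Complex.ofRealCLM.contDiff).integrable
    simpa using this
  have h := Real.hasDerivAt_fourier hk.integrable h1 (-x)
  have h2 := h.scomp x (hasDerivAt_neg x)
  have h3 : 𝓕⁻ k = 𝓕 k ∘ fun y => -y := by
    ext y
    exact Real.fourierInv_eq_fourier_neg k y
  rw [h3]
  convert! h2 using 1
  rw [Real.fourierInv_eq_fourier_neg, neg_one_smul, Real.fourier_eq, Real.fourier_eq,
    ← integral_neg]
  congr 1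
  ext ξ
  simp only [smul_eq_mul, Circle.smul_def]
  ring

/-- The dispersion relation of `w_t + α w_xxx + β w_x = 0`. -/
def disp (α β ξ : ℝ) : ℝ := α * (2 * Real.pi * ξ) ^ 3 - β * (2 * Real.pi * ξ)

theorem disp_neg (α β ξ : ℝ) : disp α β (-ξ) = -disp α β ξ := by
  unfold disp; ring

theorem contDiff_disp (α β : ℝ) : ContDiff ℝ ∞ (disp α β) := by
  unfold disp; fun_prop

/-- The Fourier transform at time `t` of the solution of `w_t + α w_xxx + β w_x = 0` whose Fourier
transform at time `0` is `k`. -/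
def phased (α β : ℝ) (k : ℝ → ℂ) (t ξ : ℝ) : ℂ :=
  Complex.exp ((t * disp α β ξ : ℝ) * Complex.I) * k ξ

theorem norm_phased (α β : ℝ) (k : ℝ → ℂ) (t ξ : ℝ) : ‖phased α β k t ξ‖ = ‖k ξ‖ := by
  rw [phased, norm_mul, Complex.norm_exp_ofReal_mul_I, one_mul]

theorem phased_zero (α β : ℝ) (k : ℝ → ℂ) : phased α β k 0 = k := by
  ext ξ; simp [phased]

theorem IsProfile.phased {k : ℝ → ℂ} (hk : IsProfile k) (α β t : ℝ) :
    IsProfile (phased α β k t) := by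
  refine hk.mul_left ?_
  have := contDiff_disp α β
  have h : ContDiff ℝ ∞ fun ξ => ((t * disp α β ξ : ℝ) : ℂ) :=
    Complex.ofRealCLM.contDiff.comp (contDiff_const.mul this)
  exact (h.mul contDiff_const).cexp

theorem l2_phased (α β : ℝ) (k : ℝ → ℂ) (t : ℝ) : l2 (phased α β k t) = l2 k := by
  rw [l2, l2]
  congr 1
  refine eLpNorm_congr_norm_ae (.of_forall fun ξ => norm_phased α β k t ξ)

/-- The solution of `w_t + α w_xxx + β w_x = 0` whose Fourier transform at time `0` is `k`. -/
def packet (α β : ℝ) (k : ℝ → ℂ) (t : ℝ) : ℝ → ℂ := 𝓕⁻ (phased α β k t)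

section packet

variable {k : ℝ → ℂ} (α β : ℝ)

theorem packet_eq (k : ℝ → ℂ) (t x : ℝ) : packet α β k t x =
    ∫ ξ : ℝ, Complex.exp ((2 * Real.pi * (ξ * x) : ℝ) * Complex.I) * phased α β k t ξ := by
  rw [packet, Real.fourierInv_eq']
  simp [mul_comm]

theorem hInf_packet (hk : IsProfile k) (t : ℝ) : HInf (packet α β k t) := by
  rw [packet, ← (hk.phased α β t).coe_fourierInv]
  exact hInf_schwartz _

theorem l2_packet (hk : IsProfile k) (t : ℝ) : l2 (packet α β k t) = l2 k := by
  rw [packet, l2_fourierInv (hk.phased α β t), l2_phased]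

theorem norm_packet_le (k : ℝ → ℂ) (t x : ℝ) : ‖packet α β k t x‖ ≤ ∫ ξ, ‖k ξ‖ := by
  refine (norm_fourierInv_le _ x).trans (le_of_eq ?_)
  simp_rw [norm_phased]

theorem deriv_packet (hk : IsProfile k) (t : ℝ) : deriv (packet α β k t) =
    packet α β (fun ξ : ℝ => (2 * Real.pi * Complex.I * ξ) * k ξ) t := by
  ext x
  rw [packet, (hasDerivAt_fourierInv (hk.phased α β t) x).deriv, packet]
  refine congrArg (fun l : ℝ → ℂ => 𝓕⁻ l x) (funext fun ξ => ?_)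
  unfold phased
  ring

theorem contDiff_symbol : ContDiff ℝ ∞ fun ξ : ℝ => (2 * Real.pi * Complex.I * ξ : ℂ) :=
  contDiff_const.mul Complex.ofRealCLM.contDiff

theorem IsProfile.symbol_mul (hk : IsProfile k) :
    IsProfile fun ξ : ℝ => (2 * Real.pi * Complex.I * ξ : ℂ) * k ξ :=
  hk.mul_left contDiff_symbol

theorem continuous_packet (hk : IsProfile k) :
    Continuous fun p : ℝ × ℝ => packet α β k p.1 p.2 := by
  simp_rw [packet_eq]
  have h1 : Continuous (disp α β) := (contDiff_disp α β).continuous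
  have h2 := hk.continuous
  refine continuous_of_dominated (bound := fun ξ => ‖k ξ‖) (fun p => ?_) (fun p => ?_)
    hk.integrable.norm (.of_forall fun ξ => ?_)
  · refine Continuous.aestronglyMeasurable ?_
    unfold phased
    fun_prop
  · refine .of_forall fun ξ => ?_
    rw [norm_mul, Complex.norm_exp_ofReal_mul_I, one_mul, norm_phased]
  · unfold phased
    fun_prop

theorem isProfile_disp_mul (hk : IsProfile k) :
    IsProfile fun ξ => (disp α β ξ * Complex.I) * k ξ :=
  hk.mul_left ((Complex.ofRealCLM.contDiff.comp (contDiff_disp α β)).mul contDiff_const)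

theorem hasDerivAt_packet (hk : IsProfile k) (t x : ℝ) :
    HasDerivAt (fun τ => packet α β k τ x)
      (packet α β (fun ξ => (disp α β ξ * Complex.I) * k ξ) t x) t := by
  simp_rw [packet_eq]
  have h1 : Continuous (disp α β) := (contDiff_disp α β).continuous
  have h2 := hk.continuous
  refine (hasDerivAt_integral_of_dominated_loc_of_deriv_le (𝕜 := ℝ) (μ := volume)
    (F := fun τ ξ => Complex.exp ((2 * Real.pi * (ξ * x) : ℝ) * Complex.I) * phased α β k τ ξ)
    (F' := fun τ ξ => Complex.exp ((2 * Real.pi * (ξ * x) : ℝ) * Complex.I) *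
      phased α β (fun ξ => (disp α β ξ * Complex.I) * k ξ) τ ξ)
    (bound := fun ξ => ‖(disp α β ξ * Complex.I) * k ξ‖) univ_mem (.of_forall fun τ => ?_) ?_ ?_
    (.of_forall fun ξ τ _ => ?_) (isProfile_disp_mul α β hk).integrable.norm
    (.of_forall fun ξ τ _ => ?_)).2
  · refine Continuous.aestronglyMeasurable ?_
    unfold phased
    fun_prop
  · refine Continuous.integrable_of_hasCompactSupport ?_ ?_
    · unfold phased
      fun_prop
    · exact (hk.phased α β t).hasCompactSupport.mul_left
  · refine Continuous.aestronglyMeasurable ?_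
    unfold phased
    fun_prop
  · rw [norm_mul, Complex.norm_exp_ofReal_mul_I, one_mul, norm_phased]
  · have h3 : HasDerivAt (fun s : ℝ => ((s * disp α β ξ : ℝ) : ℂ) * Complex.I)
        (disp α β ξ * Complex.I) τ := by
      have := ((hasDerivAt_id τ).mul_const (disp α β ξ)).ofReal_comp.mul_const Complex.I
      simpa using this
    have h4 := (h3.cexp.mul_const (k ξ)).const_mul
      (Complex.exp ((2 * Real.pi * (ξ * x) : ℝ) * Complex.I))
    convert! h4 using 1
    unfold phased
    ring

/-- Both sides are Fourier multipliers, and -α(2πiξ)³ - β(2πiξ) = i `disp α β ξ`. -/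
theorem packet_equation (hk : IsProfile k) (t : ℝ) :
    packet α β (fun ξ => (disp α β ξ * Complex.I) * k ξ) t =
      fun x => -α * iteratedDeriv 3 (packet α β k t) x - β * deriv (packet α β k t) x := by
  ext x
  rw [HInf.iteratedDeriv_three, deriv_packet α β hk, deriv_packet α β hk.symbol_mul,
    deriv_packet α β hk.symbol_mul.symbol_mul]
  have hi : ∀ {l : ℝ → ℂ}, IsProfile l → Integrable fun ξ : ℝ =>
      Complex.exp ((2 * Real.pi * (ξ * x) : ℝ) * Complex.I) * phased α β l t ξ := by
    intro l hl
    refine Continuous.integrable_of_hasCompactSupport ?_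
      (hl.phased α β t).hasCompactSupport.mul_left
    have := (hl.phased α β t).continuous
    fun_prop
  simp_rw [packet_eq]
  rw [← integral_const_mul, ← integral_const_mul, ← integral_sub
    ((hi hk.symbol_mul.symbol_mul.symbol_mul).const_mul _) ((hi hk.symbol_mul).const_mul _)]
  congr 1
  ext ξ
  unfold phased disp
  push_cast
  linear_combination (α * Complex.exp ((2 * Real.pi * (ξ * x)) * Complex.I) *
    Complex.exp ((t * (α * (2 * Real.pi * ξ) ^ 3 - β * (2 * Real.pi * ξ))) * Complex.I) *
    (2 * Real.pi * ξ) ^ 3 * k ξ * Complex.I) * Complex.I_sq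

end packet

/-- Solutions of `w_t + α w_xxx + β w_x = 0` for all times, smooth and square integrable with all
their derivatives. -/
structure LinFlow (α β : ℝ) (b : ℝ → ℝ → ℂ) : Prop where
  hInf : ∀ t, HInf (b t)
  timeReg : ∀ T, TimeReg T b fun t x => -α * iteratedDeriv 3 (b t) x - β * deriv (b t) x
  cont_deriv : Continuous fun p : ℝ × ℝ => deriv (b p.1) p.2

theorem linFlow_packet {k : ℝ → ℂ} (α β : ℝ) (hk : IsProfile k) : LinFlow α β (packet α β k) where
  hInf := hInf_packet α β hk
  timeReg T := by
    have h := isProfile_disp_mul α β hk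
    have he : (fun t x => -α * iteratedDeriv 3 (packet α β k t) x -
        β * deriv (packet α β k t) x : ℝ → ℝ → ℂ) =
        packet α β (fun ξ => (disp α β ξ * Complex.I) * k ξ) :=
      funext fun t => (packet_equation α β hk t).symm
    rw [he]
    exact
    { cont := (continuous_packet α β hk).continuousOn
      cont' := (continuous_packet α β h).continuousOn
      hasDerivAt := fun t _ x => hasDerivAt_packet α β hk t x
      memLp := fun t _ => (hInf_packet α β hk t).memLp_zero
      memLp' := fun t _ => (hInf_packet α β h t).memLp_zero
      bound := ⟨max (l2 k) (l2 fun ξ => (disp α β ξ * Complex.I) * k ξ), fun t _ => by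
        rw [l2_packet α β hk, l2_packet α β h]
        exact ⟨le_max_left _ _, le_max_right _ _⟩⟩ }
  cont_deriv := by
    simp_rw [deriv_packet α β hk]
    exact continuous_packet α β hk.symbol_mul

/-- The convolution of two functions on the line. -/
def conv (k l : ℝ → ℂ) (ξ : ℝ) : ℂ := ∫ η, k η * l (ξ - η)

theorem conv_eq (k l : ℝ → ℂ) : conv k l = k ⋆[ContinuousLinearMap.mul ℂ ℂ] l := rfl

theorem IsProfile.conv {k l : ℝ → ℂ} (hk : IsProfile k) (hl : IsProfile l) :
    IsProfile (conv k l) := by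
  have h := (hl.hasCompactSupport.contDiff_convolution_right (n := ⊤)
    (ContinuousLinearMap.mul ℝ ℂ) hk.continuous.locallyIntegrable hl.contDiff :
    ContDiff ℝ _ (k ⋆[ContinuousLinearMap.mul ℝ ℂ] l))
  exact ⟨h, hk.hasCompactSupport.convolution (ContinuousLinearMap.mul ℝ ℂ) hl.hasCompactSupport⟩

theorem fourierInv_mul_fourierInv {k l : ℝ → ℂ} (hk : IsProfile k) (hl : IsProfile l) (x : ℝ) :
    𝓕⁻ k x * 𝓕⁻ l x = 𝓕⁻ (conv k l) x := by
  rw [Real.fourierInv_eq_fourier_neg, Real.fourierInv_eq_fourier_neg,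
    Real.fourierInv_eq_fourier_neg, conv_eq,
    Real.fourier_mul_convolution_eq hk.integrable hl.integrable]

theorem fourierInv_fourierInv {k : ℝ → ℂ} (hk : IsProfile k) (ξ : ℝ) :
    𝓕⁻ (𝓕⁻ k) ξ = k (-ξ) := by
  have h := congrArg (fun f : 𝓢(ℝ, ℂ) => f (-ξ)) (fourier_fourierInv_eq (F := 𝓢(ℝ, ℂ)) hk.toSchwartz)
  simp only [IsProfile.toSchwartz_apply] at h
  rw [← h, Real.fourierInv_eq_fourier_neg, SchwartzMap.fourier_coe, hk.coe_fourierInv]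

/-- Parseval for a triple product: only frequencies η, -ξ-η, ξ of sum zero interact. No conjugate
appears because all pairings are bilinear. -/
theorem integral_fourierInv_triple {k₁ k₂ k₃ : ℝ → ℂ} (h₁ : IsProfile k₁) (h₂ : IsProfile k₂)
    (h₃ : IsProfile k₃) : ∫ x, 𝓕⁻ k₁ x * 𝓕⁻ k₂ x * 𝓕⁻ k₃ x =
      ∫ ξ, ∫ η, k₃ ξ * (k₁ η * k₂ (-ξ - η)) := by
  simp_rw [fourierInv_mul_fourierInv h₁ h₂]
  have h := SchwartzMap.integral_fourierInv_mul_eq h₃.toSchwartz (𝓕⁻ (h₁.conv h₂).toSchwartz)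
  rw [h₃.coe_fourierInv, SchwartzMap.fourierInv_coe (𝓕⁻ (h₁.conv h₂).toSchwartz),
    (h₁.conv h₂).coe_fourierInv] at h
  simp_rw [mul_comm (𝓕⁻ (conv k₁ k₂) _)]
  rw [h]
  congr 1
  ext ξ
  rw [fourierInv_fourierInv (h₁.conv h₂), IsProfile.toSchwartz_apply, conv, ← integral_const_mul]

end MajdaBiello
end

/-! ### Smooth solutions paired with linear flows, and the conserved energy. -/

noncomputable section

namespace MajdaBiello

theorem IsSmoothCurve.hInf {T : ℝ} {w : ℝ → ℝ → ℂ} (hw : IsSmoothCurve T w) {t : ℝ}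
    (ht : t ∈ Icc 0 T) : HInf (w t) := ⟨hw.contDiff t ht, hw.memLp t ht⟩

/-- The reverse triangle inequality. Continuity on the compact time interval supplies uniform
bounds, and later a time at which ‖u‖ is maximal. -/
theorem IsSmoothCurve.continuousOn_l2 {T : ℝ} {w : ℝ → ℝ → ℂ} (hw : IsSmoothCurve T w) (n : ℕ) :
    ContinuousOn (fun t => l2 (iteratedDeriv n (w t))) (Icc 0 T) := by
  intro t ht
  have h1 : Tendsto (fun τ => l2 (iteratedDeriv n (w τ) - iteratedDeriv n (w t)))
      (𝓝[Icc 0 T] t) (𝓝 0) := by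
    simpa using! (ENNReal.tendsto_toReal ENNReal.zero_ne_top).comp (hw.tendsto t ht n)
  refine tendsto_iff_norm_sub_tendsto_zero.2 (squeeze_zero' (.of_forall fun τ => norm_nonneg _)
    (eventually_mem_nhdsWithin.mono fun τ hτ => ?_) h1)
  have hf := hw.memLp τ hτ n
  have hg := hw.memLp t ht n
  have h2 := l2_add_le (hf.sub hg) hg
  have h3 := l2_sub_le hf (hf.sub hg)
  rw [sub_add_cancel] at h2
  rw [sub_sub_cancel] at h3
  rw [Real.norm_eq_abs, abs_le]
  constructor <;> linarith

theorem IsSmoothCurve.exists_l2_le {T : ℝ} {w : ℝ → ℝ → ℂ} (hw : IsSmoothCurve T w) (n : ℕ) :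
    ∃ C, ∀ t ∈ Icc 0 T, l2 (iteratedDeriv n (w t)) ≤ C := by
  obtain ⟨C, hC⟩ := isCompact_Icc.exists_bound_of_continuousOn (hw.continuousOn_l2 n)
  exact ⟨C, fun t ht => (le_abs_self _).trans (hC t ht)⟩

theorem hasDerivWithinAt_slice {T : ℝ} {w : ℝ → ℝ → ℂ}
    (hw : ContDiffOn ℝ ∞ (fun p : ℝ × ℝ => w p.1 p.2) (Icc 0 T ×ˢ univ)) {t : ℝ}
    (ht : t ∈ Icc 0 T) (x : ℝ) :
    HasDerivWithinAt (fun τ => w τ x) (fderivWithin ℝ (fun p : ℝ × ℝ => w p.1 p.2)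
      (Icc 0 T ×ˢ univ) (t, x) (1, 0)) (Icc 0 T) t := by
  have h1 := (hw.differentiableOn (by simp) (t, x) ⟨ht, mem_univ _⟩).hasFDerivWithinAt
  have h2 : HasDerivWithinAt (fun τ : ℝ => (τ, x)) (1, 0) (Icc 0 T) t :=
    (hasDerivWithinAt_id t _).prodMk (hasDerivWithinAt_const t _ x)
  have h3 : MapsTo (fun τ : ℝ => (τ, x)) (Icc 0 T) (Icc 0 T ×ˢ univ) :=
    fun τ hτ => ⟨hτ, mem_univ _⟩
  exact h1.comp_hasDerivWithinAt t h2 h3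

theorem continuousOn_derivWithin_slice {T : ℝ} (hT : 0 < T) {w : ℝ → ℝ → ℂ}
    (hw : ContDiffOn ℝ ∞ (fun p : ℝ × ℝ => w p.1 p.2) (Icc 0 T ×ˢ univ)) :
    ContinuousOn (fun p : ℝ × ℝ => derivWithin (fun τ => w τ p.2) (Icc 0 T) p.1)
      (Icc 0 T ×ˢ univ) := by
  have hu : UniqueDiffOn ℝ (Icc 0 T ×ˢ (univ : Set ℝ)) :=
    (uniqueDiffOn_Icc hT).prod uniqueDiffOn_univ
  have h := (hw.continuousOn_fderivWithin hu (by simp)).clm_apply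
    (continuousOn_const (c := ((1 : ℝ), (0 : ℝ))))
  refine h.congr fun p hp => ?_
  exact (hasDerivWithinAt_slice hw hp.1 p.2).derivWithin (uniqueDiffOn_Icc hT _ hp.1)

theorem timeReg_of_contDiffOn {T : ℝ} (hT : 0 < T) {w w' : ℝ → ℝ → ℂ}
    (hw : ContDiffOn ℝ ∞ (fun p : ℝ × ℝ => w p.1 p.2) (Icc 0 T ×ˢ univ))
    (h : ∀ t ∈ Icc 0 T, ∀ x, derivWithin (fun τ => w τ x) (Icc 0 T) t = w' t x)
    (hL : ∀ t ∈ Icc 0 T, MemLp (w t) 2 volume) (hL' : ∀ t ∈ Icc 0 T, MemLp (w' t) 2 volume)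
    (hC : ∃ C, ∀ t ∈ Icc 0 T, l2 (w t) ≤ C) (hC' : ∃ C, ∀ t ∈ Icc 0 T, l2 (w' t) ≤ C) :
    TimeReg T w w' where
  cont := hw.continuousOn
  cont' := (continuousOn_derivWithin_slice hT hw).congr fun p hp => (h p.1 hp.1 p.2).symm
  hasDerivAt t ht x := by
    have ht' := Ioo_subset_Icc_self ht
    have h1 := hasDerivWithinAt_slice hw ht' x
    rw [← h t ht' x, h1.derivWithin (uniqueDiffOn_Icc hT _ ht')]
    exact h1.hasDerivAt (Icc_mem_nhds ht.1 ht.2)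
  memLp := hL
  memLp' := hL'
  bound := by
    obtain ⟨C, hC⟩ := hC
    obtain ⟨C', hC'⟩ := hC'
    exact ⟨max C C', fun t ht =>
      ⟨(hC t ht).trans (le_max_left _ _), (hC' t ht).trans (le_max_right _ _)⟩⟩

theorem l2_mul_le_of_hInf {f g : ℝ → ℂ} {A B : ℝ} (hf : MemLp f 2 volume) (hg : HInf g)
    (hA : l2 f ≤ A) (hB : l2 g ≤ B) (hB' : l2 (deriv g) ≤ B) :
    l2 (fun x => f x * g x) ≤ √(2 * B * B) * A := by
  have h0 : 0 ≤ B := (l2_nonneg _).trans hB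
  refine (l2_mul_le_of_bdd hf fun x => (hg.norm_le x).trans ?_).trans
    (mul_le_mul_of_nonneg_left hA (Real.sqrt_nonneg (2 * B * B)))
  refine Real.sqrt_le_sqrt (mul_le_mul (by linarith) hB' (l2_nonneg _) (by positivity))

namespace IsSmoothSolution

variable {α β T : ℝ} {u v : ℝ → ℝ → ℂ}

theorem exists_bound (hs : IsSmoothSolution α β T u v) : ∃ C, ∀ t ∈ Icc 0 T,
    (l2 (u t) ≤ C ∧ l2 (deriv (u t)) ≤ C ∧ l2 (iteratedDeriv 3 (u t)) ≤ C) ∧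
    l2 (v t) ≤ C ∧ l2 (deriv (v t)) ≤ C ∧ l2 (iteratedDeriv 3 (v t)) ≤ C := by
  obtain ⟨C₀, h₀⟩ := hs.curve_u.exists_l2_le 0
  obtain ⟨C₁, h₁⟩ := hs.curve_u.exists_l2_le 1
  obtain ⟨C₃, h₃⟩ := hs.curve_u.exists_l2_le 3
  obtain ⟨D₀, k₀⟩ := hs.curve_v.exists_l2_le 0
  obtain ⟨D₁, k₁⟩ := hs.curve_v.exists_l2_le 1
  obtain ⟨D₃, k₃⟩ := hs.curve_v.exists_l2_le 3
  simp only [iteratedDeriv_zero, iteratedDeriv_one] at h₀ h₁ k₀ k₁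
  refine ⟨max (max (max C₀ C₁) C₃) (max (max D₀ D₁) D₃), fun t ht => ⟨⟨?_, ?_, ?_⟩, ?_, ?_, ?_⟩⟩
  · exact (h₀ t ht).trans (by simp)
  · exact (h₁ t ht).trans (by simp)
  · exact (h₃ t ht).trans (by simp)
  · exact (k₀ t ht).trans (by simp)
  · exact (k₁ t ht).trans (by simp)
  · exact (k₃ t ht).trans (by simp)

theorem timeReg_u (hs : IsSmoothSolution α β T u v) (hT : 0 < T) :
    TimeReg T u fun t x => -iteratedDeriv 3 (u t) x - v t x * deriv (v t) x := by
  obtain ⟨C, hC⟩ := hs.exists_bound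
  refine timeReg_of_contDiffOn hT hs.contDiffOn_u (fun t ht x => ?_)
    (fun t ht => (hs.curve_u.hInf ht).memLp_zero) (fun t ht => ?_) ⟨C, fun t ht => (hC t ht).1.1⟩
    ⟨C + √(2 * C * C) * C, fun t ht => ?_⟩
  · linear_combination hs.eq_u t ht x
  · have hu := hs.curve_u.hInf ht
    have hv := hs.curve_v.hInf ht
    exact (hu.iteratedDeriv_three_hInf.neg.sub (hv.mul hv.deriv)).memLp_zero
  · have hu := hs.curve_u.hInf ht
    have hv := hs.curve_v.hInf ht
    obtain ⟨⟨-, -, h1⟩, h2, h3, -⟩ := hC t ht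
    have h4 := l2_sub_le hu.iteratedDeriv_three_hInf.neg.memLp_zero
      (hv.deriv.mul hv).memLp_zero
    have h5 := l2_mul_le_of_hInf hv.deriv.memLp_zero hv h3 h2 h3
    rw [l2_neg] at h4
    simp_rw [mul_comm (v t _)]
    exact h4.trans (add_le_add h1 h5)

theorem timeReg_v (hs : IsSmoothSolution α β T u v) (hT : 0 < T) :
    TimeReg T v fun t x => -α * iteratedDeriv 3 (v t) x - β * deriv (v t) x
      - deriv (fun y => u t y * v t y) x := by
  obtain ⟨C, hC⟩ := hs.exists_bound
  refine timeReg_of_contDiffOn hT hs.contDiffOn_v (fun t ht x => ?_)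
    (fun t ht => (hs.curve_v.hInf ht).memLp_zero) (fun t ht => ?_)
    ⟨C, fun t ht => (hC t ht).2.1⟩
    ⟨|α| * C + |β| * C + (√(2 * C * C) * C + √(2 * C * C) * C), fun t ht => ?_⟩
  · linear_combination hs.eq_v t ht x
  · have hu := hs.curve_u.hInf ht
    have hv := hs.curve_v.hInf ht
    exact (((hv.iteratedDeriv_three_hInf.const_smul (-α)).sub (hv.deriv.const_smul β)).sub
      (hu.mul hv).deriv).memLp_zero
  · have hu := hs.curve_u.hInf ht
    have hv := hs.curve_v.hInf ht
    obtain ⟨⟨h0, h1, -⟩, h2, h3, h4⟩ := hC t ht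
    have e1 := (hv.iteratedDeriv_three_hInf.const_smul (-α))
    have e2 := (hv.deriv.const_smul β)
    have k1 := l2_sub_le (e1.sub e2).memLp_zero (hu.mul hv).deriv.memLp_zero
    have k2 := l2_sub_le e1.memLp_zero e2.memLp_zero
    rw [l2_smul, l2_smul, norm_neg, Complex.norm_real, Complex.norm_real, Real.norm_eq_abs,
      Real.norm_eq_abs] at k2
    have k3 : l2 (deriv fun y => u t y * v t y) ≤ √(2 * C * C) * C + √(2 * C * C) * C := by
      rw [hu.deriv_mul_eq hv]
      refine (l2_add_le (hu.deriv.mul hv).memLp_zero (hu.mul hv.deriv).memLp_zero).trans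
        (add_le_add (l2_mul_le_of_hInf hu.deriv.memLp_zero hv h1 h2 h3) ?_)
      simp_rw [mul_comm (u t _)]
      exact l2_mul_le_of_hInf hv.deriv.memLp_zero hu h3 h0 h1
    refine k1.trans (add_le_add (k2.trans ?_) k3)
    gcongr

end IsSmoothSolution

section space

variable {u v b : ℝ → ℂ}

/-- The integrand is ∂_t(ub) when b solves the linear equation of u. Since ∂³ is antisymmetric for
the bilinear pairing, the linear parts cancel and only the nonlinearity survives; its derivative
moves onto the smooth b, so that L² bounds on the solution control it. -/
theorem integral_flux_u (hu : HInf u) (hv : HInf v) (hb : HInf b) :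
    ∫ x, ((-iteratedDeriv 3 u x - v x * deriv v x) * b x + u x *
      (-((1 : ℝ) : ℂ) * iteratedDeriv 3 b x - ((0 : ℝ) : ℂ) * deriv b x)) =
      1 / 2 * ∫ x, v x * v x * deriv b x := by
  have h1 := hu.integral_iteratedDeriv_three_mul hb
  have h2 := hv.integral_mul_deriv_mul hb
  have i1 := hu.integrable_mul hb.iteratedDeriv_three_hInf
  have i2 := hu.iteratedDeriv_three_hInf.integrable_mul hb
  have i3 := (hv.mul hv.deriv).integrable_mul hb
  have : ∀ x, ((-iteratedDeriv 3 u x - v x * deriv v x) * b x + u x *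
      (-((1 : ℝ) : ℂ) * iteratedDeriv 3 b x - ((0 : ℝ) : ℂ) * deriv b x)) =
      (-(iteratedDeriv 3 u x * b x) - u x * iteratedDeriv 3 b x) - v x * deriv v x * b x := by
    intro x; push_cast; ring
  simp_rw [this]
  have j2 : Integrable fun x => -(iteratedDeriv 3 u x * b x) := i2.neg
  have j1 : Integrable fun x => -(iteratedDeriv 3 u x * b x) - u x * iteratedDeriv 3 b x :=
    j2.sub i1
  rw [integral_sub j1 i3, integral_sub j2 i1, integral_neg, h1, h2]
  ring

theorem integral_flux_v (α β : ℝ) (hu : HInf u) (hv : HInf v) (hb : HInf b) :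
    ∫ x, ((-α * iteratedDeriv 3 v x - β * deriv v x - deriv (fun y => u y * v y) x) * b x + v x *
      (-α * iteratedDeriv 3 b x - β * deriv b x)) = ∫ x, u x * v x * deriv b x := by
  have h1 := hv.integral_iteratedDeriv_three_mul hb
  have h2 := hv.integral_mul_deriv hb
  have h3 := (hu.mul hv).integral_mul_deriv hb
  have i1 := (hv.integrable_mul hb.iteratedDeriv_three_hInf).const_mul (α : ℂ)
  have i2 := (hv.iteratedDeriv_three_hInf.integrable_mul hb).const_mul (α : ℂ)
  have i3 := (hv.integrable_mul hb.deriv).const_mul (β : ℂ)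
  have i4 := (hv.deriv.integrable_mul hb).const_mul (β : ℂ)
  have i5 := (hu.mul hv).deriv.integrable_mul hb
  have : ∀ x, ((-α * iteratedDeriv 3 v x - β * deriv v x - deriv (fun y => u y * v y) x) * b x
      + v x * (-α * iteratedDeriv 3 b x - β * deriv b x)) =
      (-(α * (iteratedDeriv 3 v x * b x)) - α * (v x * iteratedDeriv 3 b x)) -
      (β * (deriv v x * b x) + β * (v x * deriv b x)) - deriv (fun y => u y * v y) x * b x := by
    intro x; ring
  simp_rw [this]
  have j2 : Integrable fun x => -(α * (iteratedDeriv 3 v x * b x)) := i2.neg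
  have j1 : Integrable fun x => -(α * (iteratedDeriv 3 v x * b x)) -
    α * (v x * iteratedDeriv 3 b x) := j2.sub i1
  have j3 : Integrable fun x => β * (deriv v x * b x) + β * (v x * deriv b x) := i4.add i3
  have j4 : Integrable fun x => (-(α * (iteratedDeriv 3 v x * b x)) -
    α * (v x * iteratedDeriv 3 b x)) - (β * (deriv v x * b x) + β * (v x * deriv b x)) :=
    j1.sub j3
  rw [integral_sub j4 i5, integral_sub j1 j3, integral_sub j2 i1, integral_add i4 i3, integral_neg, integral_const_mul,
    integral_const_mul, integral_const_mul, integral_const_mul, h1, h2, h3]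
  ring

theorem integral_mul_self_of_real (hu : MemLp u 2 volume) (h : ∀ x, (u x).im = 0) :
    ∫ x, u x * u x = ((l2 u ^ 2 : ℝ) : ℂ) := by
  rw [l2_sq hu, ← integral_complex_ofReal]
  congr 1
  ext x
  have : u x = (u x).re := Complex.ext rfl (by simp [h x])
  rw [this, ← Complex.ofReal_mul, Complex.norm_real, Real.norm_eq_abs, sq_abs, sq]

end space

namespace IsSmoothSolution

variable {α β T : ℝ} {u v : ℝ → ℝ → ℂ}

theorem integral_u_mul (hs : IsSmoothSolution α β T u v) (hT : 0 < T) {b : ℝ → ℝ → ℂ}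
    (hb : LinFlow 1 0 b) {t : ℝ} (ht : t ∈ Icc 0 T) :
    ∫ x, u t x * b t x = (∫ x, u 0 x * b 0 x) +
      ∫ τ in 0..t, 1 / 2 * ∫ x, v τ x * v τ x * deriv (b τ) x := by
  rw [← sub_eq_iff_eq_add', (hs.timeReg_u hT).integral_mul_sub (hb.timeReg T) ht]
  refine intervalIntegral.integral_congr fun τ hτ => ?_
  rw [uIcc_of_le ht.1] at hτ
  have hτ' : τ ∈ Icc 0 T := ⟨hτ.1, hτ.2.trans ht.2⟩
  exact integral_flux_u (hs.curve_u.hInf hτ') (hs.curve_v.hInf hτ') (hb.hInf τ)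

theorem integral_v_mul (hs : IsSmoothSolution α β T u v) (hT : 0 < T) {b : ℝ → ℝ → ℂ}
    (hb : LinFlow α β b) {t : ℝ} (ht : t ∈ Icc 0 T) :
    ∫ x, v t x * b t x = (∫ x, v 0 x * b 0 x) +
      ∫ τ in 0..t, ∫ x, u τ x * v τ x * deriv (b τ) x := by
  rw [← sub_eq_iff_eq_add', (hs.timeReg_v hT).integral_mul_sub (hb.timeReg T) ht]
  refine intervalIntegral.integral_congr fun τ hτ => ?_
  rw [uIcc_of_le ht.1] at hτ
  have hτ' : τ ∈ Icc 0 T := ⟨hτ.1, hτ.2.trans ht.2⟩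
  exact integral_flux_v α β (hs.curve_u.hInf hτ') (hs.curve_v.hInf hτ') (hb.hInf τ)

theorem integral_sq_add (hs : IsSmoothSolution α β T u v) (hT : 0 < T) {t : ℝ}
    (ht : t ∈ Icc 0 T) :
    (∫ x, u t x * u t x) + ∫ x, v t x * v t x =
      (∫ x, u 0 x * u 0 x) + ∫ x, v 0 x * v 0 x := by
  have h1 := (hs.timeReg_u hT).integral_mul_sub (hs.timeReg_u hT) ht
  have h2 := (hs.timeReg_v hT).integral_mul_sub (hs.timeReg_v hT) ht
  -- The energy flux out of u is the flux into v: -∫ u v v_x from the first equation cancels -∫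
  -- (uv)_x v from the second after one integration by parts.
  have h3 : ∀ τ ∈ uIcc 0 t,
      ∫ x, ((-iteratedDeriv 3 (u τ) x - v τ x * deriv (v τ) x) * u τ x +
        u τ x * (-iteratedDeriv 3 (u τ) x - v τ x * deriv (v τ) x)) =
      -∫ x, ((-α * iteratedDeriv 3 (v τ) x - β * deriv (v τ) x
          - deriv (fun y => u τ y * v τ y) x) * v τ x +
        v τ x * (-α * iteratedDeriv 3 (v τ) x - β * deriv (v τ) x
          - deriv (fun y => u τ y * v τ y) x)) := by
    intro τ hτ
    rw [uIcc_of_le ht.1] at hτ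
    have hτ' : τ ∈ Icc 0 T := ⟨hτ.1, hτ.2.trans ht.2⟩
    have hu := hs.curve_u.hInf hτ'
    have hv := hs.curve_v.hInf hτ'
    have e1 := integral_flux_u hu hv hu
    have e2 := integral_flux_v α β hu hv hv
    have e3 := hv.integral_mul_deriv_mul hu
    have e4 := (hu.mul hv).integral_mul_deriv hv
    have e5 : ∫ x, u τ x * v τ x * deriv (v τ) x = ∫ x, v τ x * deriv (v τ) x * u τ x :=
      integral_congr_ae (.of_forall fun x => by simp only; ring)
    have i1 := (hv.mul hv.deriv).integrable_mul hu
    have i2 := (hu.mul hv).deriv.integrable_mul hv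
    -- The flux identities expect a second factor with linear time derivative, so the nonlinear part
    -- of the derivative of the second factor is split off here and below.
    have f1 : ∀ x, ((-iteratedDeriv 3 (u τ) x - v τ x * deriv (v τ) x) * u τ x +
        u τ x * (-iteratedDeriv 3 (u τ) x - v τ x * deriv (v τ) x)) =
        ((-iteratedDeriv 3 (u τ) x - v τ x * deriv (v τ) x) * u τ x + u τ x *
      (-((1 : ℝ) : ℂ) * iteratedDeriv 3 (u τ) x - ((0 : ℝ) : ℂ) * deriv (u τ) x)) -
        v τ x * deriv (v τ) x * u τ x := by
      intro x; push_cast; ring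
    have f2 : ∀ x, ((-α * iteratedDeriv 3 (v τ) x - β * deriv (v τ) x
          - deriv (fun y => u τ y * v τ y) x) * v τ x +
        v τ x * (-α * iteratedDeriv 3 (v τ) x - β * deriv (v τ) x
          - deriv (fun y => u τ y * v τ y) x)) =
        ((-α * iteratedDeriv 3 (v τ) x - β * deriv (v τ) x
          - deriv (fun y => u τ y * v τ y) x) * v τ x +
        v τ x * (-α * iteratedDeriv 3 (v τ) x - β * deriv (v τ) x)) -
          deriv (fun y => u τ y * v τ y) x * v τ x := by
      intro x; ring
    have j1 : Integrable fun x => ((-iteratedDeriv 3 (u τ) x - v τ x * deriv (v τ) x) * u τ x +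
        u τ x * (-((1 : ℝ) : ℂ) * iteratedDeriv 3 (u τ) x - ((0 : ℝ) : ℂ) * deriv (u τ) x)) :=
      ((hu.iteratedDeriv_three_hInf.neg.sub (hv.mul hv.deriv)).integrable_mul hu).add
        (hu.integrable_mul ((hu.iteratedDeriv_three_hInf.const_smul (-((1 : ℝ) : ℂ))).sub
          (hu.deriv.const_smul _)))
    have j2 : Integrable fun x => ((-α * iteratedDeriv 3 (v τ) x - β * deriv (v τ) x
          - deriv (fun y => u τ y * v τ y) x) * v τ x +
        v τ x * (-α * iteratedDeriv 3 (v τ) x - β * deriv (v τ) x)) := by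
      have k := (hv.iteratedDeriv_three_hInf.const_smul (-α)).sub (hv.deriv.const_smul β)
      exact ((k.sub (hu.mul hv).deriv).integrable_mul hv).add (hv.integrable_mul k)
    simp_rw [f1, f2]
    rw [integral_sub j1 i1, integral_sub j2 i2, e1, e2, e3, e5, e3]
    rw [e5, e3] at e4
    linear_combination -e4
  rw [intervalIntegral.integral_congr h3, intervalIntegral.integral_neg] at h1
  linear_combination h1 + h2

/-- The conserved quantity is ∫u² + ∫v² without absolute values; it controls the L² norm only for
real solutions, which is why real data are used even in the complex setting. -/
theorem l2_sq_add (hs : IsSmoothSolution α β T u v) (hT : 0 < T)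
    (hu : ∀ t ∈ Icc 0 T, ∀ x, (u t x).im = 0) (hv : ∀ t ∈ Icc 0 T, ∀ x, (v t x).im = 0) {t : ℝ}
    (ht : t ∈ Icc 0 T) : l2 (u t) ^ 2 + l2 (v t) ^ 2 = l2 (u 0) ^ 2 + l2 (v 0) ^ 2 := by
  have h0 : (0 : ℝ) ∈ Icc 0 T := ⟨le_rfl, hT.le⟩
  have h := hs.integral_sq_add hT ht
  rw [integral_mul_self_of_real (hs.curve_u.hInf ht).memLp_zero (hu t ht),
    integral_mul_self_of_real (hs.curve_v.hInf ht).memLp_zero (hv t ht),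
    integral_mul_self_of_real (hs.curve_u.hInf h0).memLp_zero (hu 0 h0),
    integral_mul_self_of_real (hs.curve_v.hInf h0).memLp_zero (hv 0 h0)] at h
  exact_mod_cast h

end IsSmoothSolution

end MajdaBiello
end

/-! ### Oscillatory integrals for the second and third order terms. -/

noncomputable section

namespace MajdaBiello

open FourierTransform

/-- A function on the frequency side that is the Fourier transform of a real function. -/
def IsHermitian (k : ℝ → ℂ) : Prop := ∀ ξ, k (-ξ) = (starRingEnd ℂ) (k ξ)

theorem IsHermitian.phased {k : ℝ → ℂ} (hk : IsHermitian k) (α β t : ℝ) :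
    IsHermitian (phased α β k t) := by
  intro ξ
  rw [MajdaBiello.phased, MajdaBiello.phased, map_mul, ← hk ξ, ← Complex.exp_conj, disp_neg]
  simp

theorem packet_im {k : ℝ → ℂ} (hk : IsHermitian k) (α β t x : ℝ) :
    (packet α β k t x).im = 0 := by
  rw [← Complex.conj_eq_iff_im, packet_eq, ← integral_conj, ← integral_neg_eq_self]
  congr 1
  ext ξ
  rw [map_mul, hk.phased α β t ξ, Complex.conj_conj, ← Complex.exp_conj]
  simp [map_ofNat]

theorem IsProfile.exists_bound {k : ℝ → ℂ} (hk : IsProfile k) :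
    ∃ R : ℝ, 0 < R ∧ (∀ ξ, ‖k ξ‖ ≤ R) ∧ ∀ ξ, R < |ξ| → k ξ = 0 := by
  obtain ⟨C, hC⟩ := hk.continuous.bounded_above_of_compact_support hk.hasCompactSupport
  obtain ⟨R, hR⟩ := hk.hasCompactSupport.isCompact.isBounded.subset_closedBall 0
  refine ⟨max (max C R) 1, by positivity, fun ξ => (hC ξ).trans (by simp), fun ξ hξ => ?_⟩
  by_contra h
  have h1 := hR (subset_tsupport k h)
  rw [mem_closedBall_zero_iff, Real.norm_eq_abs] at h1
  have h2 : R ≤ max (max C R) 1 := by simp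
  linarith

/-- The time integral of an oscillating exponential of frequency `r`. -/
def osc (t r : ℝ) : ℂ := ∫ τ in 0..t, Complex.exp ((τ * r : ℝ) * Complex.I)

theorem norm_osc_le {t : ℝ} (ht : 0 ≤ t) (r : ℝ) : ‖osc t r‖ ≤ t := by
  have := intervalIntegral.norm_integral_le_of_norm_le_const (a := 0) (b := t) (C := 1)
    (f := fun τ : ℝ => Complex.exp ((τ * r : ℝ) * Complex.I))
    fun τ _ => (Complex.norm_exp_ofReal_mul_I _).le
  rwa [one_mul, sub_zero, abs_of_nonneg ht] at this

theorem mul_osc (t r : ℝ) :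
    (r * Complex.I) * osc t r = Complex.exp ((t * r : ℝ) * Complex.I) - 1 := by
  rw [osc, ← intervalIntegral.integral_const_mul]
  have hd : ∀ τ ∈ uIcc 0 t, HasDerivAt (fun τ : ℝ => Complex.exp ((τ * r : ℝ) * Complex.I))
      ((r * Complex.I) * Complex.exp ((τ * r : ℝ) * Complex.I)) τ := by
    intro τ _
    have h := ((hasDerivAt_id τ).mul_const r).ofReal_comp.mul_const Complex.I
    simp only [id_eq, one_mul] at h
    simpa [mul_comm] using h.cexp
  rw [intervalIntegral.integral_eq_sub_of_hasDerivAt hd]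
  · simp
  · exact Continuous.intervalIntegrable (by fun_prop) _ _

theorem abs_mul_norm_osc_le (t r : ℝ) : |r| * ‖osc t r‖ ≤ 2 := by
  have h := congrArg norm (mul_osc t r)
  rw [norm_mul, norm_mul, Complex.norm_I, mul_one, Complex.norm_real, Real.norm_eq_abs] at h
  rw [h]
  refine (norm_sub_le _ _).trans ?_
  rw [Complex.norm_exp_ofReal_mul_I, norm_one]
  norm_num

theorem continuous_osc : Continuous fun p : ℝ × ℝ => osc p.1 p.2 := by
  unfold osc
  exact intervalIntegral.continuous_parametric_intervalIntegral_of_continuous (μ := volume)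
    (f := fun (p : ℝ × ℝ) (τ : ℝ) => Complex.exp ((τ * p.2 : ℝ) * Complex.I))
    (by fun_prop) continuous_fst

section bilinear

variable (α β : ℝ) {f g h : ℝ → ℂ}

/-- The phase of the interaction of frequencies `η` (of `v`) and `-ζ-η` (of `u`). -/
def phaseUV (z : ℝ × ℝ) : ℝ := disp α β z.1 + disp α β z.2 + disp 1 0 (-z.1 - z.2)

/-- The amplitude of the interaction of `u` and `v`, tested against `h`. -/
def ampUV (f g h : ℝ → ℂ) (z : ℝ × ℝ) : ℂ :=
  (2 * Real.pi * Complex.I * z.1) * h z.1 * (g z.2 * f (-z.1 - z.2))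

theorem continuous_phaseUV : Continuous (phaseUV α β) := by
  unfold phaseUV disp; fun_prop

theorem continuous_ampUV (hf : IsProfile f) (hg : IsProfile g) (hh : IsProfile h) :
    Continuous (ampUV f g h) := by
  have h1 := hf.continuous
  have h2 := hg.continuous
  have h3 := hh.continuous
  unfold ampUV; fun_prop

theorem integrable_ampUV (hf : IsProfile f) (hg : IsProfile g) (hh : IsProfile h) :
    Integrable (ampUV f g h) := by
  refine (continuous_ampUV hf hg hh).integrable_of_hasCompactSupport ?_
  refine HasCompactSupport.of_support_subset_isCompact
    (hh.hasCompactSupport.isCompact.prod hg.hasCompactSupport.isCompact) fun z hz => ⟨?_, ?_⟩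
  · exact subset_tsupport h fun h0 => hz (by simp [ampUV, h0])
  · exact subset_tsupport g fun h0 => hz (by simp [ampUV, h0])

theorem integrable_exp_mul {X : Type*} [TopologicalSpace X] [MeasurableSpace X] [BorelSpace X]
    {μ : Measure X} {H : X → ℂ} {Ω : X → ℝ} (hH : Integrable H μ) (hΩ : Continuous Ω) :
    Integrable (fun z => H z * Complex.exp ((Ω z : ℝ) * Complex.I)) μ := by
  refine hH.mul_bdd (c := 1) (Continuous.aestronglyMeasurable (by fun_prop))
    (.of_forall fun z => (Complex.norm_exp_ofReal_mul_I _).le)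

/-- The triple product formula with the moduli of the profiles kept apart from their phases: time
enters only through exp(it·`phaseUV`), so the time integral becomes `osc`. -/
theorem integral_packet_uv (hf : IsProfile f) (hg : IsProfile g) (hh : IsProfile h) (t : ℝ) :
    ∫ x, packet 1 0 f t x * packet α β g t x * deriv (packet α β h t) x =
      ∫ z, ampUV f g h z * Complex.exp ((t * phaseUV α β z : ℝ) * Complex.I) := by
  have hc : Continuous fun z => t * phaseUV α β z := continuous_const.mul (continuous_phaseUV α β)
  rw [Measure.volume_eq_prod, integral_prod _ (integrable_exp_mul (integrable_ampUV hf hg hh) hc),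
    deriv_packet α β hh]
  simp_rw [mul_comm (packet 1 0 f t _)]
  unfold packet
  rw [integral_fourierInv_triple (hg.phased α β t) (hf.phased 1 0 t) (hh.symbol_mul.phased α β t)]
  congr 1
  ext ζ
  congr 1
  ext η
  unfold phased ampUV phaseUV
  push_cast
  rw [mul_add, mul_add, add_mul, add_mul, Complex.exp_add, Complex.exp_add]
  ring

theorem integral_integral_packet_uv (hf : IsProfile f) (hg : IsProfile g) (hh : IsProfile h)
    {T : ℝ} (hT : 0 ≤ T) :
    ∫ t in 0..T, ∫ x, packet 1 0 f t x * packet α β g t x * deriv (packet α β h t) x =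
      ∫ z, ampUV f g h z * osc T (phaseUV α β z) := by
  simp_rw [integral_packet_uv α β hf hg hh]
  have hfin : IsFiniteMeasure (volume.restrict (uIoc 0 T)) := ⟨by rw [uIoc_of_le hT]; simp⟩
  rw [intervalIntegral_integral_swap]
  · simp_rw [intervalIntegral.integral_const_mul]
    rfl
  · have h1 : Integrable (fun p : ℝ × ℝ × ℝ => ampUV f g h p.2)
        ((volume.restrict (uIoc 0 T)).prod volume) := (integrable_ampUV hf hg hh).comp_snd _
    have h2 := continuous_phaseUV α β
    exact integrable_exp_mul h1 (Ω := fun p : ℝ × ℝ × ℝ => p.1 * phaseUV α β p.2) (by fun_prop)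

end bilinear

section trilinear

variable (α β : ℝ) {g h : ℝ → ℂ}

/-- The phase of the interaction of two frequencies `η`, `-ξ-η` of `v` that produces `u`. -/
def phaseVV (z : ℝ × ℝ × ℝ) : ℝ :=
  disp α β z.2.1 + disp α β (-z.1 - z.2.1) + disp 1 0 z.1

/-- The phase of the interaction of the frequency `w` of `v` with a frequency of `u`, tested
against the frequency `ξ-w`. -/
def phaseUV' (z : ℝ × ℝ × ℝ) : ℝ := disp α β z.2.2 + disp α β (z.1 - z.2.2) - disp 1 0 z.1

/-- The amplitude of the cubic interaction of `v` with itself, tested against `h`. -/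
def ampVVV (g h : ℝ → ℂ) (z : ℝ × ℝ × ℝ) : ℂ :=
  (2 * Real.pi * Complex.I * z.1) * (g z.2.1 * g (-z.1 - z.2.1)) *
    (g z.2.2 * ((2 * Real.pi * Complex.I * (z.1 - z.2.2 : ℝ)) * h (z.1 - z.2.2)))

theorem continuous_phaseVV : Continuous (phaseVV α β) := by
  unfold phaseVV disp; fun_prop

theorem continuous_phaseUV' : Continuous (phaseUV' α β) := by
  unfold phaseUV' disp; fun_prop

theorem integrable_ampVVV (hg : IsProfile g) (hh : IsProfile h) : Integrable (ampVVV g h) := by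
  have h2 := hg.continuous
  have h3 := hh.continuous
  have hc : Continuous (ampVVV g h) := by unfold ampVVV; fun_prop
  obtain ⟨R, -, -, hR⟩ := hg.exists_bound
  have hR' : ∀ ξ, g ξ ≠ 0 → |ξ| ≤ R := fun ξ hξ => not_lt.1 fun h => hξ (hR ξ h)
  refine hc.integrable_of_hasCompactSupport (HasCompactSupport.of_support_subset_isCompact
    ((isCompact_Icc (a := -(2 * R)) (b := 2 * R)).prod
      ((isCompact_Icc (a := -R) (b := R)).prod (isCompact_Icc (a := -R) (b := R)))) ?_)
  rintro ⟨ξ, η, w⟩ hz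
  have e1 := abs_le.1 (hR' η fun h0 => hz (by simp [ampVVV, h0]))
  have e2 := abs_le.1 (hR' w fun h0 => hz (by simp [ampVVV, h0]))
  have e3 := abs_le.1 (hR' (-ξ - η) fun h0 => hz (by simp [ampVVV, h0]))
  exact ⟨⟨by simp only; linarith, by simp only; linarith⟩, e1, e2⟩

/-- The Fourier transform at time `0` of the solution of `w_t + w_xxx = 0` that agrees at time `τ`
with the product of the solutions of `w_t + α w_xxx + β w_x = 0` given by `g` and `∂h`. -/
def backProfile (g h : ℝ → ℂ) (τ : ℝ) : ℝ → ℂ :=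
  phased 1 0 (conv (phased α β g τ)
    (phased α β (fun ξ : ℝ => (2 * Real.pi * Complex.I * ξ) * h ξ) τ)) (-τ)

theorem isProfile_backProfile (hg : IsProfile g) (hh : IsProfile h) (τ : ℝ) :
    IsProfile (backProfile α β g h τ) :=
  ((hg.phased α β τ).conv (hh.symbol_mul.phased α β τ)).phased 1 0 (-τ)

/-- The product on the right solves no linear equation, but at each fixed τ it is the value at time
τ of an Airy flow. Pairing u(τ) with it therefore falls under `IsSmoothSolution.integral_u_mul`,
which replaces u by its quadratic source. -/
theorem packet_backProfile (hg : IsProfile g) (hh : IsProfile h) (τ x : ℝ) :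
    packet 1 0 (backProfile α β g h τ) τ x =
      packet α β g τ x * deriv (packet α β h τ) x := by
  rw [deriv_packet α β hh, packet, packet, packet,
    fourierInv_mul_fourierInv (hg.phased α β τ) (hh.symbol_mul.phased α β τ)]
  refine congrArg (fun l : ℝ → ℂ => 𝓕⁻ l x) (funext fun ξ => ?_)
  rw [backProfile, phased, phased, ← mul_assoc, ← Complex.exp_add]
  simp

/-- Here ξ is the frequency carried by the intermediate u. The phase separates: σ, the time of the
first interaction, multiplies `phaseVV`, and τ, the time of the second, multiplies `phaseUV'`; the
integrals over 0 < σ < τ < T then produce `doubleOsc`. -/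
theorem integral_packet_vv_back (hg : IsProfile g) (hh : IsProfile h) (σ τ : ℝ) :
    ∫ x, packet α β g σ x * packet α β g σ x *
        deriv (packet 1 0 (backProfile α β g h τ) σ) x =
      ∫ z, ampVVV g h z * Complex.exp ((σ * phaseVV α β z + τ * phaseUV' α β z : ℝ) *
        Complex.I) := by
  have hc : Continuous fun z => σ * phaseVV α β z + τ * phaseUV' α β z :=
    (continuous_const.mul (continuous_phaseVV α β)).add
      (continuous_const.mul (continuous_phaseUV' α β))
  have hi := integrable_exp_mul (integrable_ampVVV hg hh) hc
  have hb := isProfile_backProfile α β hg hh τ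
  rw [Measure.volume_eq_prod] at hi
  rw [Measure.volume_eq_prod, integral_prod _ hi, deriv_packet 1 0 hb]
  unfold packet
  rw [integral_fourierInv_triple (hg.phased α β σ) (hg.phased α β σ) (hb.symbol_mul.phased 1 0 σ)]
  refine integral_congr_ae (hi.prod_right_ae.mono fun ξ hξ => ?_)
  simp only
  rw [Measure.volume_eq_prod] at hξ
  rw [Measure.volume_eq_prod, integral_prod _ hξ]
  congr 1
  ext η
  rw [phased, backProfile, phased, conv, mul_comm (_ * _) (phased α β g σ η * _), ← mul_assoc,
    ← mul_assoc, ← mul_assoc, ← integral_const_mul]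
  congr 1
  ext w
  unfold phased ampVVV phaseVV phaseUV'
  push_cast
  have he : ((σ : ℂ) * (disp α β η + disp α β (-ξ - η) + disp 1 0 ξ) +
      τ * (disp α β w + disp α β (ξ - w) - disp 1 0 ξ)) * Complex.I =
      σ * disp α β η * Complex.I + σ * disp α β (-ξ - η) * Complex.I +
      σ * disp 1 0 ξ * Complex.I + -τ * disp 1 0 ξ * Complex.I +
      τ * disp α β w * Complex.I + τ * disp α β (ξ - w) * Complex.I := by ring
  rw [he, Complex.exp_add, Complex.exp_add, Complex.exp_add, Complex.exp_add, Complex.exp_add]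
  ring

/-- The third order term of the solution, tested against `h`, before the last time integration. -/
def cubicDensity (g h : ℝ → ℂ) (τ : ℝ) : ℂ :=
  ∫ z, ampVVV g h z * (osc τ (phaseVV α β z) *
    Complex.exp ((τ * phaseUV' α β z : ℝ) * Complex.I))

theorem integral_cubicDensity (hg : IsProfile g) (hh : IsProfile h) {τ : ℝ} (hτ : 0 ≤ τ) :
    ∫ σ in 0..τ, ∫ x, packet α β g σ x * packet α β g σ x *
        deriv (packet 1 0 (backProfile α β g h τ) σ) x = cubicDensity α β g h τ := by
  simp_rw [integral_packet_vv_back α β hg hh]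
  have hfin : IsFiniteMeasure (volume.restrict (uIoc 0 τ)) := ⟨by rw [uIoc_of_le hτ]; simp⟩
  rw [intervalIntegral_integral_swap]
  · rw [cubicDensity]
    congr 1
    ext z
    rw [intervalIntegral.integral_const_mul, osc, ← intervalIntegral.integral_mul_const]
    congr 1
    refine intervalIntegral.integral_congr fun σ _ => ?_
    push_cast
    rw [add_mul, Complex.exp_add]
  · have h1 : Integrable (fun p : ℝ × ℝ × ℝ × ℝ => ampVVV g h p.2)
        ((volume.restrict (uIoc 0 τ)).prod volume) := (integrable_ampVVV hg hh).comp_snd _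
    have h2 := continuous_phaseVV α β
    have h3 := continuous_phaseUV' α β
    exact integrable_exp_mul h1
      (Ω := fun p : ℝ × ℝ × ℝ × ℝ => p.1 * phaseVV α β p.2 + τ * phaseUV' α β p.2) (by fun_prop)

theorem norm_cubicIntegrand_le {T τ : ℝ} (hτ : τ ∈ Icc 0 T) (z : ℝ × ℝ × ℝ) :
    ‖osc τ (phaseVV α β z) * Complex.exp ((τ * phaseUV' α β z : ℝ) * Complex.I)‖ ≤ T := by
  rw [norm_mul, Complex.norm_exp_ofReal_mul_I, mul_one]
  exact (norm_osc_le hτ.1 _).trans hτ.2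

theorem continuous_cubicIntegrand : Continuous fun p : ℝ × ℝ × ℝ × ℝ =>
    osc p.1 (phaseVV α β p.2) * Complex.exp ((p.1 * phaseUV' α β p.2 : ℝ) * Complex.I) := by
  have h2 := continuous_phaseVV α β
  have h3 := continuous_phaseUV' α β
  have h4 : Continuous fun p : ℝ × ℝ × ℝ × ℝ => osc p.1 (phaseVV α β p.2) :=
    continuous_osc.comp (continuous_fst.prodMk (h2.comp continuous_snd))
  fun_prop

theorem integrable_cubicIntegrand (hg : IsProfile g) (hh : IsProfile h) {T : ℝ} (hT : 0 ≤ T) :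
    Integrable (fun p : ℝ × ℝ × ℝ × ℝ => ampVVV g h p.2 * (osc p.1 (phaseVV α β p.2) *
      Complex.exp ((p.1 * phaseUV' α β p.2 : ℝ) * Complex.I)))
      ((volume.restrict (uIoc 0 T)).prod volume) := by
  have hfin : IsFiniteMeasure (volume.restrict (uIoc 0 T)) := ⟨by rw [uIoc_of_le hT]; simp⟩
  have h1 : Integrable (fun p : ℝ × ℝ × ℝ × ℝ => ampVVV g h p.2)
      ((volume.restrict (uIoc 0 T)).prod volume) := (integrable_ampVVV hg hh).comp_snd _
  refine h1.mul_bdd (c := T) (continuous_cubicIntegrand α β).aestronglyMeasurable ?_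
  refine (Measure.quasiMeasurePreserving_fst.ae (p := fun τ => τ ∈ uIoc 0 T)
    (ae_restrict_mem measurableSet_uIoc)).mono fun p hp => ?_
  rw [uIoc_of_le hT] at hp
  exact norm_cubicIntegrand_le α β ⟨hp.1.le, hp.2⟩ p.2

theorem intervalIntegrable_cubicDensity (hg : IsProfile g) (hh : IsProfile h) {T : ℝ}
    (hT : 0 ≤ T) : IntervalIntegrable (cubicDensity α β g h) volume 0 T := by
  rw [intervalIntegrable_iff]
  exact (integrable_cubicIntegrand α β hg hh hT).integral_prod_left

/-- The oscillatory factor of the third order term. -/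
def doubleOsc (T ψ l : ℝ) : ℂ :=
  ∫ τ in 0..T, osc τ ψ * Complex.exp ((τ * l : ℝ) * Complex.I)

theorem integral_integral_cubicDensity (hg : IsProfile g) (hh : IsProfile h) {T : ℝ}
    (hT : 0 ≤ T) : ∫ τ in 0..T, cubicDensity α β g h τ =
      ∫ z, ampVVV g h z * doubleOsc T (phaseVV α β z) (phaseUV' α β z) := by
  unfold cubicDensity
  rw [intervalIntegral_integral_swap]
  · simp_rw [intervalIntegral.integral_const_mul]
    rfl
  · exact integrable_cubicIntegrand α β hg hh hT

end trilinear

end MajdaBiello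
end

/-! ### Energy estimate and expansion in the size of the data. -/

noncomputable section

namespace MajdaBiello

section triple

variable {a b c : ℝ → ℂ} {K : ℝ}

theorem integrable_triple (ha : MemLp a 2 volume) (hb : MemLp b 2 volume) (hc : Continuous c)
    (hK : ∀ x, ‖c x‖ ≤ K) : Integrable fun x => a x * b x * c x := by
  simp_rw [mul_assoc]
  exact integrable_mul_of_memLp ha (memLp_mul_of_bdd hb hc hK)

theorem integral_norm_triple_le (ha : MemLp a 2 volume) (hb : MemLp b 2 volume)
    (hc : Continuous c) (hK : ∀ x, ‖c x‖ ≤ K) :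
    ∫ x, ‖a x * b x * c x‖ ≤ K * (l2 a * l2 b) := by
  simp_rw [mul_assoc]
  refine (integral_norm_mul_le ha (memLp_mul_of_bdd hb hc hK)).trans ?_
  have := mul_le_mul_of_nonneg_left (l2_mul_le_of_bdd hb hK) (l2_nonneg a)
  linarith

theorem norm_integral_triple_le {A B : ℝ} (ha : MemLp a 2 volume) (hb : MemLp b 2 volume)
    (hc : Continuous c) (hK : ∀ x, ‖c x‖ ≤ K) (hA : l2 a ≤ A) (hB : l2 b ≤ B) :
    ‖∫ x, a x * b x * c x‖ ≤ K * (A * B) := by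
  have hK0 : 0 ≤ K := (norm_nonneg _).trans (hK 0)
  have hA0 : 0 ≤ A := (l2_nonneg _).trans hA
  refine ((norm_integral_le_integral_norm _).trans (integral_norm_triple_le ha hb hc hK)).trans ?_
  have := l2_nonneg b
  gcongr

/-- From ab - a₀b₀ = (a - a₀)b + a₀(b - b₀), with the third factor bounded uniformly. -/
theorem norm_integral_product_sub_le {a₀ b₀ : ℝ → ℂ} {A B E F : ℝ} (ha : MemLp a 2 volume)
    (hb : MemLp b 2 volume) (ha₀ : MemLp a₀ 2 volume) (hb₀ : MemLp b₀ 2 volume)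
    (hc : Continuous c) (hK : ∀ x, ‖c x‖ ≤ K) (hE : l2 (a - a₀) ≤ E) (hF : l2 (b - b₀) ≤ F)
    (hA : l2 a₀ ≤ A) (hB : l2 b ≤ B) :
    ‖(∫ x, a x * b x * c x) - ∫ x, a₀ x * b₀ x * c x‖ ≤ K * (E * B) + K * (A * F) := by
  have h1 : (∫ x, a x * b x * c x) - ∫ x, a₀ x * b₀ x * c x =
      (∫ x, (a - a₀) x * b x * c x) + ∫ x, a₀ x * (b - b₀) x * c x := by
    rw [← integral_sub (integrable_triple ha hb hc hK) (integrable_triple ha₀ hb₀ hc hK),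
      ← integral_add (integrable_triple (ha.sub ha₀) hb hc hK)
        (integrable_triple ha₀ (hb.sub hb₀) hc hK)]
    congr 1
    ext x
    simp only [Pi.sub_apply]
    ring
  rw [h1]
  exact (norm_add_le _ _).trans (add_le_add
    (norm_integral_triple_le (ha.sub ha₀) hb hc hK hE hB)
    (norm_integral_triple_le ha₀ (hb.sub hb₀) hc hK hA hF))

theorem intervalIntegrable_triple {T A B : ℝ} {a b c : ℝ → ℝ → ℂ}
    (ha : ContinuousOn (fun p : ℝ × ℝ => a p.1 p.2) (Icc 0 T ×ˢ univ))
    (hb : ContinuousOn (fun p : ℝ × ℝ => b p.1 p.2) (Icc 0 T ×ˢ univ))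
    (hc : Continuous fun p : ℝ × ℝ => c p.1 p.2)
    (ha2 : ∀ t ∈ Icc 0 T, MemLp (a t) 2 volume) (hb2 : ∀ t ∈ Icc 0 T, MemLp (b t) 2 volume)
    (hA : ∀ t ∈ Icc 0 T, l2 (a t) ≤ A) (hB : ∀ t ∈ Icc 0 T, l2 (b t) ≤ B)
    (hK : ∀ t x, ‖c t x‖ ≤ K) {t : ℝ} (ht : t ∈ Icc 0 T) :
    IntervalIntegrable (fun τ => ∫ x, a τ x * b τ x * c τ x) volume 0 t := by
  have hc' : ∀ τ, Continuous (c τ) := fun τ => hc.comp (by fun_prop : Continuous fun x => (τ, x))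
  refine intervalIntegrable_integral_of_continuousOn (C := K * (A * B))
    (F := fun τ x => a τ x * b τ x * c τ x) ((ha.mul hb).mul hc.continuousOn)
    (fun τ hτ => integrable_triple (ha2 τ hτ) (hb2 τ hτ) (hc' τ) (hK τ))
    (fun τ hτ => (integral_norm_triple_le (ha2 τ hτ) (hb2 τ hτ) (hc' τ) (hK τ)).trans ?_) ht
  have hK0 : 0 ≤ K := (norm_nonneg _).trans (hK 0 0)
  have h1 := hA τ hτ
  have h2 := hB τ hτ
  have h3 := l2_nonneg (b τ)
  have h4 := (l2_nonneg _).trans h1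
  gcongr

end triple

/-- A bound for the space derivative of all packets with profile `k`. -/
def derivBound (k : ℝ → ℂ) : ℝ := ∫ ξ : ℝ, ‖(2 * Real.pi * Complex.I * ξ) * k ξ‖

theorem derivBound_nonneg (k : ℝ → ℂ) : 0 ≤ derivBound k := integral_nonneg fun _ => norm_nonneg _

theorem norm_deriv_packet_le {k : ℝ → ℂ} (hk : IsProfile k) (α β t x : ℝ) :
    ‖deriv (packet α β k t) x‖ ≤ derivBound k := by
  rw [deriv_packet α β hk]
  exact norm_packet_le α β _ t x

/-- The phases have modulus one, so the convolution has a bound and a support that do not depend on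
τ. -/
theorem exists_derivBound_backProfile (α β : ℝ) {g h : ℝ → ℂ} (hg : IsProfile g)
    (hh : IsProfile h) : ∃ K, ∀ τ, derivBound (backProfile α β g h τ) ≤ K := by
  obtain ⟨R, hR0, hgR, hg0⟩ := hg.exists_bound
  obtain ⟨S, hS0, hhS, hh0⟩ := hh.symbol_mul.exists_bound
  refine ⟨∫ ξ, (Icc (-(R + S)) (R + S)).indicator
    (fun _ => 2 * Real.pi * (R + S) * (∫ η, ‖g η‖ * S)) ξ, fun τ => ?_⟩
  refine integral_mono (isProfile_backProfile α β hg hh τ).symbol_mul.integrable.norm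
    ((integrable_indicator_iff measurableSet_Icc).2 continuous_const.integrableOn_Icc) fun ξ => ?_
  simp only
  rw [norm_mul, backProfile, norm_phased]
  have hb : ‖(2 * Real.pi * Complex.I * ξ : ℂ)‖ = 2 * Real.pi * |ξ| := by
    simp [abs_of_pos Real.pi_pos]
  rw [hb]
  by_cases hξ : ξ ∈ Icc (-(R + S)) (R + S)
  · rw [indicator_of_mem hξ]
    have h1 := abs_le.2 hξ
    have h2 : ‖conv (phased α β g τ)
        (phased α β (fun ξ : ℝ => (2 * Real.pi * Complex.I * ξ) * h ξ) τ) ξ‖ ≤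
        ∫ η, ‖g η‖ * S := by
      refine norm_integral_le_of_norm_le (hg.integrable.norm.mul_const S) (.of_forall fun η => ?_)
      rw [norm_mul, norm_phased, norm_phased]
      exact mul_le_mul_of_nonneg_left (hhS _) (norm_nonneg _)
    have := Real.pi_pos
    gcongr
  · rw [indicator_of_notMem hξ]
    refine (mul_eq_zero_of_right _ ?_).le
    rw [norm_eq_zero, conv]
    refine integral_eq_zero_of_ae (.of_forall fun η => ?_)
    have hξ' : R + S < |ξ| := not_le.1 fun h => hξ (abs_le.1 h)
    by_cases hη : R < |η|
    · simp [phased, hg0 η hη]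
    · have : S < |ξ - η| := by
        have := abs_sub_abs_le_abs_sub ξ η
        linarith
      have h0 := hh0 _ this
      simp only [Pi.zero_apply]
      rw [phased, phased, h0]
      simp

/-- `u`, `v` is a real smooth solution whose initial data have the Fourier transforms `εf`,
`εg`. -/
structure IsScaledSolution (α β T : ℝ) (f g : ℝ → ℂ) (ε : ℝ) (u v : ℝ → ℝ → ℂ) : Prop
    extends IsSmoothSolution α β T u v where
  im_u : ∀ t ∈ Icc 0 T, ∀ x, (u t x).im = 0
  im_v : ∀ t ∈ Icc 0 T, ∀ x, (v t x).im = 0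
  init_u : ∀ x, u 0 x = ε * packet 1 0 f 0 x
  init_v : ∀ x, v 0 x = ε * packet α β g 0 x

namespace IsScaledSolution

variable {α β T ε : ℝ} {f g : ℝ → ℂ} {u v : ℝ → ℝ → ℂ}

theorem l2_init (hf : IsProfile f) (hg : IsProfile g)
    (hs : IsScaledSolution α β T f g ε u v) :
    l2 (u 0) = |ε| * l2 f ∧ l2 (v 0) = |ε| * l2 g := by
  have h1 : u 0 = (ε : ℂ) • packet 1 0 f 0 := funext hs.init_u
  have h2 : v 0 = (ε : ℂ) • packet α β g 0 := funext hs.init_v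
  rw [h1, h2, l2_smul, l2_smul, l2_packet 1 0 hf, l2_packet α β hg, Complex.norm_real,
    Real.norm_eq_abs]
  exact ⟨rfl, rfl⟩

theorem l2_sq_le (hf : IsProfile f) (hg : IsProfile g)
    (hs : IsScaledSolution α β T f g ε u v) (hT : 0 < T) {t : ℝ} (ht : t ∈ Icc 0 T) :
    l2 (u t) ≤ |ε| * √(l2 f ^ 2 + l2 g ^ 2) ∧ l2 (v t) ≤ |ε| * √(l2 f ^ 2 + l2 g ^ 2) := by
  have h := hs.l2_sq_add hT hs.im_u hs.im_v ht
  rw [(hs.l2_init hf hg).1, (hs.l2_init hf hg).2] at h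
  have h0 : 0 ≤ l2 f ^ 2 + l2 g ^ 2 := by positivity
  have h1 : (|ε| * √(l2 f ^ 2 + l2 g ^ 2)) ^ 2 = (|ε| * l2 f) ^ 2 + (|ε| * l2 g) ^ 2 := by
    rw [mul_pow, Real.sq_sqrt h0]; ring
  constructor <;> refine le_of_sq_le_sq ?_ (by positivity) <;> nlinarith [sq_nonneg (l2 (u t)), sq_nonneg (l2 (v t))]

/-- Expand the squares. The solution and its linear part both have squared norm ε²(‖f‖² + ‖g‖²) for
all times, so only the cross term varies, and pairing the solution with the linear flow evaluates it
exactly. -/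
theorem energy_eq (hf : IsProfile f) (hg : IsProfile g) (hf' : IsHermitian f)
    (hg' : IsHermitian g) (hs : IsScaledSolution α β T f g ε u v) (hT : 0 < T) {t : ℝ}
    (ht : t ∈ Icc 0 T) :
    ((l2 (u t - (ε : ℂ) • packet 1 0 f t) ^ 2 + l2 (v t - (ε : ℂ) • packet α β g t) ^ 2 : ℝ) : ℂ) =
      -2 * ε * ((∫ τ in 0..t, 1 / 2 * ∫ x, v τ x * v τ x * deriv (packet 1 0 f τ) x) +
        ∫ τ in 0..t, ∫ x, u τ x * v τ x * deriv (packet α β g τ) x) := by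
  have h0 : (0 : ℝ) ∈ Icc 0 T := ⟨le_rfl, hT.le⟩
  have key : ∀ {w p : ℝ → ℂ} {c : ℝ}, HInf w → HInf p → (∀ x, (w x).im = 0) →
      (∀ x, (p x).im = 0) → ((l2 (w - (c : ℂ) • p) ^ 2 : ℝ) : ℂ) =
      (l2 w ^ 2 : ℝ) - 2 * c * (∫ x, w x * p x) + c ^ 2 * (l2 p ^ 2 : ℝ) := by
    intro w p c hw hp hwi hpi
    rw [← integral_mul_self_of_real (hw.sub (hp.const_smul _)).memLp_zero (fun x => by
        simp [hwi x, hpi x]), ← integral_mul_self_of_real hw.memLp_zero hwi,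
      ← integral_mul_self_of_real hp.memLp_zero hpi, ← integral_const_mul, ← integral_const_mul]
    have i1 := hw.integrable_mul hw
    have i2 := (hw.integrable_mul hp).const_mul (2 * c : ℂ)
    have i3 := (hp.integrable_mul hp).const_mul (c ^ 2 : ℂ)
    have i4 : Integrable fun x => w x * w x - 2 * c * (w x * p x) := i1.sub i2
    rw [← integral_sub i1 i2, ← integral_add i4 i3]
    congr 1
    ext x
    simp only [Pi.sub_apply, Pi.smul_apply, smul_eq_mul]
    ring
  have hU := linFlow_packet 1 0 hf
  have hV := linFlow_packet α β hg
  have e1 := hs.integral_u_mul hT hU ht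
  have e2 := hs.integral_v_mul hT hV ht
  have c1 := hs.l2_sq_add hT hs.im_u hs.im_v ht
  rw [(hs.l2_init hf hg).1, (hs.l2_init hf hg).2] at c1
  have n1 : ∫ x, u 0 x * packet 1 0 f 0 x = ε * (l2 f ^ 2 : ℝ) := by
    simp_rw [hs.init_u, mul_assoc]
    rw [integral_const_mul, integral_mul_self_of_real (hU.hInf 0).memLp_zero
      (packet_im hf' 1 0 0), l2_packet 1 0 hf]
  have n2 : ∫ x, v 0 x * packet α β g 0 x = ε * (l2 g ^ 2 : ℝ) := by
    simp_rw [hs.init_v, mul_assoc]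
    rw [integral_const_mul, integral_mul_self_of_real (hV.hInf 0).memLp_zero
      (packet_im hg' α β 0), l2_packet α β hg]
  have k1 := key (c := ε) (hs.curve_u.hInf ht) (hU.hInf t) (hs.im_u t ht) (packet_im hf' 1 0 t)
  have k2 := key (c := ε) (hs.curve_v.hInf ht) (hV.hInf t) (hs.im_v t ht) (packet_im hg' α β t)
  rw [e1, n1, l2_packet 1 0 hf] at k1
  rw [e2, n2, l2_packet α β hg] at k2
  have c2 : ((l2 (u t) ^ 2 : ℝ) : ℂ) + (l2 (v t) ^ 2 : ℝ) =
      ε ^ 2 * ((l2 f ^ 2 : ℝ) + (l2 g ^ 2 : ℝ)) := by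
    have : l2 (u t) ^ 2 + l2 (v t) ^ 2 = ε ^ 2 * (l2 f ^ 2 + l2 g ^ 2) := by
      rw [c1, mul_pow, mul_pow, sq_abs]; ring
    exact_mod_cast this
  rw [Complex.ofReal_add, k1, k2]
  linear_combination c2

theorem energy_le (hf : IsProfile f) (hg : IsProfile g) (hf' : IsHermitian f)
    (hg' : IsHermitian g) (hs : IsScaledSolution α β T f g ε u v) (hT : 0 < T) {A B : ℝ}
    (hA : ∀ t ∈ Icc 0 T, l2 (u t) ≤ A) (hB : ∀ t ∈ Icc 0 T, l2 (v t) ≤ B) {t : ℝ}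
    (ht : t ∈ Icc 0 T) :
    l2 (u t - (ε : ℂ) • packet 1 0 f t) ^ 2 + l2 (v t - (ε : ℂ) • packet α β g t) ^ 2 ≤
      2 * |ε| * T * (1 / 2 * (derivBound f * (B * B)) + derivBound g * (A * B)) := by
  have h := congrArg norm (hs.energy_eq hf hg hf' hg' hT ht)
  rw [Complex.norm_real, Real.norm_of_nonneg (by positivity)] at h
  rw [h]
  have hA0 : 0 ≤ A := (l2_nonneg _).trans (hA t ht)
  have hB0 : 0 ≤ B := (l2_nonneg _).trans (hB t ht)
  have hf0 := derivBound_nonneg f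
  have hg0 := derivBound_nonneg g
  have hsub : ∀ τ ∈ uIoc 0 t, τ ∈ Icc 0 T := fun τ hτ => by
    rw [uIoc_of_le ht.1] at hτ
    exact ⟨hτ.1.le, hτ.2.trans ht.2⟩
  have h1 : ‖∫ τ in 0..t, 1 / 2 * ∫ x, v τ x * v τ x * deriv (packet 1 0 f τ) x‖ ≤
      (1 / 2 * (derivBound f * (B * B))) * |t - 0| := by
    refine intervalIntegral.norm_integral_le_of_norm_le_const fun τ hτ => ?_
    have hv := (hs.curve_v.hInf (hsub τ hτ)).memLp_zero
    rw [norm_mul]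
    have := norm_integral_triple_le hv hv (hInf_packet 1 0 hf τ).deriv.continuous
      (norm_deriv_packet_le hf 1 0 τ) (hB τ (hsub τ hτ)) (hB τ (hsub τ hτ))
    norm_num at this ⊢
    linarith
  have h2 : ‖∫ τ in 0..t, ∫ x, u τ x * v τ x * deriv (packet α β g τ) x‖ ≤
      (derivBound g * (A * B)) * |t - 0| := by
    refine intervalIntegral.norm_integral_le_of_norm_le_const fun τ hτ => ?_
    exact norm_integral_triple_le (hs.curve_u.hInf (hsub τ hτ)).memLp_zero
      (hs.curve_v.hInf (hsub τ hτ)).memLp_zero (hInf_packet α β hg τ).deriv.continuous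
      (norm_deriv_packet_le hg α β τ) (hA τ (hsub τ hτ)) (hB τ (hsub τ hτ))
  have h3 : |t - 0| ≤ T := by rw [sub_zero, abs_of_nonneg ht.1]; exact ht.2
  have h4 : ‖(-2 * ε : ℂ)‖ = 2 * |ε| := by simp
  rw [norm_mul, h4]
  calc _ ≤ 2 * |ε| * ((1 / 2 * (derivBound f * (B * B))) * |t - 0| +
        (derivBound g * (A * B)) * |t - 0|) := by
        gcongr
        exact (norm_add_le _ _).trans (add_le_add h1 h2)
    _ ≤ 2 * |ε| * ((1 / 2 * (derivBound f * (B * B))) * T + (derivBound g * (A * B)) * T) := by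
        gcongr
    _ = _ := by ring

end IsScaledSolution

/-- Second order expansion of the solution with small data `ε(f,g)`, tested against `h`. -/
theorem exists_quadratic_expansion {α β T : ℝ} {f g h : ℝ → ℂ} (hf : IsProfile f)
    (hg : IsProfile g) (hh : IsProfile h) (hf' : IsHermitian f) (hg' : IsHermitian g)
    (hT : 0 < T) : ∃ (c : ℂ) (C : ℝ), ∀ (ε : ℝ) (u v : ℝ → ℝ → ℂ),
      IsScaledSolution α β T f g ε u v →
      ‖(∫ x, v T x * packet α β h T x) - ε * c -
        ε ^ 2 * ∫ z, ampUV f g h z * osc T (phaseUV α β z)‖ ≤ C * (ε ^ 2 * √|ε|) := by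
  set D := √(l2 f ^ 2 + l2 g ^ 2) with hD
  set C₀ := 2 * T * (1 / 2 * (derivBound f * (D * D)) + derivBound g * (D * D)) with hC₀
  have hD0 : 0 ≤ D := Real.sqrt_nonneg _
  have hf0 := derivBound_nonneg f
  have hg0 := derivBound_nonneg g
  have hh0 := derivBound_nonneg h
  have hfD : l2 f ≤ D := Real.le_sqrt_of_sq_le (by nlinarith [sq_nonneg (l2 g)])
  have hgD : l2 g ≤ D := Real.le_sqrt_of_sq_le (by nlinarith [sq_nonneg (l2 f)])
  refine ⟨∫ x, packet α β g 0 x * packet α β h 0 x,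
    T * (derivBound h * (√C₀ * D) + derivBound h * (D * √C₀)), fun ε u v hs => ?_⟩
  have hTT : T ∈ Icc 0 T := ⟨hT.le, le_rfl⟩
  have hU := linFlow_packet 1 0 hf
  have hV := linFlow_packet α β hg
  have hA := fun t ht => (hs.l2_sq_le hf hg hT (t := t) ht).1
  have hB := fun t ht => (hs.l2_sq_le hf hg hT (t := t) ht).2
  -- With u and v of size |ε|, the right side of `energy_le` is of order |ε|³, so the distance to
  -- the linear solution is of order |ε|^{3/2}. This is not the optimal order ε², but it suffices.
  have hE : ∀ t ∈ Icc 0 T, l2 (u t - (ε : ℂ) • packet 1 0 f t) ≤ √C₀ * (|ε| * √|ε|) ∧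
      l2 (v t - (ε : ℂ) • packet α β g t) ≤ √C₀ * (|ε| * √|ε|) := by
    intro t ht
    have h1 := hs.energy_le hf hg hf' hg' hT hA hB ht
    have h2 : (√C₀ * (|ε| * √|ε|)) ^ 2 = C₀ * (|ε| ^ 2 * |ε|) := by
      rw [mul_pow, mul_pow, Real.sq_sqrt (by positivity), Real.sq_sqrt (abs_nonneg _)]
    have h3 : 2 * |ε| * T * (1 / 2 * (derivBound f * (|ε| * D * (|ε| * D))) +
        derivBound g * (|ε| * D * (|ε| * D))) = C₀ * (|ε| ^ 2 * |ε|) := by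
      rw [hC₀]; ring
    rw [h3, ← h2] at h1
    have h4 := sq_nonneg (l2 (u t - (ε : ℂ) • packet 1 0 f t))
    have h5 := sq_nonneg (l2 (v t - (ε : ℂ) • packet α β g t))
    constructor <;> refine le_of_sq_le_sq ?_ (by positivity) <;> linarith
  have e1 := hs.integral_v_mul hT (linFlow_packet α β hh) hTT
  have e2 : ∫ x, v 0 x * packet α β h 0 x =
      ε * ∫ x, packet α β g 0 x * packet α β h 0 x := by
    simp_rw [hs.init_v, mul_assoc]
    rw [integral_const_mul]
  have hcc := (linFlow_packet α β hh).cont_deriv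
  have hi1 := intervalIntegrable_triple (c := fun t x => deriv (packet α β h t) x)
    (hs.contDiffOn_u.continuousOn) (hs.contDiffOn_v.continuousOn)
    hcc (fun t ht => (hs.curve_u.hInf ht).memLp_zero)
    (fun t ht => (hs.curve_v.hInf ht).memLp_zero) hA hB
    (fun t x => norm_deriv_packet_le hh α β t x) hTT
  have hi2 := intervalIntegrable_triple (c := fun t x => deriv (packet α β h t) x)
    ((continuous_packet 1 0 hf).continuousOn (s := Icc 0 T ×ˢ univ))
    ((continuous_packet α β hg).continuousOn) hcc
    (fun t _ => (hU.hInf t).memLp_zero) (fun t _ => (hV.hInf t).memLp_zero)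
    (fun t _ => (l2_packet 1 0 hf t).le) (fun t _ => (l2_packet α β hg t).le)
    (fun t x => norm_deriv_packet_le hh α β t x) hTT
  -- What remains is the time integral of uv minus ε² times the product of the linear solutions: one
  -- factor of size |ε| and one difference of size |ε|^{3/2}, in all ε²√|ε|.
  have e3 : (∫ x, v T x * packet α β h T x) - ε * (∫ x, packet α β g 0 x * packet α β h 0 x) -
      ε ^ 2 * (∫ z, ampUV f g h z * osc T (phaseUV α β z)) =
      ∫ t in 0..T, ((∫ x, u t x * v t x * deriv (packet α β h t) x) - ε ^ 2 *
        ∫ x, packet 1 0 f t x * packet α β g t x * deriv (packet α β h t) x) := by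
    rw [intervalIntegral.integral_sub hi1 (hi2.const_mul _), intervalIntegral.integral_const_mul,
      integral_integral_packet_uv α β hf hg hh hT.le, e1, e2]
    ring
  rw [e3]
  refine (intervalIntegral.norm_integral_le_of_norm_le_const (C :=
    derivBound h * (√C₀ * (|ε| * √|ε|) * (|ε| * D)) +
      derivBound h * (|ε| * D * (√C₀ * (|ε| * √|ε|)))) fun t ht => ?_).trans (le_of_eq ?_)
  · rw [uIoc_of_le hT.le] at ht
    have ht' : t ∈ Icc 0 T := ⟨ht.1.le, ht.2⟩
    have e4 : (ε : ℂ) ^ 2 * ∫ x, packet 1 0 f t x * packet α β g t x * deriv (packet α β h t) x =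
        ∫ x, ((ε : ℂ) • packet 1 0 f t) x * ((ε : ℂ) • packet α β g t) x *
          deriv (packet α β h t) x := by
      rw [← integral_const_mul]
      congr 1
      ext x
      simp only [Pi.smul_apply, smul_eq_mul]
      ring
    rw [e4]
    refine norm_integral_product_sub_le (hs.curve_u.hInf ht').memLp_zero
      (hs.curve_v.hInf ht').memLp_zero ((hU.hInf t).const_smul _).memLp_zero
      ((hV.hInf t).const_smul _).memLp_zero (hInf_packet α β hh t).deriv.continuous
      (norm_deriv_packet_le hh α β t) (hE t ht').1 (hE t ht').2 ?_ (hB t ht')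
    rw [l2_smul, l2_packet 1 0 hf, Complex.norm_real, Real.norm_eq_abs]
    gcongr
  · rw [sub_zero, abs_of_pos hT, ← sq_abs ε]
    ring

/-- Third order expansion of the solution with small data `ε(0,g)`, tested against `h`. -/
theorem exists_cubic_expansion {α β T : ℝ} {g h : ℝ → ℂ} (hg : IsProfile g) (hh : IsProfile h)
    (hg' : IsHermitian g) (hT : 0 < T) : ∃ (c : ℂ) (C : ℝ), ∀ (ε : ℝ) (u v : ℝ → ℝ → ℂ),
      IsScaledSolution α β T 0 g ε u v →
      ‖(∫ x, v T x * packet α β h T x) - ε * c - ε ^ 3 * (1 / 2 *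
        ∫ z, ampVVV g h z * doubleOsc T (phaseVV α β z) (phaseUV' α β z))‖ ≤ C * ε ^ 4 := by
  have hf : IsProfile 0 := ⟨contDiff_const, HasCompactSupport.zero⟩
  have hf' : IsHermitian 0 := fun ξ => by simp
  have hp0 : ∀ t, packet 1 0 0 t = 0 := fun t => by
    ext x; rw [packet_eq]; simp [phased]
  set D := l2 g with hD
  have hD0 : 0 ≤ D := l2_nonneg _
  have hg0 := derivBound_nonneg g
  have hh0 := derivBound_nonneg h
  set c₀ := 2 * T * derivBound g * D with hc₀
  have hc₀0 : 0 ≤ c₀ := by positivity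
  obtain ⟨K, hK⟩ := exists_derivBound_backProfile α β hg hh
  have hK0 : 0 ≤ K := (derivBound_nonneg _).trans (hK 0)
  refine ⟨∫ x, packet α β g 0 x * packet α β h 0 x,
    T * (1 / 2 * (K * (c₀ * D) + K * (D * c₀)) * T + derivBound h * (c₀ * c₀)),
    fun ε u v hs => ?_⟩
  have hTT : T ∈ Icc 0 T := ⟨hT.le, le_rfl⟩
  have h0T : (0 : ℝ) ∈ Icc 0 T := ⟨le_rfl, hT.le⟩
  have hV := linFlow_packet α β hg
  have hDD : √(l2 0 ^ 2 + D ^ 2) = D := by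
    rw [show l2 0 = 0 by simp [l2]]
    simp [Real.sqrt_sq hD0]
  have hdb : derivBound 0 = 0 := by simp [derivBound]
  have hA := fun t ht => (hs.l2_sq_le hf hg hT (t := t) ht).1
  have hB := fun t ht => (hs.l2_sq_le hf hg hT (t := t) ht).2
  rw [hDD] at hA hB
  -- The linear part of u vanishes, so only the term in `energy_le` that is linear in the bound of u
  -- remains. Keeping M free allows a bootstrap.
  have hen : ∀ M, (∀ t ∈ Icc 0 T, l2 (u t) ≤ M) → ∀ t ∈ Icc 0 T,
      l2 (u t) ^ 2 + l2 (v t - (ε : ℂ) • packet α β g t) ^ 2 ≤ c₀ * ε ^ 2 * M := by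
    intro M hM t ht
    have h1 := hs.energy_le hf hg hf' hg' hT hM hB ht
    rw [hp0, smul_zero, sub_zero, hdb] at h1
    refine h1.trans (le_of_eq ?_)
    rw [hc₀, ← sq_abs ε]
    ring
  -- At the time where ‖u‖ attains its maximum m, the inequality reads m² ≤ c₀ε²m. Thus u is of
  -- order ε², and inserting this gives the same order for v minus its linear part.
  have hu : ∀ t ∈ Icc 0 T, l2 (u t) ≤ c₀ * ε ^ 2 := by
    have hcont := hs.curve_u.continuousOn_l2 0
    simp only [iteratedDeriv_zero] at hcont
    obtain ⟨m, hm, hmax⟩ := isCompact_Icc.exists_isMaxOn ⟨0, h0T⟩ hcont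
    intro t ht
    refine (hmax ht).trans ?_
    have h1 := hen (l2 (u m)) (fun t ht => hmax ht) m hm
    have h2 := sq_nonneg (l2 (v m - (ε : ℂ) • packet α β g m))
    rcases (l2_nonneg (u m)).eq_or_lt with h3 | h3
    · simp only
      rw [← h3]; positivity
    · refine le_of_mul_le_mul_right ?_ h3
      nlinarith
  have hw : ∀ t ∈ Icc 0 T, l2 (v t - (ε : ℂ) • packet α β g t) ≤ c₀ * ε ^ 2 := by
    intro t ht
    have h1 := hen _ hu t ht
    refine le_of_sq_le_sq ?_ (by positivity)
    nlinarith [sq_nonneg (l2 (u t))]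
  have e1 := hs.integral_v_mul hT (linFlow_packet α β hh) hTT
  have e2 : ∫ x, v 0 x * packet α β h 0 x =
      ε * ∫ x, packet α β g 0 x * packet α β h 0 x := by
    simp_rw [hs.init_v, mul_assoc]
    rw [integral_const_mul]
  have hi1 := intervalIntegrable_triple (c := fun t x => deriv (packet α β h t) x)
    (hs.contDiffOn_u.continuousOn) (hs.contDiffOn_v.continuousOn)
    (linFlow_packet α β hh).cont_deriv (fun t ht => (hs.curve_u.hInf ht).memLp_zero)
    (fun t ht => (hs.curve_v.hInf ht).memLp_zero) hA hB
    (fun t x => norm_deriv_packet_le hh α β t x) hTT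
  have hi2 := (intervalIntegrable_cubicDensity α β hg hh hT.le).const_mul ((ε : ℂ) ^ 3 * (1 / 2))
  have e3 : (∫ x, v T x * packet α β h T x) - ε * (∫ x, packet α β g 0 x * packet α β h 0 x) -
      ε ^ 3 * (1 / 2 * ∫ z, ampVVV g h z * doubleOsc T (phaseVV α β z) (phaseUV' α β z)) =
      ∫ t in 0..T, ((∫ x, u t x * v t x * deriv (packet α β h t) x) -
        ε ^ 3 * (1 / 2) * cubicDensity α β g h t) := by
    rw [intervalIntegral.integral_sub hi1 hi2, intervalIntegral.integral_const_mul,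
      integral_integral_cubicDensity α β hg hh hT.le, e1, e2]
    ring
  rw [e3]
  -- The quadratic part of u: the pairing with the Airy flow turns u(t) into the time integral of
  -- v², and v is replaced by its linear part at a cost of order |ε|³.
  have hback : ∀ t ∈ Icc 0 T, ‖(∫ x, u t x * packet 1 0 (backProfile α β g h t) t x) -
      ε ^ 2 * (1 / 2) * cubicDensity α β g h t‖ ≤
      1 / 2 * (K * (c₀ * ε ^ 2 * (|ε| * D)) + K * (|ε| * D * (c₀ * ε ^ 2))) * T := by
    intro t ht
    have hb := isProfile_backProfile α β hg hh t
    have hsub : Icc 0 t ⊆ Icc 0 T := Icc_subset_Icc_right ht.2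
    have e4 := hs.integral_u_mul hT (linFlow_packet 1 0 hb) ht
    have e5 : ∫ x, u 0 x * packet 1 0 (backProfile α β g h t) 0 x = 0 := by
      simp_rw [hs.init_u, hp0]
      simp
    have hj1 := intervalIntegrable_triple
      (c := fun τ x => deriv (packet 1 0 (backProfile α β g h t) τ) x)
      (hs.contDiffOn_v.continuousOn) (hs.contDiffOn_v.continuousOn)
      (linFlow_packet 1 0 hb).cont_deriv
      (fun t ht => (hs.curve_v.hInf ht).memLp_zero)
      (fun t ht => (hs.curve_v.hInf ht).memLp_zero) hB hB
      (fun τ x => norm_deriv_packet_le hb 1 0 τ x) ht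
    have hj2 := intervalIntegrable_triple
      (c := fun τ x => deriv (packet 1 0 (backProfile α β g h t) τ) x)
      ((continuous_packet α β hg).continuousOn (s := Icc 0 T ×ˢ univ))
      ((continuous_packet α β hg).continuousOn)
      (linFlow_packet 1 0 hb).cont_deriv
      (fun t _ => (hV.hInf t).memLp_zero) (fun t _ => (hV.hInf t).memLp_zero)
      (fun t _ => (l2_packet α β hg t).le) (fun t _ => (l2_packet α β hg t).le)
      (fun τ x => norm_deriv_packet_le hb 1 0 τ x) ht
    rw [e4, e5, zero_add, ← integral_cubicDensity α β hg hh ht.1,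
      ← intervalIntegral.integral_const_mul, ← intervalIntegral.integral_sub (hj1.const_mul _)
        (hj2.const_mul _)]
    refine (intervalIntegral.norm_integral_le_of_norm_le_const (C :=
      1 / 2 * (K * (c₀ * ε ^ 2 * (|ε| * D)) + K * (|ε| * D * (c₀ * ε ^ 2)))) fun τ hτ => ?_).trans ?_
    · rw [uIoc_of_le ht.1] at hτ
      have hτ' : τ ∈ Icc 0 T := hsub ⟨hτ.1.le, hτ.2⟩
      have e6 : (1 / 2 : ℂ) * (∫ x, v τ x * v τ x *
            deriv (packet 1 0 (backProfile α β g h t) τ) x) -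
          ε ^ 2 * (1 / 2) * (∫ x, packet α β g τ x * packet α β g τ x *
            deriv (packet 1 0 (backProfile α β g h t) τ) x) =
          1 / 2 * ((∫ x, v τ x * v τ x * deriv (packet 1 0 (backProfile α β g h t) τ) x) -
            ∫ x, ((ε : ℂ) • packet α β g τ) x * ((ε : ℂ) • packet α β g τ) x *
            deriv (packet 1 0 (backProfile α β g h t) τ) x) := by
        rw [mul_sub, mul_comm ((ε : ℂ) ^ 2), mul_assoc, ← integral_const_mul ((ε : ℂ) ^ 2)]
        congr 3
        ext x
        simp only [Pi.smul_apply, smul_eq_mul]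
        ring
      rw [e6, norm_mul]
      have h1 : ‖(1 / 2 : ℂ)‖ = 1 / 2 := by norm_num
      rw [h1]
      refine mul_le_mul_of_nonneg_left ?_ (by norm_num)
      refine norm_integral_product_sub_le (hs.curve_v.hInf hτ').memLp_zero
        (hs.curve_v.hInf hτ').memLp_zero ((hV.hInf τ).const_smul _).memLp_zero
        ((hV.hInf τ).const_smul _).memLp_zero (hInf_packet 1 0 hb τ).deriv.continuous
        (fun x => (norm_deriv_packet_le hb 1 0 τ x).trans (hK t)) (hw τ hτ') (hw τ hτ') ?_
        (hB τ hτ')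
      rw [l2_smul, l2_packet α β hg, Complex.norm_real, Real.norm_eq_abs]
    · refine mul_le_mul_of_nonneg_left ?_ (by positivity)
      rw [sub_zero, abs_of_nonneg ht.1]
      exact ht.2
  refine (intervalIntegral.norm_integral_le_of_norm_le_const (C :=
    |ε| * (1 / 2 * (K * (c₀ * ε ^ 2 * (|ε| * D)) + K * (|ε| * D * (c₀ * ε ^ 2))) * T) +
      derivBound h * (c₀ * ε ^ 2 * (c₀ * ε ^ 2))) fun t ht => ?_).trans (le_of_eq ?_)
  · rw [uIoc_of_le hT.le] at ht
    have ht' : t ∈ Icc 0 T := ⟨ht.1.le, ht.2⟩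
    have hdc := (hInf_packet α β hh t).deriv.continuous
    have hdb := norm_deriv_packet_le hh α β t
    have hum := (hs.curve_u.hInf ht').memLp_zero
    have hvm := (hs.curve_v.hInf ht').memLp_zero
    have hpm := ((hV.hInf t).const_smul (ε : ℂ)).memLp_zero
    -- Split v into its linear part, for which `hback` applies with a further factor ε, and a
    -- remainder of order ε² that meets u of order ε². Both errors are of order ε⁴.
    have e7 : (∫ x, u t x * v t x * deriv (packet α β h t) x) -
        ε ^ 3 * (1 / 2) * cubicDensity α β g h t =
        ε * ((∫ x, u t x * packet 1 0 (backProfile α β g h t) t x) -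
          ε ^ 2 * (1 / 2) * cubicDensity α β g h t) +
        ∫ x, u t x * (v t - (ε : ℂ) • packet α β g t) x * deriv (packet α β h t) x := by
      have e8 : ∫ x, u t x * (v t - (ε : ℂ) • packet α β g t) x * deriv (packet α β h t) x =
          (∫ x, u t x * v t x * deriv (packet α β h t) x) -
          ε * ∫ x, u t x * packet 1 0 (backProfile α β g h t) t x := by
        rw [← integral_const_mul, ← integral_sub (integrable_triple hum hvm hdc hdb)
          (((hs.curve_u.hInf ht').integrable_mul
            (hInf_packet 1 0 (isProfile_backProfile α β hg hh t) t)).const_mul _)]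
        congr 1
        ext x
        rw [packet_backProfile α β hg hh]
        simp only [Pi.sub_apply, Pi.smul_apply, smul_eq_mul]
        ring
      rw [e8]
      ring
    rw [e7]
    refine (norm_add_le _ _).trans (add_le_add ?_ ?_)
    · rw [norm_mul, Complex.norm_real, Real.norm_eq_abs]
      exact mul_le_mul_of_nonneg_left (hback t ht') (abs_nonneg _)
    · exact norm_integral_triple_le hum (hvm.sub hpm) hdc hdb (hu t ht') (hw t ht')
  · rw [sub_zero, abs_of_pos hT, ← sq_abs ε]
    have : ε ^ 4 = |ε| ^ 4 := by rw [← abs_pow, abs_of_nonneg (by positivity)]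
    rw [this]
    ring

end MajdaBiello
end

/-! ### Sobolev spaces on the frequency side, and complex conjugation. -/

noncomputable section

namespace MajdaBiello

open FourierTransform TemperedDistribution ComplexConjugate

namespace Sobolev

variable {s : ℝ}

theorem norm_eq (f : Sobolev s) : ‖f‖ = ‖f.besselL2‖ := rfl

theorem isometry_besselLinear (s : ℝ) : Isometry (besselLinear s) :=
  AddMonoidHomClass.isometry_of_norm (besselLinear s) fun _ => rfl

theorem toDistribution_eq (f : Sobolev s) : f.toDistribution =
    besselPotential ℝ ℂ (-s) (Lp.toTemperedDistributionCLM ℂ (volume : Measure ℝ) 2 f.besselL2) := by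
  rw [← besselL2_spec, besselPotential_besselPotential_apply]
  simp

/-- The symbol `⟨ξ⟩^r`. -/
def weight (r ξ : ℝ) : ℂ := (((1 + ‖ξ‖ ^ 2) ^ (r / 2) : ℝ) : ℂ)

theorem weight_neg (r ξ : ℝ) : weight r (-ξ) = weight r ξ := by simp [weight]

theorem conj_weight (r ξ : ℝ) : conj (weight r ξ) = weight r ξ := Complex.conj_ofReal _

theorem hasTemperateGrowth_weight (r : ℝ) : (weight r).HasTemperateGrowth := by
  unfold weight; fun_prop

theorem contDiff_weight (r : ℝ) : ContDiff ℝ ∞ (weight r) := (hasTemperateGrowth_weight r).1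

theorem _root_.MajdaBiello.IsProfile.weight_mul {k : ℝ → ℂ} (hk : IsProfile k) (r : ℝ) :
    IsProfile fun ξ => weight r ξ * k ξ := hk.mul_left (contDiff_weight r)

/-- The Bessel potential on test functions, transposed. -/
def besselTest (r : ℝ) (φ : 𝓢(ℝ, ℂ)) : 𝓢(ℝ, ℂ) :=
  𝓕 (SchwartzMap.smulLeftCLM ℂ (weight r) (𝓕⁻ φ))

theorem besselPotential_apply_apply (r : ℝ) (f : 𝓢'(ℝ, ℂ)) (φ : 𝓢(ℝ, ℂ)) :
    besselPotential ℝ ℂ r f φ = f (besselTest r φ) :=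
  fourierMultiplierCLM_apply_apply _ _ _

theorem besselTest_apply (r : ℝ) (φ : 𝓢(ℝ, ℂ)) (x : ℝ) :
    besselTest r φ x = 𝓕 (fun ξ => weight r ξ * 𝓕⁻ (φ : ℝ → ℂ) ξ) x := by
  rw [besselTest, SchwartzMap.fourier_coe]
  refine congrFun (congrArg (𝓕 : (ℝ → ℂ) → ℝ → ℂ) (funext fun ξ => ?_)) x
  rw [SchwartzMap.smulLeftCLM_apply_apply (hasTemperateGrowth_weight r), SchwartzMap.fourierInv_coe,
    smul_eq_mul]

theorem toDistribution_apply (f : Sobolev s) (φ : 𝓢(ℝ, ℂ)) :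
    f.toDistribution φ = ∫ x, besselTest (-s) φ x * f.besselL2 x := by
  rw [toDistribution_eq, besselPotential_apply_apply, Lp.toTemperedDistributionCLM_apply,
    Lp.toTemperedDistribution_apply]
  rfl

/-- Complex conjugation of Schwartz functions. -/
def conjTest (φ : 𝓢(ℝ, ℂ)) : 𝓢(ℝ, ℂ) :=
  SchwartzMap.postcompCLM (𝕜 := ℝ) (Complex.conjCLE : ℂ →L[ℝ] ℂ) φ

theorem conjTest_apply (φ : 𝓢(ℝ, ℂ)) (x : ℝ) : conjTest φ x = conj (φ x) := rfl

theorem conj_fourierInv (k : ℝ → ℂ) (x : ℝ) :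
    conj (𝓕⁻ k x) = 𝓕 (fun ξ => conj (k ξ)) x := by
  rw [Real.fourierInv_eq', Real.fourier_eq', ← integral_conj]
  congr 1
  ext ξ
  rw [smul_eq_mul, smul_eq_mul, map_mul, ← Complex.exp_conj]
  simp [map_ofNat]

theorem conj_fourier (k : ℝ → ℂ) (x : ℝ) :
    conj (𝓕 k x) = 𝓕⁻ (fun ξ => conj (k ξ)) x := by
  have := conj_fourierInv (fun ξ => conj (k ξ)) x
  simp only [Complex.conj_conj] at this
  rw [← this, Complex.conj_conj]

/-- The weight is real and even, so the Bessel potential commutes with conjugation. -/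
theorem besselTest_conjTest (r : ℝ) (φ : 𝓢(ℝ, ℂ)) (x : ℝ) :
    besselTest r (conjTest φ) x = conj (besselTest r φ x) := by
  rw [besselTest_apply, besselTest_apply, conj_fourier,
    Real.fourierInv_eq_fourier_comp_neg fun ξ => conj (weight r ξ * 𝓕⁻ (φ : ℝ → ℂ) ξ)]
  refine congrFun (congrArg (𝓕 : (ℝ → ℂ) → ℝ → ℂ) (funext fun ξ => ?_)) x
  rw [map_mul, weight_neg, conj_weight, conj_fourierInv, Real.fourierInv_eq_fourier_neg]
  rfl

/-- Complex conjugation on `L²(ℝ)`. -/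
def conjL2 : Lp ℂ 2 (volume : Measure ℝ) →L[ℝ] Lp ℂ 2 (volume : Measure ℝ) :=
  (Complex.conjCLE : ℂ →L[ℝ] ℂ).compLpL 2 volume

theorem coeFn_conjL2 (f : Lp ℂ 2 (volume : Measure ℝ)) :
    ∀ᵐ x, conjL2 f x = conj (f x) :=
  ContinuousLinearMap.coeFn_compLpL _ f

theorem exists_conjS (f : Sobolev s) : ∃ g : Sobolev s, g.besselL2 = conjL2 f.besselL2 := by
  have h : besselPotential ℝ ℂ s (besselPotential ℝ ℂ (-s)
      (Lp.toTemperedDistributionCLM ℂ (volume : Measure ℝ) 2 (conjL2 f.besselL2))) =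
      Lp.toTemperedDistributionCLM ℂ (volume : Measure ℝ) 2 (conjL2 f.besselL2) := by
    rw [besselPotential_besselPotential_apply]
    simp
  refine ⟨⟨_, conjL2 f.besselL2, h⟩, toTemperedDistribution_injective ?_⟩
  exact (besselL2_spec _).symm.trans h

/-- Complex conjugation on `H^s(ℝ)`. -/
def conjS (f : Sobolev s) : Sobolev s := (exists_conjS f).choose

theorem besselL2_conjS (f : Sobolev s) : f.conjS.besselL2 = conjL2 f.besselL2 :=
  (exists_conjS f).choose_spec

theorem continuous_conjS : Continuous (conjS : Sobolev s → Sobolev s) := by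
  rw [(isometry_besselLinear s).isUniformInducing.isInducing.continuous_iff]
  have : besselLinear s ∘ conjS = conjL2 ∘ besselLinear s := funext besselL2_conjS
  rw [this]
  exact conjL2.continuous.comp (isometry_besselLinear s).continuous

theorem conjS_apply (f : Sobolev s) (φ : 𝓢(ℝ, ℂ)) :
    f.conjS.toDistribution φ = conj (f.toDistribution (conjTest φ)) := by
  rw [toDistribution_apply, toDistribution_apply, ← integral_conj]
  refine integral_congr_ae ?_
  filter_upwards [coeFn_conjL2 f.besselL2] with x hx
  rw [besselL2_conjS, hx, map_mul, besselTest_conjTest, Complex.conj_conj]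

theorem IsGivenBy.conjS {f : Sobolev s} {a : ℝ → ℂ} (h : f.IsGivenBy a) :
    f.conjS.IsGivenBy fun x => conj (a x) := by
  intro φ
  rw [conjS_apply, h, ← integral_conj]
  congr 1
  ext x
  rw [map_mul, conjTest_apply, Complex.conj_conj]

theorem conjS_eq_self {f : Sobolev s} {a : ℝ → ℂ} (h : f.IsGivenBy a) (ha : ∀ x, (a x).im = 0) :
    f.conjS = f := by
  apply toDistribution_injective
  ext φ
  rw [h, h.conjS]
  congr 1
  ext x
  exact congrArg (φ x * ·) (Complex.conj_eq_iff_im.2 (ha x))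

theorem conjS_mem_realValued {f : Sobolev s} (hf : f ∈ realValued s) :
    f.conjS ∈ realValued s := by
  intro φ hφ
  rw [conjS_apply, Complex.conj_im, neg_eq_zero]
  exact hf _ fun x => by rw [conjTest_apply, Complex.conj_im, hφ, neg_zero]

theorem IsGivenBy.mem_realValued {f : Sobolev s} {a : ℝ → ℂ} (h : f.IsGivenBy a)
    (ha : ∀ x, (a x).im = 0) : f ∈ realValued s := by
  intro φ hφ
  rw [h, ← Complex.conj_eq_iff_im, ← integral_conj]
  congr 1
  ext x
  rw [map_mul, Complex.conj_eq_iff_im.2 (ha x), Complex.conj_eq_iff_im.2 (hφ x)]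

/-- Two L² representatives of a distribution agree almost everywhere, and continuous ones agree
everywhere. This carries identities between curves in H^s to pointwise identities between smooth
solutions. -/
theorem IsGivenBy.unique {f : Sobolev s} {a b : ℝ → ℂ} (ha : f.IsGivenBy a) (hb : f.IsGivenBy b)
    (ha' : HInf a) (hb' : HInf b) : a = b := by
  have h : ha'.memLp_zero.toLp a = hb'.memLp_zero.toLp b := by
    apply toTemperedDistribution_injective
    ext φ
    simp only [Lp.toTemperedDistributionCLM_apply, Lp.toTemperedDistribution_apply]
    have h1 : ∫ x, φ x • (ha'.memLp_zero.toLp a) x = ∫ x, φ x * a x :=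
      integral_congr_ae (by
        filter_upwards [ha'.memLp_zero.coeFn_toLp] with x hx
        rw [hx, smul_eq_mul])
    have h2 : ∫ x, φ x • (hb'.memLp_zero.toLp b) x = ∫ x, φ x * b x :=
      integral_congr_ae (by
        filter_upwards [hb'.memLp_zero.coeFn_toLp] with x hx
        rw [hx, smul_eq_mul])
    rw [h1, h2, ← ha φ, ← hb φ]
  rw [MemLp.toLp_eq_toLp_iff] at h
  exact (ha'.continuous.ae_eq_iff_eq volume hb'.continuous).1 h

/-- The element of `H^s(ℝ)` with Fourier transform `k`. -/
def ofProfile (s : ℝ) {k : ℝ → ℂ} (hk : IsProfile k) : Sobolev s :=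
  ⟨SchwartzMap.toTemperedDistributionCLM ℝ ℂ volume (𝓕⁻ hk.toSchwartz),
    SchwartzMap.memSobolev _⟩

theorem isSmooth_smul_ofProfile (c : ℂ) {k : ℝ → ℂ} (hk : IsProfile k) :
    (c • ofProfile s hk).IsSmooth := fun r => by
  rw [toDistribution_smul]
  exact (SchwartzMap.memSobolev _).smul c

theorem isGivenBy_ofProfile {k : ℝ → ℂ} (hk : IsProfile k) :
    (ofProfile s hk).IsGivenBy (𝓕⁻ k) := fun φ => by
  rw [← hk.coe_fourierInv]
  exact SchwartzMap.toTemperedDistributionCLM_apply_apply _ _ _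

theorem IsGivenBy.smul {f : Sobolev s} {a : ℝ → ℂ} (h : f.IsGivenBy a) (c : ℂ) :
    (c • f).IsGivenBy fun x => c * a x := fun φ => by
  rw [toDistribution_smul]
  change c * f.toDistribution φ = _
  rw [h, ← integral_const_mul]
  congr 1
  ext x
  ring

theorem norm_ofProfile {k : ℝ → ℂ} (hk : IsProfile k) :
    ‖ofProfile s hk‖ = l2 fun ξ => weight s ξ * k ξ := by
  have h : (ofProfile s hk).besselL2 = (𝓕⁻ (hk.weight_mul s).toSchwartz : 𝓢(ℝ, ℂ)).toLp 2 := by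
    apply toTemperedDistribution_injective
    rw [← besselL2_spec, Lp.toTemperedDistributionCLM_apply, Lp.toTemperedDistribution_toLp_eq]
    refine (fourierMultiplierCLM_toTemperedDistributionCLM_eq (hasTemperateGrowth_weight s) _).trans
      ?_
    congr 1
    rw [SchwartzMap.fourierMultiplierCLM_apply, fourier_fourierInv_eq]
    congr 1
    ext ξ
    rw [SchwartzMap.smulLeftCLM_apply_apply (hasTemperateGrowth_weight s)]
    rfl
  rw [norm_eq, h, SchwartzMap.norm_toLp, IsProfile.coe_fourierInv]
  exact l2_fourierInv (hk.weight_mul s)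

/-- The duality of H^s and H^{-s}: move the Bessel potential of order -s onto the test function and
apply Cauchy–Schwarz and Plancherel. -/
theorem norm_toDistribution_le (f : Sobolev s) {k : ℝ → ℂ} (hk : IsProfile k) :
    ‖f.toDistribution (𝓕⁻ hk.toSchwartz)‖ ≤ ‖f‖ * l2 fun ξ => weight (-s) ξ * k ξ := by
  have h : (besselTest (-s) (𝓕⁻ hk.toSchwartz) : ℝ → ℂ) = 𝓕⁻ (fun ξ => weight (-s) ξ * k ξ) := by
    ext x
    rw [besselTest_apply, Real.fourierInv_eq_fourier_comp_neg fun ξ => weight (-s) ξ * k ξ]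
    refine congrFun (congrArg (𝓕 : (ℝ → ℂ) → ℝ → ℂ) (funext fun ξ => ?_)) x
    rw [hk.coe_fourierInv, fourierInv_fourierInv hk, weight_neg]
  rw [toDistribution_apply, norm_eq]
  refine (norm_integral_mul_le (SchwartzMap.memLp _ 2 volume) (Lp.memLp f.besselL2)).trans
    (le_of_eq ?_)
  rw [h, l2_fourierInv (hk.weight_mul (-s)), mul_comm, Lp.norm_def]
  rfl

end Sobolev

theorem iteratedDeriv_conj (w : ℝ → ℂ) (n : ℕ) :
    iteratedDeriv n (fun x => conj (w x)) = fun x => conj (iteratedDeriv n w x) := by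
  induction n with
  | zero => simp
  | succ n ih =>
    rw [iteratedDeriv_succ, iteratedDeriv_succ, ih]
    exact deriv.star'

theorem eLpNorm_conj (f : ℝ → ℂ) : eLpNorm (fun x => conj (f x)) 2 volume = eLpNorm f 2 volume :=
  eLpNorm_congr_norm_ae (.of_forall fun x => by simp)

theorem IsSmoothCurve.conj {T : ℝ} {w : ℝ → ℝ → ℂ} (h : IsSmoothCurve T w) :
    IsSmoothCurve T fun t x => conj (w t x) where
  contDiff t ht := Complex.conjCLE.contDiff.comp (h.contDiff t ht)
  memLp t ht n := by
    rw [iteratedDeriv_conj]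
    exact (h.memLp t ht n).star
  tendsto t ht n := by
    refine (h.tendsto t ht n).congr fun τ => ?_
    rw [iteratedDeriv_conj, iteratedDeriv_conj, ← eLpNorm_conj]
    congr 1
    ext x
    simp

theorem IsSmoothSolution.conj {α β T : ℝ} {u v : ℝ → ℝ → ℂ} (h : IsSmoothSolution α β T u v) :
    IsSmoothSolution α β T (fun t x => conj (u t x)) (fun t x => conj (v t x)) where
  contDiffOn_u := Complex.conjCLE.contDiff.comp_contDiffOn h.contDiffOn_u
  contDiffOn_v := Complex.conjCLE.contDiff.comp_contDiffOn h.contDiffOn_v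
  curve_u := h.curve_u.conj
  curve_v := h.curve_v.conj
  eq_u t ht x := by
    have h1 := congrArg conj (h.eq_u t ht x)
    have h2 : derivWithin (fun τ => conj (u τ x)) (Icc 0 T) t =
      conj (derivWithin (fun τ => u τ x) (Icc 0 T) t) := derivWithin.star
    have h3 : deriv (fun y => conj (v t y)) x = conj (deriv (v t) x) :=
      congrFun deriv.star' x
    rw [iteratedDeriv_conj, h2, h3]
    simpa using h1
  eq_v t ht x := by
    have h1 := congrArg conj (h.eq_v t ht x)
    have h2 : derivWithin (fun τ => conj (v τ x)) (Icc 0 T) t =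
      conj (derivWithin (fun τ => v τ x) (Icc 0 T) t) := derivWithin.star
    have h3 : deriv (fun y => conj (v t y)) x = conj (deriv (v t) x) :=
      congrFun deriv.star' x
    have h4 : deriv (fun y => conj (u t y) * conj (v t y)) x =
        conj (deriv (fun y => u t y * v t y) x) := by
      refine Eq.trans ?_ (congrFun (deriv.star' (f := fun y => u t y * v t y)) x)
      simp
    rw [iteratedDeriv_conj, h2, h3, h4]
    simpa using h1

end MajdaBiello
end

/-! ### From a differentiable solution map to bounds on multilinear forms. -/

noncomputable section

namespace MajdaBiello

open FourierTransform ComplexConjugate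

section FiniteDifferences

variable {E F : Type} [NormedAddCommGroup E] [NormedSpace ℝ E] [NormedAddCommGroup F]
  [NormedSpace ℝ F]

theorem hasFDerivAt_iterate_fwdDiff {Φ : E → F} {Φ' : E → E →L[ℝ] F} {ρ : ℝ}
    (h : ∀ z, ‖z‖ < ρ → HasFDerivAt Φ (Φ' z) z) (n : ℕ) (x y : E) (hxy : ‖y‖ + n * ‖x‖ < ρ) :
    HasFDerivAt ((fwdDiff x)^[n] Φ) ((fwdDiff x)^[n] Φ' y) y := by
  induction n generalizing y with
  | zero => exact h y (by simpa using hxy)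
  | succ n ih =>
    rw [Function.iterate_succ_apply', Function.iterate_succ_apply']
    push_cast at hxy
    have h0 := norm_nonneg x
    have h1 := ih (y + x) (by linarith [norm_add_le y x])
    have h2 := ih y (by linarith)
    exact ((hasFDerivAt_comp_add_right x).2 h1).sub h2

/-- Induction through the mean value inequality: the derivative of the n-th difference is the n-th
difference of the derivative, to which the induction hypothesis applies with a new target space.
Uniformity in the base point y is what the mean value step along a segment consumes. -/
theorem exists_norm_iterate_fwdDiff_le (n : ℕ) {F : Type} [NormedAddCommGroup F]
    [NormedSpace ℝ F] {Φ : E → F} (h : ContDiffAt ℝ n Φ 0) :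
    ∃ δ > 0, ∃ C, ∀ x y : E, ‖x‖ < δ → ‖y‖ < δ → ‖(fwdDiff x)^[n] Φ y‖ ≤ C * ‖x‖ ^ n := by
  induction n generalizing F with
  | zero =>
    obtain ⟨δ, hδ, hb⟩ := Metric.continuousAt_iff.1 h.continuousAt 1 one_pos
    refine ⟨δ, hδ, 1 + ‖Φ 0‖, fun x y _ hy => ?_⟩
    have := hb (x := y) (by rwa [dist_zero_right])
    rw [dist_eq_norm] at this
    have h2 := norm_le_norm_sub_add (Φ y) (Φ 0)
    simp only [Function.iterate_zero, id, pow_zero, mul_one]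
    linarith
  | succ n ih =>
    obtain ⟨δ, hδ, C, hC⟩ := ih (h.fderiv_right (m := n) (by norm_cast))
    have hd : ∀ᶠ z in 𝓝 (0 : E), DifferentiableAt ℝ Φ z := by
      filter_upwards [h.eventually (by simp)] with z hz
      exact hz.differentiableAt (by simp)
    obtain ⟨ρ, hρ, hd⟩ := Metric.eventually_nhds_iff.1 hd
    have hd' : ∀ z, ‖z‖ < ρ → HasFDerivAt Φ (fderiv ℝ Φ z) z := fun z hz =>
      (hd (by rwa [dist_zero_right])).hasFDerivAt
    -- Points z of the segment satisfy ‖z‖ ≤ ‖y‖ + ‖x‖. Half of δ keeps them in the region of the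
    -- induction hypothesis, and ρ/(n+2) keeps z and its n translates by x where the map is
    -- differentiable.
    refine ⟨min (δ / 2) (ρ / (n + 2)), by positivity, C, fun x y hx hy => ?_⟩
    rw [lt_min_iff] at hx hy
    have h2 : ∀ z ∈ segment ℝ y (y + x), ‖z‖ < δ ∧ ‖z‖ + n * ‖x‖ < ρ := by
      intro z hz
      obtain ⟨t, ht, rfl⟩ := segment_eq_image' ℝ y (y + x) ▸ hz
      have h3 : ‖y + t • (y + x - y)‖ ≤ ‖y‖ + ‖x‖ := by
        refine (norm_add_le _ _).trans ?_
        rw [add_sub_cancel_left, norm_smul, Real.norm_of_nonneg ht.1]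
        nlinarith [norm_nonneg x, ht.2]
      refine ⟨by linarith, ?_⟩
      have h4 := (lt_div_iff₀ (by positivity)).1 hx.2
      have h5 := (lt_div_iff₀ (by positivity)).1 hy.2
      have h6 : ρ / (n + 2) * (n + 2) = ρ := by field_simp
      have h7 : (n : ℝ) * ‖x‖ ≤ n * (ρ / (n + 2)) := by gcongr; exact hx.2.le
      linarith [hx.2, hy.2]
    have h3 := (convex_segment y (y + x)).norm_image_sub_le_of_norm_hasFDerivWithin_le
      (f := (fwdDiff x)^[n] Φ) (f' := (fwdDiff x)^[n] (fderiv ℝ Φ)) (C := C * ‖x‖ ^ n)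
      (fun z hz => (hasFDerivAt_iterate_fwdDiff hd' n x z (h2 z hz).2).hasFDerivWithinAt)
      (fun z hz => hC x z (by linarith) (h2 z hz).1)
      (left_mem_segment ℝ y (y + x)) (right_mem_segment ℝ y (y + x))
    rw [Function.iterate_succ_apply', fwdDiff]
    refine h3.trans (le_of_eq ?_)
    rw [add_sub_cancel_left, pow_succ, mul_assoc]

end FiniteDifferences

/-- A real subspace of `H^s(ℝ)` that is closed under complex conjugation and contains the real
packets. -/
structure IsAdmissible {s : ℝ} (X : Submodule ℝ (Sobolev s)) : Prop where
  conjS_mem : ∀ f ∈ X, f.conjS ∈ X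
  ofProfile_mem : ∀ {k : ℝ → ℂ} (hk : IsProfile k), IsHermitian k → Sobolev.ofProfile s hk ∈ X

theorem im_fourierInv {k : ℝ → ℂ} (hk : IsHermitian k) (x : ℝ) : (𝓕⁻ k x).im = 0 := by
  have := packet_im hk 0 0 0 x
  rwa [packet, phased_zero] at this

theorem isAdmissible_top (s : ℝ) : IsAdmissible (⊤ : Submodule ℝ (Sobolev s)) :=
  ⟨fun _ _ => trivial, fun _ _ => trivial⟩

theorem isAdmissible_realValued (s : ℝ) : IsAdmissible (Sobolev.realValued s) :=
  ⟨fun _ => Sobolev.conjS_mem_realValued, fun hk hk' =>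
    (Sobolev.isGivenBy_ofProfile hk).mem_realValued (im_fourierInv hk')⟩

section Data

variable {s : ℝ} {X : Submodule ℝ (Sobolev s)} (hX : IsAdmissible X)
  {f g : ℝ → ℂ} (hf : IsProfile f) (hg : IsProfile g) (hf' : IsHermitian f) (hg' : IsHermitian g)

/-- The real initial data with Fourier transforms `f` and `g`. -/
def data : X × X :=
  (⟨Sobolev.ofProfile s hf, hX.ofProfile_mem hf hf'⟩,
    ⟨Sobolev.ofProfile s hg, hX.ofProfile_mem hg hg'⟩)

theorem norm_data_le : ‖data hX hf hg hf' hg'‖ ≤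
    l2 (fun ξ => Sobolev.weight s ξ * f ξ) + l2 fun ξ => Sobolev.weight s ξ * g ξ := by
  rw [Prod.norm_def, ← Sobolev.norm_ofProfile hf, ← Sobolev.norm_ofProfile hg]
  exact max_le_add_of_nonneg (norm_nonneg _) (norm_nonneg _)

/-- Complex conjugation of both components. -/
def conjPair (d : X × X) : X × X :=
  (⟨d.1.1.conjS, hX.conjS_mem _ d.1.2⟩, ⟨d.2.1.conjS, hX.conjS_mem _ d.2.2⟩)

theorem continuous_conjPair : Continuous (conjPair hX) := by
  have h1 : Continuous fun d : X × X => d.1.1.conjS :=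
    Sobolev.continuous_conjS.comp (continuous_subtype_val.comp continuous_fst)
  have h2 : Continuous fun d : X × X => d.2.1.conjS :=
    Sobolev.continuous_conjS.comp (continuous_subtype_val.comp continuous_snd)
  exact (h1.subtype_mk _).prodMk (h2.subtype_mk _)

theorem exists_isScaledSolution {α β T r : ℝ} {hT : 0 < T}
    {Φ : X × X → C(Icc (0 : ℝ) T, X × X)}
    (hΦ : ∀ d ∈ Metric.ball (0 : X × X) r, d.1.1.IsSmooth → d.2.1.IsSmooth →
      ∀ w : C(Icc (0 : ℝ) T, X × X),
        (w ⟨0, left_mem_Icc.2 hT.le⟩ = d ∧ SolvesSmoothly α β w) ↔ w = Φ d)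
    (ε : ℝ) (hε : ε • data hX hf hg hf' hg' ∈ Metric.ball (0 : X × X) r) :
    ∃ u v, IsScaledSolution α β T f g ε u v ∧
      (Φ (ε • data hX hf hg hf' hg') ⟨T, right_mem_Icc.2 hT.le⟩).2.1.IsGivenBy (v T) := by
  set d := ε • data hX hf hg hf' hg' with hd
  have hd1 : d.1.1 = (ε : ℂ) • Sobolev.ofProfile s hf := rfl
  have hd2 : d.2.1 = (ε : ℂ) • Sobolev.ofProfile s hg := rfl
  have hs1 : d.1.1.IsSmooth := by rw [hd1]; exact Sobolev.isSmooth_smul_ofProfile _ hf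
  have hs2 : d.2.1.IsSmooth := by rw [hd2]; exact Sobolev.isSmooth_smul_ofProfile _ hg
  have g1 : d.1.1.IsGivenBy fun x => ε * packet 1 0 f 0 x := by
    rw [hd1, packet, phased_zero]; exact (Sobolev.isGivenBy_ofProfile hf).smul _
  have g2 : d.2.1.IsGivenBy fun x => ε * packet α β g 0 x := by
    rw [hd2, packet, phased_zero]; exact (Sobolev.isGivenBy_ofProfile hg).smul _
  have key := hΦ d hε hs1 hs2
  obtain ⟨h0, u, v, hsol, hgiv⟩ := (key (Φ d)).2 rfl
  let w' : C(Icc (0 : ℝ) T, X × X) := ⟨fun t => conjPair hX (Φ d t),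
    (continuous_conjPair hX).comp (Φ d).continuous⟩
  have hdc : conjPair hX d = d := by
    refine Prod.ext (Subtype.ext ?_) (Subtype.ext ?_)
    · exact Sobolev.conjS_eq_self g1 fun x => by
        simp [packet_im hf']
    · exact Sobolev.conjS_eq_self g2 fun x => by
        simp [packet_im hg']
  -- The conjugate of the solution is a smooth solution with the same real data, so uniqueness makes
  -- the solution real. Continuity of conjugation on H^s is needed for the conjugate to be an
  -- admissible curve.
  have hw' : w' = Φ d := by
    refine (key w').1 ⟨?_, _, _, hsol.conj, fun t => ⟨(hgiv t).1.conjS, (hgiv t).2.conjS⟩⟩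
    change conjPair hX (Φ d _) = d
    rw [h0, hdc]
  have h0T : (0 : ℝ) ∈ Icc 0 T := left_mem_Icc.2 hT.le
  have hHc := hInf_packet 1 0 hf 0
  have hHg := hInf_packet α β hg 0
  refine ⟨u, v, ⟨hsol, fun t ht x => ?_, fun t ht x => ?_, fun x => ?_, fun x => ?_⟩,
    (hgiv ⟨T, _⟩).2⟩
  · have h1 := (hgiv ⟨t, ht⟩).1
    have h2 : (Φ d ⟨t, ht⟩).1.1.IsGivenBy fun x => conj (u t x) := by
      rw [← hw']; exact h1.conjS
    have h3 := h2.unique h1 (hsol.conj.curve_u.hInf ht) (hsol.curve_u.hInf ht)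
    exact Complex.conj_eq_iff_im.1 (congrFun h3 x)
  · have h1 := (hgiv ⟨t, ht⟩).2
    have h2 : (Φ d ⟨t, ht⟩).2.1.IsGivenBy fun x => conj (v t x) := by
      rw [← hw']; exact h1.conjS
    have h3 := h2.unique h1 (hsol.conj.curve_v.hInf ht) (hsol.curve_v.hInf ht)
    exact Complex.conj_eq_iff_im.1 (congrFun h3 x)
  · have h1 := (hgiv ⟨0, h0T⟩).1
    rw [h0] at h1
    exact congrFun (h1.unique g1 (hsol.curve_u.hInf h0T) (hHc.const_smul ε)) x
  · have h1 := (hgiv ⟨0, h0T⟩).2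
    rw [h0] at h1
    exact congrFun (h1.unique g2 (hsol.curve_v.hInf h0T) (hHg.const_smul ε)) x

end Data

/-- If `A ε` is bounded by `K` and `A ε - a` by a function tending to zero, for small `ε > 0`, then
`a` is bounded by `K`. -/
theorem norm_le_of_approx {a : ℂ} {K : ℝ} {A : ℝ → ℂ} {R : ℝ → ℝ}
    (hA : ∀ᶠ ε in 𝓝[>] (0 : ℝ), ‖A ε‖ ≤ K) (hR : Tendsto R (𝓝[>] 0) (𝓝 0))
    (h : ∀ᶠ ε in 𝓝[>] (0 : ℝ), ‖A ε - a‖ ≤ R ε) : ‖a‖ ≤ K := by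
  have h1 : Tendsto A (𝓝[>] 0) (𝓝 a) := by
    rw [tendsto_iff_norm_sub_tendsto_zero]
    exact squeeze_zero' (.of_forall fun _ => norm_nonneg _) h hR
  exact le_of_tendsto h1.norm hA

/-- Bounds for the finite differences of a `C^n` solution map along a line through the origin,
tested against a packet at the final time. -/
theorem IsLocallyWellPosed.exists_fwdDiff_bound {s : ℝ} {X : Submodule ℝ (Sobolev s)} {α β : ℝ}
    {n : ℕ} (h : IsLocallyWellPosed X α β n) (hX : IsAdmissible X) :
    ∃ T > 0, ∃ C : ℝ, 0 ≤ C ∧ ∀ f g h : ℝ → ℂ,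
      IsProfile f → IsProfile g → IsProfile h → IsHermitian f → IsHermitian g →
      ∃ F : ℝ → ℂ, (∀ᶠ ε in 𝓝 (0 : ℝ), ∃ u v, IsScaledSolution α β T f g ε u v ∧
          F ε = ∫ x, v T x * packet α β h T x) ∧
        ∀ᶠ ε in 𝓝 (0 : ℝ), ‖(fwdDiff ε)^[n] F 0‖ ≤ |ε| ^ n *
          (C * (l2 (fun ξ => Sobolev.weight s ξ * f ξ) +
            l2 fun ξ => Sobolev.weight s ξ * g ξ) ^ n * l2 fun ξ => Sobolev.weight (-s) ξ * h ξ) := by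
  obtain ⟨T, hT, r, Φ, hr, hCn, hΦ⟩ := h
  have hat : ContDiffAt ℝ n Φ 0 := hCn.contDiffAt (Metric.ball_mem_nhds _ hr)
  obtain ⟨δ, hδ, C, hC⟩ := exists_norm_iterate_fwdDiff_le n hat
  refine ⟨T, hT, |C|, abs_nonneg _, fun f g h hf hg hh hf' hg' => ?_⟩
  set d := data hX hf hg hf' hg' with hd
  set W := l2 fun ξ => Sobolev.weight (-s) ξ * h ξ with hW
  have hW0 : 0 ≤ W := l2_nonneg _
  have hTT : T ∈ Icc 0 T := right_mem_Icc.2 hT.le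
  -- The test function is the packet of h at the final time; its H^{-s} norm is that of h, since the
  -- phase has modulus one.
  let χ := 𝓕⁻ (hh.phased α β T).toSchwartz
  let P : C(Icc (0 : ℝ) T, X × X) → ℂ := fun w => (w ⟨T, hTT⟩).2.1.toDistribution χ
  have hP : ∀ w, ‖P w‖ ≤ ‖w‖ * W := by
    intro w
    refine (Sobolev.norm_toDistribution_le _ (hh.phased α β T)).trans ?_
    have e : (fun ξ => Sobolev.weight (-s) ξ * phased α β h T ξ) =
        phased α β (fun ξ => Sobolev.weight (-s) ξ * h ξ) T := by
      ext ξ; rw [phased, phased]; ring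
    rw [e, l2_phased]
    refine mul_le_mul_of_nonneg_right ?_ hW0
    exact (norm_snd_le (w ⟨T, hTT⟩)).trans (w.norm_coe_le_norm _)
  have hPs : ∀ w₁ w₂, P (w₁ - w₂) = P w₁ - P w₂ := fun w₁ w₂ => rfl
  have hcont : Tendsto (fun ε : ℝ => ‖ε • d‖) (𝓝 0) (𝓝 0) := by
    have : Continuous fun ε : ℝ => ‖ε • d‖ := by fun_prop
    simpa using this.tendsto 0
  refine ⟨fun ε => P (Φ (ε • d)), ?_, ?_⟩
  · filter_upwards [hcont.eventually_lt_const hr] with ε hε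
    obtain ⟨u, v, hs, hv⟩ := exists_isScaledSolution hX hf hg hf' hg' (hT := hT) hΦ ε
      (by rwa [mem_ball_zero_iff])
    refine ⟨u, v, hs, (hv χ).trans ?_⟩
    congr 1
    ext x
    rw [mul_comm, IsProfile.coe_fourierInv]
    rfl
  · filter_upwards [hcont.eventually_lt_const hδ] with ε hε
    -- Evaluation at time T against χ respects differences, so differences of the scalar function in
    -- ε are differences of the solution map in the direction εd.
    have h1 : ∀ (m : ℕ) (y : ℝ), (fwdDiff ε)^[m] (fun t => P (Φ (t • d))) y =
        P ((fwdDiff (ε • d))^[m] Φ (y • d)) := by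
      intro m
      induction m with
      | zero => exact fun y => rfl
      | succ m ih =>
        intro y
        rw [Function.iterate_succ_apply', Function.iterate_succ_apply', fwdDiff, fwdDiff, ih, ih,
          hPs, add_smul]
    rw [h1, zero_smul]
    refine (hP _).trans ?_
    have h2 := hC (ε • d) 0 hε (by simpa using hδ)
    have h3 : ‖ε • d‖ ≤ |ε| * (l2 (fun ξ => Sobolev.weight s ξ * f ξ) +
        l2 fun ξ => Sobolev.weight s ξ * g ξ) := by
      rw [norm_smul, Real.norm_eq_abs]
      exact mul_le_mul_of_nonneg_left (norm_data_le hX hf hg hf' hg') (abs_nonneg _)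
    calc _ ≤ (|C| * ‖ε • d‖ ^ n) * W := by
            refine mul_le_mul_of_nonneg_right (h2.trans ?_) hW0
            exact mul_le_mul_of_nonneg_right (le_abs_self _) (by positivity)
      _ ≤ |C| * (|ε| * _) ^ n * W := by gcongr
      _ = _ := by rw [mul_pow]; ring

theorem eventually_two_three_mul {p : ℝ → Prop} (h : ∀ᶠ ε in 𝓝 (0 : ℝ), p ε) :
    ∀ᶠ ε in 𝓝[>] (0 : ℝ), p 0 ∧ p ε ∧ p (2 * ε) ∧ p (3 * ε) := by
  have hm : ∀ c : ℝ, ∀ᶠ ε in 𝓝[>] (0 : ℝ), p (c * ε) := fun c =>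
    nhdsWithin_le_nhds (((by simpa using (continuous_const_mul c).tendsto 0 :
      Tendsto (fun ε : ℝ => c * ε) (𝓝 0) (𝓝 0))).eventually h)
  filter_upwards [hm 0, hm 1, hm 2, hm 3] with ε h0 h1 h2 h3
  exact ⟨by simpa using h0, by simpa using h1, h2, h3⟩

/-- Boundedness of the quadratic form in the expansion of a twice differentiable solution map. -/
theorem IsLocallyWellPosed.exists_quadratic_bound {s : ℝ} {X : Submodule ℝ (Sobolev s)} {α β : ℝ}
    (h : IsLocallyWellPosed X α β 2) (hX : IsAdmissible X) :
    ∃ T > 0, ∃ C : ℝ, 0 ≤ C ∧ ∀ f g h : ℝ → ℂ,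
      IsProfile f → IsProfile g → IsProfile h → IsHermitian f → IsHermitian g →
      ‖∫ z, ampUV f g h z * osc T (phaseUV α β z)‖ ≤
        C * (l2 (fun ξ => Sobolev.weight s ξ * f ξ) + l2 fun ξ => Sobolev.weight s ξ * g ξ) ^ 2 *
          l2 fun ξ => Sobolev.weight (-s) ξ * h ξ := by
  obtain ⟨T, hT, C, hC0, H⟩ := h.exists_fwdDiff_bound hX
  refine ⟨T, hT, C, hC0, fun f g h hf hg hh hf' hg' => ?_⟩
  obtain ⟨F, hF, hD⟩ := H f g h hf hg hh hf' hg'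
  obtain ⟨c, C', hexp⟩ := exists_quadratic_expansion (α := α) (β := β) hf hg hh hf' hg' hT
  set a := ∫ z, ampUV f g h z * osc T (phaseUV α β z) with ha
  set K := C * (l2 (fun ξ => Sobolev.weight s ξ * f ξ) +
    l2 fun ξ => Sobolev.weight s ξ * g ξ) ^ 2 * l2 fun ξ => Sobolev.weight (-s) ξ * h ξ
  have hK0 : 0 ≤ K := mul_nonneg (by positivity) (l2_nonneg _)
  have hF' : ∀ᶠ ε in 𝓝 (0 : ℝ), ‖F ε - ε * c - ε ^ 2 * a‖ ≤ C' * (ε ^ 2 * √|ε|) := by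
    filter_upwards [hF] with ε ⟨u, v, hs, hv⟩
    rw [hv]
    exact hexp ε u v hs
  -- The second difference F(2ε) - 2F(ε) + F(0) removes the linear term and turns ε²a into (4 -
  -- 2)ε²a. The expansion at ε = 0 gives F(0) = 0.
  have h2 : ‖2 * a‖ ≤ K := by
    refine norm_le_of_approx (A := fun ε => (fwdDiff ε)^[2] F 0 / ε ^ 2)
      (R := fun ε => C' * (4 * √(2 * ε)) + 2 * (C' * √ε)) ?_ ?_ ?_
    · filter_upwards [nhdsWithin_le_nhds hD, self_mem_nhdsWithin] with ε hε (hε0 : 0 < ε)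
      rw [norm_div, norm_pow, Complex.norm_real, Real.norm_eq_abs, div_le_iff₀ (by positivity),
        mul_comm]
      exact hε
    · have : Continuous fun ε : ℝ => C' * (4 * √(2 * ε)) + 2 * (C' * √ε) := by fun_prop
      simpa using (this.tendsto 0).mono_left nhdsWithin_le_nhds
    · filter_upwards [eventually_two_three_mul hF', self_mem_nhdsWithin] with ε
        ⟨h0, h1, h2, _⟩ (hε0 : 0 < ε)
      have hε' : (ε : ℂ) ≠ 0 := by exact_mod_cast hε0.ne'
      have e0 : F 0 = 0 := by simpa using h0
      have e : (fwdDiff ε)^[2] F 0 / ε ^ 2 - 2 * a =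
          ((F (2 * ε) - (2 * ε : ℝ) * c - (2 * ε : ℝ) ^ 2 * a) -
            2 * (F ε - ε * c - ε ^ 2 * a)) / ε ^ 2 := by
        simp only [Function.iterate_succ, Function.iterate_zero, Function.comp_apply, id, fwdDiff,
          zero_add, e0, ← two_mul]
        field_simp
        push_cast
        ring
      rw [e, norm_div, norm_pow, Complex.norm_real, Real.norm_eq_abs, div_le_iff₀ (by positivity),
        sq_abs]
      refine (norm_sub_le _ _).trans ?_
      rw [norm_mul]
      simp only [Complex.norm_ofNat]
      rw [abs_of_pos hε0] at h1
      rw [abs_of_pos (by positivity)] at h2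
      nlinarith
  rw [norm_mul] at h2
  simp only [Complex.norm_ofNat] at h2
  linarith [norm_nonneg a]

/-- Boundedness of the cubic form in the expansion of a thrice differentiable solution map. -/
theorem IsLocallyWellPosed.exists_cubic_bound {s : ℝ} {X : Submodule ℝ (Sobolev s)} {α β : ℝ}
    (h : IsLocallyWellPosed X α β 3) (hX : IsAdmissible X) :
    ∃ T > 0, ∃ C : ℝ, 0 ≤ C ∧ ∀ g h : ℝ → ℂ, IsProfile g → IsProfile h → IsHermitian g →
      ‖∫ z, ampVVV g h z * doubleOsc T (phaseVV α β z) (phaseUV' α β z)‖ ≤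
        C * (l2 fun ξ => Sobolev.weight s ξ * g ξ) ^ 3 *
          l2 fun ξ => Sobolev.weight (-s) ξ * h ξ := by
  obtain ⟨T, hT, C, hC0, H⟩ := h.exists_fwdDiff_bound hX
  refine ⟨T, hT, C, hC0, fun g h hg hh hg' => ?_⟩
  have hf : IsProfile 0 := ⟨contDiff_const, HasCompactSupport.zero⟩
  have hf' : IsHermitian 0 := fun ξ => by simp
  obtain ⟨F, hF, hD⟩ := H 0 g h hf hg hh hf' hg'
  obtain ⟨c, C', hexp⟩ := exists_cubic_expansion (α := α) (β := β) hg hh hg' hT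
  set a := ∫ z, ampVVV g h z * doubleOsc T (phaseVV α β z) (phaseUV' α β z) with ha
  have hl0 : l2 (fun ξ => Sobolev.weight s ξ * (0 : ℝ → ℂ) ξ) = 0 := by
    simp [l2]
  rw [hl0, zero_add] at hD
  set K := C * (l2 fun ξ => Sobolev.weight s ξ * g ξ) ^ 3 *
    l2 fun ξ => Sobolev.weight (-s) ξ * h ξ
  have hF' : ∀ᶠ ε in 𝓝 (0 : ℝ), ‖F ε - ε * c - ε ^ 3 * (1 / 2 * a)‖ ≤ C' * ε ^ 4 := by
    filter_upwards [hF] with ε ⟨u, v, hs, hv⟩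
    rw [hv]
    exact hexp ε u v hs
  -- In the third difference the cubic coefficient a/2 is multiplied by 27 - 3·8 + 3 = 6.
  have h2 : ‖3 * a‖ ≤ K := by
    refine norm_le_of_approx (A := fun ε => (fwdDiff ε)^[3] F 0 / ε ^ 3)
      -- The fourth order errors add up to 3⁴ + 3·2⁴ + 3 = 132.
      (R := fun ε => C' * (132 * ε)) ?_ ?_ ?_
    · filter_upwards [nhdsWithin_le_nhds hD, self_mem_nhdsWithin] with ε hε (hε0 : 0 < ε)
      rw [norm_div, norm_pow, Complex.norm_real, Real.norm_eq_abs, div_le_iff₀ (by positivity),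
        mul_comm]
      exact hε
    · have : Continuous fun ε : ℝ => C' * (132 * ε) := by fun_prop
      simpa using (this.tendsto 0).mono_left nhdsWithin_le_nhds
    · filter_upwards [eventually_two_three_mul hF', self_mem_nhdsWithin] with ε
        ⟨h0, h1, h2, h3⟩ (hε0 : 0 < ε)
      have hε' : (ε : ℂ) ≠ 0 := by exact_mod_cast hε0.ne'
      have e0 : F 0 = 0 := by simpa using h0
      have e : (fwdDiff ε)^[3] F 0 / ε ^ 3 - 3 * a =
          ((F (3 * ε) - (3 * ε : ℝ) * c - (3 * ε : ℝ) ^ 3 * (1 / 2 * a)) -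
            3 * (F (2 * ε) - (2 * ε : ℝ) * c - (2 * ε : ℝ) ^ 3 * (1 / 2 * a)) +
            3 * (F ε - ε * c - ε ^ 3 * (1 / 2 * a))) / ε ^ 3 := by
        simp only [Function.iterate_succ, Function.iterate_zero, Function.comp_apply, id, fwdDiff,
          zero_add, e0, ← two_mul]
        rw [show 2 * ε + ε = 3 * ε by ring]
        field_simp
        push_cast
        ring
      rw [e, norm_div, norm_pow, Complex.norm_real, Real.norm_eq_abs, div_le_iff₀ (by positivity),
        abs_of_pos hε0]
      refine (norm_add_le _ _).trans ((add_le_add_left (norm_sub_le _ _) _).trans ?_)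
      rw [norm_mul, norm_mul]
      simp only [Complex.norm_ofNat]
      linarith
  rw [norm_mul] at h2
  simp only [Complex.norm_ofNat] at h2
  linarith [norm_nonneg a]

end MajdaBiello
end

/-! ### Frequency bumps, their Sobolev norms, and elementary phase bounds. -/

noncomputable section

namespace MajdaBiello

open FourierTransform ComplexConjugate

/-- A fixed even bump function on the line. -/
def stdBump : ContDiffBump (0 : ℝ) := ⟨1 / 2, 1, by norm_num, by norm_num⟩

/-- A bump of width `γ` about `c`. -/
def bump (c γ ξ : ℝ) : ℝ := stdBump ((ξ - c) / γ)

theorem bump_nonneg (c γ ξ : ℝ) : 0 ≤ bump c γ ξ := stdBump.nonneg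

theorem bump_le_one (c γ ξ : ℝ) : bump c γ ξ ≤ 1 := stdBump.le_one

theorem bump_neg (c γ ξ : ℝ) : bump c γ (-ξ) = bump (-c) γ ξ := by
  rw [bump, bump, ← stdBump.neg]
  congr 1
  ring

theorem bump_eq_zero {c γ ξ : ℝ} (hγ : 0 < γ) (h : γ ≤ |ξ - c|) : bump c γ ξ = 0 := by
  refine stdBump.zero_of_le_dist ?_
  rw [dist_zero_right, norm_div, Real.norm_of_nonneg hγ.le, Real.norm_eq_abs, le_div_iff₀ hγ]
  simpa [stdBump] using h

theorem bump_eq_one {c γ ξ : ℝ} (hγ : 0 < γ) (h : |ξ - c| ≤ γ / 2) : bump c γ ξ = 1 := by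
  refine stdBump.one_of_mem_closedBall ?_
  rw [mem_closedBall_zero_iff, norm_div, Real.norm_of_nonneg hγ.le, Real.norm_eq_abs,
    div_le_iff₀ hγ]
  simp only [stdBump]
  linarith

theorem isProfile_bump (c : ℝ) {γ : ℝ} (hγ : 0 < γ) :
    IsProfile fun ξ => ((bump c γ ξ : ℝ) : ℂ) where
  contDiff := by
    refine Complex.ofRealCLM.contDiff.comp ?_
    refine stdBump.contDiff.comp ?_
    fun_prop
  hasCompactSupport := by
    refine HasCompactSupport.of_support_subset_isCompact (isCompact_Icc (a := c - γ) (b := c + γ))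
      fun ξ hξ => ?_
    by_contra h
    refine hξ ?_
    simp only
    rw [bump_eq_zero hγ, Complex.ofReal_zero]
    by_contra h2
    rw [not_le, abs_lt] at h2
    exact h ⟨by linarith, by linarith⟩

/-- Two symmetric bumps of width `γ` about `±c`. -/
def twoBump (c γ ξ : ℝ) : ℝ := bump c γ ξ + bump (-c) γ ξ

theorem twoBump_nonneg (c γ ξ : ℝ) : 0 ≤ twoBump c γ ξ :=
  add_nonneg (bump_nonneg _ _ _) (bump_nonneg _ _ _)

theorem twoBump_le_two (c γ ξ : ℝ) : twoBump c γ ξ ≤ 2 := by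
  have h1 := bump_le_one c γ ξ
  have h2 := bump_le_one (-c) γ ξ
  rw [twoBump]; linarith

theorem twoBump_eq_zero {c γ ξ : ℝ} (hγ : 0 < γ) (h : γ ≤ |ξ - c|) (h' : γ ≤ |ξ + c|) :
    twoBump c γ ξ = 0 := by
  rw [twoBump, bump_eq_zero hγ h, bump_eq_zero hγ (by simpa using h'), add_zero]

theorem one_le_twoBump {c γ ξ : ℝ} (hγ : 0 < γ) (h : |ξ - c| ≤ γ / 2) : 1 ≤ twoBump c γ ξ := by
  rw [twoBump, bump_eq_one hγ h]
  linarith [bump_nonneg (-c) γ ξ]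

theorem isProfile_twoBump (c : ℝ) {γ : ℝ} (hγ : 0 < γ) :
    IsProfile fun ξ => ((twoBump c γ ξ : ℝ) : ℂ) where
  contDiff := by
    simp only [twoBump, Complex.ofReal_add]
    exact (isProfile_bump c hγ).contDiff.add (isProfile_bump (-c) hγ).contDiff
  hasCompactSupport := by
    simp only [twoBump, Complex.ofReal_add]
    exact (isProfile_bump c hγ).hasCompactSupport.add (isProfile_bump (-c) hγ).hasCompactSupport

theorem isHermitian_twoBump (c γ : ℝ) : IsHermitian fun ξ => ((twoBump c γ ξ : ℝ) : ℂ) := by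
  intro ξ
  simp only
  rw [Complex.conj_ofReal, twoBump, bump_neg, bump_neg, neg_neg, add_comm, ← twoBump]

theorem l2_le_of_support {k : ℝ → ℂ} (hk : IsProfile k) {A m : ℝ} {S : Set ℝ}
    (hS : MeasurableSet S) (hSm : volume.real S ≤ m) (hSf : volume S ≠ ⊤) (hA : 0 ≤ A)
    (h1 : ∀ ξ ∈ S, ‖k ξ‖ ≤ A) (h0 : ∀ ξ ∉ S, k ξ = 0) : l2 k ≤ A * √m := by
  have hm : 0 ≤ m := measureReal_nonneg.trans hSm
  refine le_of_sq_le_sq ?_ (by positivity)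
  rw [l2_sq hk.memLp, mul_pow, Real.sq_sqrt hm]
  calc ∫ ξ, ‖k ξ‖ ^ 2 ≤ ∫ ξ, S.indicator (fun _ => A ^ 2) ξ := by
        refine integral_mono_of_nonneg (.of_forall fun _ => by positivity)
          ((integrable_indicator_iff hS).2 (integrableOn_const hSf)) (.of_forall fun ξ => ?_)
        by_cases hξ : ξ ∈ S
        · simp only [indicator_of_mem hξ]
          gcongr
          exact h1 ξ hξ
        · simp [indicator_of_notMem hξ, h0 ξ hξ]
    _ = volume.real S * A ^ 2 := by
        rw [integral_indicator hS, setIntegral_const, smul_eq_mul]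
    _ ≤ A ^ 2 * m := by rw [mul_comm]; gcongr

/-- The upper bound on |ξ| serves r ≥ 0 and the lower bound serves r ≤ 0; the constant is the sum of
the two cases. -/
theorem exists_norm_weight_le (r : ℝ) {K : ℝ} (hK : 0 < K) : ∃ C, 0 ≤ C ∧ ∀ N ξ : ℝ, 1 ≤ N →
    N / K ≤ |ξ| → |ξ| ≤ K * N → ‖Sobolev.weight r ξ‖ ≤ C * N ^ r := by
  refine ⟨(1 + K ^ 2) ^ (r / 2) + (1 / K ^ 2) ^ (r / 2), by positivity, fun N ξ hN h1 h2 => ?_⟩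
  have hN0 : 0 < N := by linarith
  have hx1 : 1 / K ^ 2 * N ^ 2 ≤ 1 + |ξ| ^ 2 := by
    have : (N / K) ^ 2 ≤ |ξ| ^ 2 := by gcongr
    rw [div_pow] at this
    have e : 1 / K ^ 2 * N ^ 2 = N ^ 2 / K ^ 2 := by ring
    linarith
  have hx2 : 1 + |ξ| ^ 2 ≤ (1 + K ^ 2) * N ^ 2 := by
    have : |ξ| ^ 2 ≤ (K * N) ^ 2 := by gcongr
    nlinarith
  have hp : ∀ c : ℝ, 0 ≤ c → (c * N ^ 2) ^ (r / 2) = c ^ (r / 2) * N ^ r := fun c hc => by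
    rw [Real.mul_rpow hc (by positivity), ← Real.rpow_natCast N 2, ← Real.rpow_mul hN0.le]
    congr 2
    push_cast; ring
  rw [Sobolev.weight, Complex.norm_real, Real.norm_of_nonneg (by positivity), Real.norm_eq_abs,
    add_mul]
  rcases le_total 0 r with hr | hr
  · have := Real.rpow_le_rpow (by positivity) hx2 (by positivity : 0 ≤ r / 2)
    rw [hp _ (by positivity)] at this
    refine this.trans (le_add_of_nonneg_right (by positivity))
  · have := Real.rpow_le_rpow_of_nonpos (by positivity) hx1 (by linarith : r / 2 ≤ 0)
    rw [hp _ (by positivity)] at this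
    refine this.trans (le_add_of_nonneg_left (by positivity))

theorem volume_two_Icc (c γ : ℝ) (hγ : 0 < γ) :
    volume.real (Icc (c - γ) (c + γ) ∪ Icc (-c - γ) (-c + γ)) ≤ 4 * γ := by
  refine (measureReal_union_le _ _).trans (le_of_eq ?_)
  rw [Real.volume_real_Icc_of_le (by linarith), Real.volume_real_Icc_of_le (by linarith)]
  ring

theorem exists_l2_weight_twoBump_le (r : ℝ) {K : ℝ} (hK : 0 < K) : ∃ C, 0 ≤ C ∧ ∀ N c γ : ℝ,
    1 ≤ N → 0 < γ → N / K + γ ≤ |c| → |c| + γ ≤ K * N →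
    l2 (fun ξ => Sobolev.weight r ξ * (twoBump c γ ξ : ℝ)) ≤ C * N ^ r * √γ := by
  obtain ⟨C, hC0, hC⟩ := exists_norm_weight_le r hK
  refine ⟨C * 2 * √4, by positivity, fun N c γ hN hγ h1 h2 => ?_⟩
  have hN0 : 0 < N := by linarith
  have h3 := l2_le_of_support ((isProfile_twoBump c hγ).weight_mul r) (A := C * N ^ r * 2)
    (S := Icc (c - γ) (c + γ) ∪ Icc (-c - γ) (-c + γ)) (measurableSet_Icc.union measurableSet_Icc)
    (volume_two_Icc c γ hγ) (measure_union_lt_top measure_Icc_lt_top measure_Icc_lt_top).ne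
    (by positivity) (fun ξ hξ => ?_) (fun ξ hξ => ?_)
  · refine h3.trans (le_of_eq ?_)
    rw [Real.sqrt_mul (by norm_num)]
    ring
  · rw [norm_mul, Complex.norm_real, Real.norm_of_nonneg (twoBump_nonneg _ _ _)]
    have h4 : |(|ξ| - |c|)| ≤ γ := by
      rcases hξ with h | h
      · exact (abs_abs_sub_abs_le _ _).trans (abs_le.2 ⟨by linarith [h.1], by linarith [h.2]⟩)
      · rw [← abs_neg c]
        exact (abs_abs_sub_abs_le _ _).trans (abs_le.2 ⟨by linarith [h.1], by linarith [h.2]⟩)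
    rw [abs_le] at h4
    exact mul_le_mul (hC N ξ hN (by linarith) (by linarith)) (twoBump_le_two _ _ _)
      (twoBump_nonneg _ _ _) (by positivity)
  · rw [mem_union, not_or] at hξ
    rw [twoBump_eq_zero hγ, Complex.ofReal_zero, mul_zero]
    · by_contra h
      rw [not_le, abs_lt] at h
      exact hξ.1 ⟨by linarith, by linarith⟩
    · by_contra h
      rw [not_le, abs_lt] at h
      exact hξ.2 ⟨by linarith, by linarith⟩

theorem exists_l2_weight_bump_le (r : ℝ) {K : ℝ} (hK : 0 < K) : ∃ C, 0 ≤ C ∧ ∀ N c γ : ℝ,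
    1 ≤ N → 0 < γ → N / K + γ ≤ |c| → |c| + γ ≤ K * N →
    l2 (fun ξ => Sobolev.weight r ξ * (bump c γ ξ : ℝ)) ≤ C * N ^ r * √γ := by
  obtain ⟨C, hC0, hC⟩ := exists_l2_weight_twoBump_le r hK
  refine ⟨C, hC0, fun N c γ hN hγ h1 h2 => (?_ : _ ≤ _).trans (hC N c γ hN hγ h1 h2)⟩
  refine ENNReal.toReal_mono ((isProfile_twoBump c hγ).weight_mul r).memLp.2.ne
    (eLpNorm_mono fun ξ => ?_)
  rw [norm_mul, norm_mul, Complex.norm_real, Complex.norm_real,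
    Real.norm_of_nonneg (twoBump_nonneg _ _ _), Real.norm_of_nonneg (bump_nonneg _ _ _), twoBump]
  gcongr
  linarith [bump_nonneg (-c) γ ξ]

theorem abs_disp_add_sub_le (α β c d : ℝ) (hd : |d| ≤ 2) : |disp α β (c + d) - disp α β c| ≤
    (4 * |α| * (2 * Real.pi) ^ 3 + |β| * (2 * Real.pi)) * (|c| + 1) ^ 2 * |d| := by
  have hpi := Real.pi_pos
  have e : disp α β (c + d) - disp α β c =
      (α * (2 * Real.pi) ^ 3 * (3 * c ^ 2 + 3 * c * d + d ^ 2) - β * (2 * Real.pi)) * d := by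
    unfold disp; ring
  have h0 := abs_nonneg c
  have h00 := abs_nonneg d
  have h1 : |3 * c ^ 2 + 3 * c * d + d ^ 2| ≤ 4 * (|c| + 1) ^ 2 := by
    refine (abs_add_three _ _ _).trans ?_
    rw [abs_mul, abs_mul, abs_mul, abs_pow, abs_pow]
    norm_num
    rw [← sq_abs c, ← sq_abs d]
    nlinarith [mul_le_mul_of_nonneg_left hd h0]
  have h2 : (1 : ℝ) ≤ (|c| + 1) ^ 2 := by nlinarith
  rw [e, abs_mul]
  refine mul_le_mul_of_nonneg_right ?_ h00
  refine (abs_sub _ _).trans ?_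
  rw [abs_mul, abs_mul, abs_mul, abs_of_pos (by positivity : 0 < (2 * Real.pi) ^ 3),
    abs_of_pos (by positivity : 0 < 2 * Real.pi), add_mul]
  have h3 : |α| * (2 * Real.pi) ^ 3 * |3 * c ^ 2 + 3 * c * d + d ^ 2| ≤
    |α| * (2 * Real.pi) ^ 3 * (4 * (|c| + 1) ^ 2) := by gcongr
  have h4 : |β| * (2 * Real.pi) * 1 ≤ |β| * (2 * Real.pi) * (|c| + 1) ^ 2 := by gcongr
  linarith

/-- Throughout the time interval the angle stays at most 1, where cos x ≥ 1 - x²/2 ≥ 1/2. -/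
theorem half_le_re_osc {T r : ℝ} (hT : 0 ≤ T) (h : |r| * T ≤ 1) : T / 2 ≤ (osc T r).re := by
  have hre : (osc T r).re = ∫ τ in 0..T, Real.cos (τ * r) := by
    rw [osc, ← Complex.reCLM_apply, ← ContinuousLinearMap.intervalIntegral_comp_comm _
      (Continuous.intervalIntegrable (by fun_prop) _ _)]
    congr 1
    ext τ
    rw [Complex.reCLM_apply, Complex.exp_ofReal_mul_I_re]
  rw [hre]
  have : ∫ _ in 0..T, (1 / 2 : ℝ) = T / 2 := by simp; ring
  rw [← this]
  refine intervalIntegral.integral_mono_on hT (by simp)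
    (Continuous.intervalIntegrable (by fun_prop) _ _) fun τ hτ => ?_
  have h1 := Real.one_sub_sq_div_two_le_cos (x := τ * r)
  have h2 : |τ * r| ≤ 1 := by
    rw [abs_mul, abs_of_nonneg hτ.1, mul_comm]
    exact (mul_le_mul_of_nonneg_left hτ.2 (abs_nonneg r)).trans h
  have h3 : (τ * r) ^ 2 ≤ 1 := by rw [← sq_abs]; nlinarith [abs_nonneg (τ * r)]
  linarith

end MajdaBiello
end

/-! ### The quadratic resonance and failure of C² well-posedness. -/

noncomputable section

namespace MajdaBiello

open FourierTransform ComplexConjugate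

/-- The resonant frequencies: `M ∼ N` with `M + N ∼ N` such that the quadratic interaction of the
frequencies `N` and `M` has vanishing phase. -/
theorem exists_resonant {α : ℝ} (β : ℝ) (h0 : 0 < α) (h4 : α < 4) (h1 : α ≠ 1) :
    ∃ K : ℝ, 0 < K ∧ ∀ᶠ N in atTop, ∃ M : ℝ, N / K ≤ |M| ∧ |M| ≤ K * N ∧ N / K ≤ N + M ∧
      N + M ≤ K * N ∧ phaseUV α β (-(N + M), M) = 0 := by
  have hpi := Real.pi_pos
  -- After division by 2πN, zero phase is the quadratic equation (2π)²(3αM² + 3αMN + (α-1)N²) = β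
  -- for M. S N is the root of its discriminant after scaling out N, M = ρ N · N is one solution,
  -- and ρ₀ is the limit ratio, in which β has disappeared. Real solutions for large N need 0 < α <
  -- 4.
  set S : ℝ → ℝ := fun N => √(3 * α * (4 - α) + 12 * α * (β / (2 * Real.pi) ^ 2) / N ^ 2) with hS
  set ρ : ℝ → ℝ := fun N => (-3 * α + S N) / (6 * α) with hρ
  set ρ₀ := (-3 * α + √(3 * α * (4 - α))) / (6 * α) with hρ₀
  have hD : 0 < 3 * α * (4 - α) := mul_pos (by positivity) (by linarith)
  have hlim1 : Tendsto (fun N : ℝ => 3 * α * (4 - α) + 12 * α * (β / (2 * Real.pi) ^ 2) / N ^ 2)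
      atTop (𝓝 (3 * α * (4 - α))) := by
    have : Tendsto (fun N : ℝ => 12 * α * (β / (2 * Real.pi) ^ 2) / N ^ 2) atTop (𝓝 0) :=
      tendsto_const_nhds.div_atTop (tendsto_pow_atTop (by norm_num))
    simpa using tendsto_const_nhds.add this
  have hlim : Tendsto ρ atTop (𝓝 ρ₀) :=
    (tendsto_const_nhds.add ((Real.continuous_sqrt.tendsto _).comp hlim1)).div_const _
  have hs0 : 0 < √(3 * α * (4 - α)) := Real.sqrt_pos.2 hD
  have hρ1 : 0 < 1 + ρ₀ := by
    have : 1 + ρ₀ = (3 * α + √(3 * α * (4 - α))) / (6 * α) := by rw [hρ₀]; field_simp; ring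
    rw [this]; positivity
  -- A vanishing ratio would mean 3α(4 - α) = 9α², that is α = 1.
  have hρ2 : ρ₀ ≠ 0 := by
    intro h
    rw [hρ₀, div_eq_zero_iff] at h
    rcases h with h | h
    · have h5 : √(3 * α * (4 - α)) = 3 * α := by linarith
      have h6 := Real.sq_sqrt hD.le
      rw [h5] at h6
      apply h1
      have : α * (α - 1) = 0 := by nlinarith
      rcases mul_eq_zero.1 this with h7 | h7 <;> linarith
    · linarith
  have hρ3 : 0 < |ρ₀| := abs_pos.2 hρ2
  set K := 2 / |ρ₀| + 2 / (1 + ρ₀) + |ρ₀| + 2 with hK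
  have hK0 : 0 < K := by positivity
  refine ⟨K, hK0, ?_⟩
  have e1 := hlim.abs.eventually_const_lt (by linarith : |ρ₀| / 2 < |ρ₀|)
  have e2 := hlim.abs.eventually_lt_const (by linarith : |ρ₀| < |ρ₀| + 1)
  have e3 := hlim.eventually_const_lt (by linarith : (1 + ρ₀) / 2 - 1 < ρ₀)
  have e4 := hlim1.eventually_const_lt hD
  filter_upwards [e1, e2, e3, e4, eventually_ge_atTop 1] with N h1 h2 h3 h4 hN
  have hN0 : 0 < N := by linarith
  have k1 : 1 / K ≤ |ρ₀| / 2 := by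
    rw [div_le_iff₀ hK0]
    have : |ρ₀| / 2 * (2 / |ρ₀|) = 1 := by field_simp
    have h5 : 2 / |ρ₀| ≤ K := by
      have : 0 < 2 / (1 + ρ₀) := by positivity
      rw [hK]; linarith
    nlinarith
  have k2 : 1 / K ≤ (1 + ρ₀) / 2 := by
    rw [div_le_iff₀ hK0]
    have : (1 + ρ₀) / 2 * (2 / (1 + ρ₀)) = 1 := by field_simp
    have h5 : 2 / (1 + ρ₀) ≤ K := by
      have : 0 < 2 / |ρ₀| := by positivity
      rw [hK]; linarith
    nlinarith
  have k3 : |ρ₀| + 2 ≤ K := by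
    have : 0 < 2 / |ρ₀| := by positivity
    have : 0 < 2 / (1 + ρ₀) := by positivity
    rw [hK]; linarith
  refine ⟨ρ N * N, ?_, ?_, ?_, ?_, ?_⟩
  · rw [abs_mul, abs_of_pos hN0, div_eq_inv_mul, ← one_div]
    gcongr; linarith
  · rw [abs_mul, abs_of_pos hN0]
    gcongr; linarith
  · have : N + ρ N * N = (1 + ρ N) * N := by ring
    rw [this, div_eq_inv_mul, ← one_div]
    gcongr; linarith
  · have : N + ρ N * N = (1 + ρ N) * N := by ring
    rw [this]
    gcongr
    linarith [le_abs_self (ρ N)]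
  · have hS2 : S N ^ 2 * N ^ 2 =
        3 * α * (4 - α) * N ^ 2 + 12 * α * (β / (2 * Real.pi) ^ 2) := by
      rw [hS, Real.sq_sqrt h4.le]
      field_simp
    have hM : 6 * α * (ρ N * N) = -3 * α * N + S N * N := by
      rw [hρ]; field_simp
    set M := ρ N * N with hM'
    have hq : (2 * Real.pi) ^ 2 * (3 * α * M ^ 2 + 3 * α * M * N + (α - 1) * N ^ 2) = β := by
      have h7 : (6 * α * M + 3 * α * N) ^ 2 = S N ^ 2 * N ^ 2 := by rw [hM]; ring
      rw [hS2] at h7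
      have h8 : 12 * α * (3 * α * M ^ 2 + 3 * α * M * N + (α - 1) * N ^ 2) =
          12 * α * (β / (2 * Real.pi) ^ 2) := by linarith
      have h9 := mul_left_cancel₀ (by positivity : 12 * α ≠ 0) h8
      rw [h9]
      field_simp
    have : phaseUV α β (-(N + M), M) = 2 * Real.pi * N *
        (β - (2 * Real.pi) ^ 2 * (3 * α * M ^ 2 + 3 * α * M * N + (α - 1) * N ^ 2)) := by
      simp only [phaseUV, disp]; ring
    rw [this, hq, sub_self, mul_zero]

/-- The three dispersion relations are cubic polynomials, so moving the frequencies by x and y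
changes the phase by at most the square of the frequency size times |x| + |y|. -/
theorem abs_phaseUV_sub_le (α β c d x y : ℝ) (hx : |x| ≤ 1) (hy : |y| ≤ 1) :
    |phaseUV α β (c + x, d + y) - phaseUV α β (c, d)| ≤
      (4 * (|α| + 1) * (2 * Real.pi) ^ 3 + |β| * (2 * Real.pi)) * (|c| + |d| + 1) ^ 2 *
        (2 * (|x| + |y|)) := by
  have hpi := Real.pi_pos
  have h1 := abs_disp_add_sub_le α β c x (by linarith)
  have h2 := abs_disp_add_sub_le α β d y (by linarith)
  have h3 := abs_disp_add_sub_le 1 0 (-c - d) (-x - y) (by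
    rw [← neg_add', abs_neg]; exact (abs_add_le _ _).trans (by linarith))
  have e : phaseUV α β (c + x, d + y) - phaseUV α β (c, d) =
      (disp α β (c + x) - disp α β c) + (disp α β (d + y) - disp α β d) +
        (disp 1 0 (-c - d + (-x - y)) - disp 1 0 (-c - d)) := by
    simp only [phaseUV]
    rw [show -(c + x) - (d + y) = -c - d + (-x - y) by ring]
    ring
  have e1 : |-x - y| ≤ |x| + |y| := by rw [← neg_add', abs_neg]; exact abs_add_le _ _
  have e2 : |-c - d| ≤ |c| + |d| := by rw [← neg_add', abs_neg]; exact abs_add_le _ _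
  set L := 4 * (|α| + 1) * (2 * Real.pi) ^ 3 + |β| * (2 * Real.pi) with hL
  have hα := abs_nonneg α
  have hβ := abs_nonneg β
  have hc := abs_nonneg c
  have hd := abs_nonneg d
  have l1 : 4 * |α| * (2 * Real.pi) ^ 3 + |β| * (2 * Real.pi) ≤ L := by
    rw [hL]; gcongr; linarith
  have l2 : 4 * |(1 : ℝ)| * (2 * Real.pi) ^ 3 + |(0 : ℝ)| * (2 * Real.pi) ≤ L := by
    rw [hL, abs_one, abs_zero]; gcongr; linarith
  have hL0 : 0 ≤ L := by positivity
  rw [e]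
  refine (abs_add_three _ _ _).trans ?_
  have h1' : _ ≤ L * (|c| + |d| + 1) ^ 2 * |x| := h1.trans (by gcongr; linarith)
  have h2' : _ ≤ L * (|c| + |d| + 1) ^ 2 * |y| := h2.trans (by gcongr; linarith)
  have h3' : _ ≤ L * (|c| + |d| + 1) ^ 2 * (|x| + |y|) := h3.trans (by gcongr)
  linarith

/-- Lower bound for the quadratic form at a resonant configuration. -/
theorem le_norm_integral_ampUV {α β T N M γ A : ℝ} (hT : 0 ≤ T) (hγ : 0 < γ)
    (hA : 3 * γ ≤ A) (hM : A ≤ |M|) (hNM : A ≤ N + M)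
    (hphase : ∀ x y, |x| ≤ γ → |y| ≤ γ → |phaseUV α β (-(N + M) + x, M + y)| * T ≤ 1) :
    γ ^ 2 / 4 * (A * T) ≤
      ‖∫ z, ampUV (fun ξ => (twoBump N γ ξ : ℝ)) (fun ξ => (twoBump M γ ξ : ℝ))
        (fun ξ => (bump (-(N + M)) γ ξ : ℝ)) z * osc T (phaseUV α β z)‖ := by
  set F := fun z : ℝ × ℝ => ampUV (fun ξ => (twoBump N γ ξ : ℝ)) (fun ξ => (twoBump M γ ξ : ℝ))
        (fun ξ => (bump (-(N + M)) γ ξ : ℝ)) z * osc T (phaseUV α β z) with hF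
  have hpi := Real.pi_gt_three
  -- The amplitude is purely imaginary, so -Im F is a real amplitude times the real part of `osc`.
  -- With -z.1 near N + M > 0 it is pointwise nonnegative, and the integral cannot lose by
  -- cancellation.
  have him : ∀ z : ℝ × ℝ, -(F z).im = 2 * Real.pi * (-z.1) * (bump (-(N + M)) γ z.1 *
      (twoBump M γ z.2 * twoBump N γ (-z.1 - z.2))) * (osc T (phaseUV α β z)).re := by
    intro z
    have : F z = ((2 * Real.pi * z.1 * (bump (-(N + M)) γ z.1 *
      (twoBump M γ z.2 * twoBump N γ (-z.1 - z.2))) : ℝ) : ℂ) *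
        (Complex.I * osc T (phaseUV α β z)) := by
      simp only [hF, ampUV]
      push_cast
      ring
    rw [this, Complex.im_ofReal_mul, Complex.I_mul_im]
    ring
  have hprod : ∀ z : ℝ × ℝ, 0 ≤ bump (-(N + M)) γ z.1 *
      (twoBump M γ z.2 * twoBump N γ (-z.1 - z.2)) := fun z =>
    mul_nonneg (bump_nonneg _ _ _) (mul_nonneg (twoBump_nonneg _ _ _) (twoBump_nonneg _ _ _))
  have hA0 : 0 < A := by linarith
  have hlow : ∀ z : ℝ × ℝ, bump (-(N + M)) γ z.1 *
      (twoBump M γ z.2 * twoBump N γ (-z.1 - z.2)) * (A * T) ≤ -(F z).im := by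
    intro z
    rw [him]
    by_cases h0 : bump (-(N + M)) γ z.1 * (twoBump M γ z.2 * twoBump N γ (-z.1 - z.2)) = 0
    · rw [h0]; simp
    have h1 : |z.1 + (N + M)| < γ := by
      by_contra h
      exact h0 (by rw [bump_eq_zero hγ (by rw [sub_neg_eq_add]; exact not_lt.1 h), zero_mul])
    have h2 : |z.2 - M| < γ ∨ |z.2 + M| < γ := by
      by_contra! h
      exact h0 (by rw [twoBump_eq_zero hγ h.1 h.2, zero_mul, mul_zero])
    have h3 : |-z.1 - z.2 - N| < γ ∨ |-z.1 - z.2 + N| < γ := by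
      by_contra! h
      exact h0 (by rw [twoBump_eq_zero hγ h.1 h.2, mul_zero, mul_zero])
    -- The even profiles add mirror frequencies, but h sits only at -(N+M). If z.2 were near -M, the
    -- frequency of u would be near N + 2M, which is within the widths of ±N only if |2M| or 2(N+M)
    -- were below 3γ.
    have h4 : |z.2 - M| < γ := by
      refine h2.resolve_right fun h => ?_
      rw [abs_lt] at h h1
      rcases h3 with h3 | h3 <;> rw [abs_lt] at h3
      · rcases abs_cases M with hM' | hM' <;> linarith
      · linarith
    have h5 : T / 2 ≤ (osc T (phaseUV α β z)).re := by
      refine half_le_re_osc hT ?_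
      have := hphase (z.1 + (N + M)) (z.2 - M) h1.le h4.le
      rw [show -(N + M) + (z.1 + (N + M)) = z.1 by ring, show M + (z.2 - M) = z.2 by ring] at this
      exact this
    have h6 : A * T ≤ 2 * Real.pi * (-z.1) * (osc T (phaseUV α β z)).re := by
      rw [abs_lt] at h1
      have h7 : 2 * A ≤ 2 * Real.pi * (-z.1) := by nlinarith
      nlinarith
    have := mul_le_mul_of_nonneg_left h6 (hprod z)
    linarith
  have hint : Integrable F := by
    refine (integrable_ampUV (isProfile_twoBump N hγ) (isProfile_twoBump M hγ)
      (isProfile_bump _ hγ)).mul_bdd (c := T) ?_ (.of_forall fun z => norm_osc_le hT _)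
    exact (continuous_osc.comp (continuous_const.prodMk
      (continuous_phaseUV α β))).aestronglyMeasurable
  -- With both variables within γ/4 of the centre, the third frequency is within γ/2, so every bump
  -- is at least 1 on this square.
  set S : Set (ℝ × ℝ) := Icc (-(N + M) - γ / 4) (-(N + M) + γ / 4) ×ˢ Icc (M - γ / 4) (M + γ / 4)
  have hS : MeasurableSet S := measurableSet_Icc.prod measurableSet_Icc
  have hvol : volume.real S = γ ^ 2 / 4 := by
    rw [measureReal_def, Measure.volume_eq_prod, Measure.prod_prod, ENNReal.toReal_mul,
      ← measureReal_def, ← measureReal_def, Real.volume_real_Icc_of_le (by linarith),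
      Real.volume_real_Icc_of_le (by linarith)]
    ring
  have hSf : volume S ≠ ⊤ := (isCompact_Icc.prod isCompact_Icc).measure_lt_top.ne
  have hAT : 0 ≤ A * T := by positivity
  calc γ ^ 2 / 4 * (A * T) = ∫ z, S.indicator (fun _ => A * T) z := by
        rw [integral_indicator hS, setIntegral_const, smul_eq_mul, hvol]
    _ ≤ ∫ z, -(F z).im := by
        refine integral_mono ((integrable_indicator_iff hS).2 (integrableOn_const hSf))
          hint.im.neg fun z => ?_
        by_cases hz : z ∈ S
        · simp only [indicator_of_mem hz]
          refine (le_mul_of_one_le_left hAT ?_).trans (hlow z)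
          obtain ⟨⟨a1, a2⟩, a3, a4⟩ := hz
          rw [bump_eq_one hγ (abs_le.2 ⟨by linarith, by linarith⟩), one_mul]
          exact one_le_mul_of_one_le_of_one_le
            (one_le_twoBump hγ (abs_le.2 ⟨by linarith, by linarith⟩))
            (one_le_twoBump hγ (abs_le.2 ⟨by linarith, by linarith⟩))
        · simp only [indicator_of_notMem hz]
          exact (mul_nonneg (hprod z) hAT).trans (hlow z)
    _ = -(∫ z, F z).im := by
        rw [integral_neg, neg_inj]
        exact integral_im hint
    _ ≤ ‖∫ z, F z‖ := (neg_le_abs _).trans (Complex.abs_im_le_norm _)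

theorem not_isLocallyWellPosed_two {s : ℝ} {X : Submodule ℝ (Sobolev s)} (hX : IsAdmissible X)
    {α : ℝ} (β : ℝ) (h0 : 0 < α) (h4 : α < 4) (h1 : α ≠ 1) (hs : s < 0) :
    ¬ IsLocallyWellPosed X α β 2 := by
  intro hwp
  obtain ⟨T, hT, C, hC0, hbound⟩ := hwp.exists_quadratic_bound hX
  obtain ⟨K, hK, hres⟩ := exists_resonant β h0 h4 h1
  -- The resonant frequencies lie between N/K and KN; the larger constant leaves room for bumps of
  -- width at most 1.
  have hK' : 0 < 2 * (K + 1) := by positivity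
  obtain ⟨C₁, hC₁, hw₁⟩ := exists_l2_weight_twoBump_le s hK'
  obtain ⟨C₂, hC₂, hw₂⟩ := exists_l2_weight_bump_le (-s) hK'
  set L := 4 * (|α| + 1) * (2 * Real.pi) ^ 3 + |β| * (2 * Real.pi) with hL
  have hL0 : 0 ≤ L := by have := Real.pi_pos; positivity
  have hy : Tendsto (fun N : ℝ => N ^ (s / 2)) atTop (𝓝 0) := by
    have := tendsto_rpow_neg_atTop (y := -(s / 2)) (by linarith)
    simpa using this
  have hy1 : Tendsto (fun N : ℝ => L * (2 * K + 1) ^ 2 * 4 * T * (N ^ (s / 2)) ^ 2) atTop (𝓝 0) := by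
    simpa using (hy.pow 2).const_mul (L * (2 * K + 1) ^ 2 * 4 * T)
  have hy2 : Tendsto (fun N : ℝ => 16 * (K + 1) * C * C₁ ^ 2 * C₂ * N ^ (s / 2)) atTop (𝓝 0) := by
    simpa using hy.const_mul (16 * (K + 1) * C * C₁ ^ 2 * C₂)
  obtain ⟨N, ⟨M, m1, m2, m3, m4, m5⟩, n1, n2, n3, n4⟩ := (hres.and
    ((hy.eventually_lt_const one_pos).and ((hy1.eventually_lt_const one_pos).and
    ((hy2.eventually_lt_const hT).and (eventually_ge_atTop (3 * (K + 1))))))).exists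
  have hN1 : 1 ≤ N := by linarith
  have hN0 : 0 < N := by linarith
  have e1 : N ^ s = (N ^ (s / 2)) ^ 2 := by
    rw [← Real.rpow_natCast, ← Real.rpow_mul hN0.le]; congr 1; push_cast; ring
  have e2 : N ^ (-s) = ((N ^ (s / 2)) ^ 2)⁻¹ := by rw [Real.rpow_neg hN0.le, e1]
  set y := N ^ (s / 2) with hydef
  have hy0 : 0 < y := Real.rpow_pos_of_pos hN0 _
  have hγ : 0 < (y / N) ^ 2 := by positivity
  have hsq : √((y / N) ^ 2) = y / N := Real.sqrt_sq (by positivity)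
  -- Thus γ = N^{s-2}: the phase varies by about N²γ = N^s over the bumps, which tends to zero, and
  -- γ is written as a square to make √γ explicit.
  set γ := (y / N) ^ 2 with hγdef
  have hyN : y / N ≤ 1 := by rw [div_le_one hN0]; linarith
  have hγ1 : γ ≤ 1 := pow_le_one₀ (by positivity) hyN
  have hA1 : 3 ≤ N / (K + 1) := by rw [le_div_iff₀ (by positivity)]; exact n4
  have hA2 : N / (K + 1) ≤ N / K := by gcongr; linarith
  have hA3 : N / (K + 1) ≤ N := div_le_self hN0.le (by linarith)
  have hA4 : N / (2 * (K + 1)) = N / (K + 1) / 2 := by field_simp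
  have hM1 : |N + M| = N + M := abs_of_pos (by linarith)
  have hKN : K * N + 1 ≤ 2 * (K + 1) * N := by nlinarith
  have l1 := hw₁ N N γ hN1 hγ (by rw [hA4, abs_of_pos hN0]; linarith)
    (by rw [abs_of_pos hN0]; nlinarith)
  have l2' := hw₁ N M γ hN1 hγ (by rw [hA4]; linarith) (by linarith)
  have l3 := hw₂ N (-(N + M)) γ hN1 hγ (by rw [hA4, abs_neg, hM1]; linarith)
    (by rw [abs_neg, hM1]; linarith)
  have key := hbound _ _ _ (isProfile_twoBump N hγ) (isProfile_twoBump M hγ)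
    (isProfile_bump (-(N + M)) hγ) (isHermitian_twoBump N γ) (isHermitian_twoBump M γ)
  have low := le_norm_integral_ampUV (α := α) (β := β) (T := T) (N := N) (M := M) (γ := γ)
    (A := N / (K + 1)) hT.le hγ (by linarith) (by linarith) (by linarith)
    (fun a b ha hb => ?_)
  -- Lower and upper bound share the factor y⁴/N³. What is left is T ≤ const · N^{s/2}, which is
  -- false for large N.
  · have h2 := low.trans key
    rw [e1, hsq] at l1 l2'
    rw [e2, hsq] at l3
    have h3 : γ ^ 2 / 4 * (N / (K + 1) * T) ≤
        C * (C₁ * y ^ 2 * (y / N) + C₁ * y ^ 2 * (y / N)) ^ 2 * (C₂ * (y ^ 2)⁻¹ * (y / N)) := by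
      refine h2.trans ?_
      have := l2_nonneg (fun ξ => Sobolev.weight s ξ * (twoBump N γ ξ : ℝ))
      have := l2_nonneg (fun ξ => Sobolev.weight s ξ * (twoBump M γ ξ : ℝ))
      have := l2_nonneg (fun ξ => Sobolev.weight (-s) ξ * (bump (-(N + M)) γ ξ : ℝ))
      gcongr
    have e3 : γ ^ 2 / 4 * (N / (K + 1) * T) = (y ^ 4 / (4 * (K + 1) * N ^ 3)) * T := by
      rw [hγdef]; field_simp
    have e4 : C * (C₁ * y ^ 2 * (y / N) + C₁ * y ^ 2 * (y / N)) ^ 2 * (C₂ * (y ^ 2)⁻¹ * (y / N)) =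
        (y ^ 4 / (4 * (K + 1) * N ^ 3)) * (16 * (K + 1) * C * C₁ ^ 2 * C₂ * y) := by
      field_simp; ring
    rw [e3, e4] at h3
    have := le_of_mul_le_mul_left h3 (by positivity)
    linarith
  · have h5 := abs_phaseUV_sub_le α β (-(N + M)) M a b (ha.trans hγ1) (hb.trans hγ1)
    rw [m5, sub_zero, abs_neg, hM1] at h5
    have h6 : (N + M + |M| + 1) ^ 2 ≤ ((2 * K + 1) * N) ^ 2 := by
      have : 0 ≤ N + M + |M| + 1 := by linarith [abs_nonneg M]
      gcongr
      linarith
    calc _ ≤ L * ((2 * K + 1) * N) ^ 2 * (2 * (γ + γ)) * T := by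
          refine mul_le_mul_of_nonneg_right (h5.trans ?_) hT.le
          gcongr
      _ = L * (2 * K + 1) ^ 2 * 4 * T * y ^ 2 := by rw [hγdef]; field_simp; ring
      _ ≤ 1 := n2.le

end MajdaBiello
end

/-! ### The oscillatory factor of the cubic form and its scaling. -/

noncomputable section

namespace MajdaBiello

open FourierTransform ComplexConjugate

theorem mul_doubleOsc (T ψ l : ℝ) :
    (ψ * Complex.I) * doubleOsc T ψ l = osc T (l + ψ) - osc T l := by
  have h1 : Continuous fun τ : ℝ => Complex.exp ((τ * (l + ψ) : ℝ) * Complex.I) := by fun_prop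
  have h2 : Continuous fun τ : ℝ => Complex.exp ((τ * l : ℝ) * Complex.I) := by fun_prop
  rw [doubleOsc, osc, osc, ← intervalIntegral.integral_const_mul,
    ← intervalIntegral.integral_sub (h1.intervalIntegrable _ _) (h2.intervalIntegrable _ _)]
  refine intervalIntegral.integral_congr fun τ _ => ?_
  rw [← mul_assoc, mul_osc, sub_mul, one_mul, ← Complex.exp_add]
  congr 2
  push_cast
  ring

theorem continuous_doubleOsc (T : ℝ) : Continuous fun p : ℝ × ℝ => doubleOsc T p.1 p.2 := by
  unfold doubleOsc
  refine intervalIntegral.continuous_parametric_intervalIntegral_of_continuous (μ := volume)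
    (f := fun (p : ℝ × ℝ) (τ : ℝ) => osc τ p.1 * Complex.exp ((τ * p.2 : ℝ) * Complex.I))
    ?_ continuous_const
  have : Continuous fun q : (ℝ × ℝ) × ℝ => osc q.2 q.1.1 :=
    continuous_osc.comp (continuous_snd.prodMk (continuous_fst.comp continuous_fst))
  simp only [Function.uncurry_def]
  fun_prop

theorem tendsto_osc_zero {ι : Type*} {L : Filter ι} {r : ι → ℝ} (T : ℝ)
    (hr : Tendsto r L (𝓝 0)) : Tendsto (fun i => osc T (r i)) L (𝓝 T) := by
  have h := (continuous_osc.comp (continuous_const.prodMk continuous_id : Continuous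
    fun r : ℝ => (T, r))).tendsto 0
  have h0 : osc T 0 = T := by simp [osc]
  simp only [Function.comp_def, h0] at h
  exact h.comp hr

theorem tendsto_osc_atTop {ι : Type*} {L : Filter ι} {r : ι → ℝ} (T : ℝ)
    (hr : Tendsto (fun i => |r i|) L atTop) : Tendsto (fun i => osc T (r i)) L (𝓝 0) := by
  refine squeeze_zero_norm' ?_ ((tendsto_const_nhds (x := (2 : ℝ))).div_atTop hr)
  filter_upwards [hr.eventually_gt_atTop 0] with i hi
  rw [le_div_iff₀ hi, mul_comm]
  exact abs_mul_norm_osc_le T (r i)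

/-- The quotient of the phase of an interaction of two frequencies of `v` by the sum of the
frequencies. -/
def resFactor (α β η₁ η₂ : ℝ) : ℝ :=
  (2 * Real.pi) ^ 3 * (α * (η₁ ^ 2 - η₁ * η₂ + η₂ ^ 2) - (η₁ + η₂) ^ 2) - β * (2 * Real.pi)

/-- The phase is divisible by the frequency of the intermediate u. The derivative in the equation of
u supplies the same factor, so the division by the phase in `mul_doubleOsc` costs only `resFactor`,
even where that frequency is close to zero. -/
theorem phaseVV_eq (α β : ℝ) (z : ℝ × ℝ × ℝ) :
    phaseVV α β z = -z.1 * resFactor α β z.2.1 (-z.1 - z.2.1) := by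
  simp only [phaseVV, disp, resFactor]; ring

/-- In the total phase the intermediate u and β drop out. It is the cubic resonance function of four
frequencies of sum zero, the product of the pairwise sums, and vanishes when any two frequencies
cancel. -/
theorem phaseUV'_add_phaseVV (α β : ℝ) (z : ℝ × ℝ × ℝ) : phaseUV' α β z + phaseVV α β z =
    3 * α * (2 * Real.pi) ^ 3 * (z.1 * (-z.1 - z.2.1 + z.2.2) * (z.2.1 + z.2.2)) := by
  simp only [phaseVV, phaseUV', disp]; ring

theorem mul_doubleOsc_eq {α β : ℝ} (T : ℝ) {z : ℝ × ℝ × ℝ}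
    (hE : resFactor α β z.2.1 (-z.1 - z.2.1) ≠ 0) :
    z.1 * doubleOsc T (phaseVV α β z) (phaseUV' α β z) =
      Complex.I / resFactor α β z.2.1 (-z.1 - z.2.1) *
        (osc T (phaseUV' α β z + phaseVV α β z) - osc T (phaseUV' α β z)) := by
  have h1 := mul_doubleOsc T (phaseVV α β z) (phaseUV' α β z)
  have h2 : (phaseVV α β z : ℂ) = -z.1 * resFactor α β z.2.1 (-z.1 - z.2.1) := by
    rw [phaseVV_eq]; push_cast; ring
  have h3 : (resFactor α β z.2.1 (-z.1 - z.2.1) : ℂ) ≠ 0 := by exact_mod_cast hE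
  rw [← h1, h2]
  field_simp
  linear_combination (z.1 * doubleOsc T (phaseVV α β z) (phaseUV' α β z)) * Complex.I_sq

/-- The amplitude of a cubic interaction of three functions, tested against `h`. -/
def ampCubic (k₁ k₂ k₃ h : ℝ → ℂ) (z : ℝ × ℝ × ℝ) : ℂ :=
  (2 * Real.pi * Complex.I * z.1) * (k₁ z.2.1 * k₂ (-z.1 - z.2.1)) *
    (k₃ z.2.2 * ((2 * Real.pi * Complex.I * (z.1 - z.2.2 : ℝ)) * h (z.1 - z.2.2)))

/-- The limit configuration of the four bumps. -/
def bumpProfile (x : ℝ × ℝ × ℝ) : ℝ :=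
  bump 0 1 x.2.1 * bump 0 1 (-x.1 - x.2.1) * (bump 0 1 x.2.2 * bump 0 1 (x.1 - x.2.2))

theorem continuous_bump (c γ : ℝ) : Continuous (bump c γ) := by
  unfold bump
  exact stdBump.continuous.comp (by fun_prop)

theorem bumpProfile_nonneg (x : ℝ × ℝ × ℝ) : 0 ≤ bumpProfile x :=
  mul_nonneg (mul_nonneg (bump_nonneg _ _ _) (bump_nonneg _ _ _))
    (mul_nonneg (bump_nonneg _ _ _) (bump_nonneg _ _ _))

theorem continuous_bumpProfile : Continuous bumpProfile := by
  have := continuous_bump 0 1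
  unfold bumpProfile
  fun_prop

theorem abs_lt_of_bumpProfile_ne_zero {x : ℝ × ℝ × ℝ} (hx : bumpProfile x ≠ 0) :
    |x.2.1| < 1 ∧ |-x.1 - x.2.1| < 1 ∧ |x.2.2| < 1 ∧ |x.1 - x.2.2| < 1 := by
  have h : ∀ y, bump 0 1 y ≠ 0 → |y| < 1 := fun y hy => by
    by_contra h
    exact hy (bump_eq_zero one_pos (by simpa using h))
  simp only [bumpProfile, mul_ne_zero_iff] at hx
  exact ⟨h _ hx.1.1, h _ hx.1.2, h _ hx.2.1, h _ hx.2.2⟩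

theorem hasCompactSupport_bumpProfile : HasCompactSupport bumpProfile := by
  refine HasCompactSupport.of_support_subset_isCompact
    ((isCompact_Icc (a := -2) (b := 2)).prod
      ((isCompact_Icc (a := -1) (b := 1)).prod (isCompact_Icc (a := -1) (b := 1)))) fun x hx => ?_
  obtain ⟨h1, -, h3, h4⟩ := abs_lt_of_bumpProfile_ne_zero hx
  rw [abs_lt] at h1 h3 h4
  exact ⟨⟨by linarith, by linarith⟩, ⟨h1.1.le, h1.2.le⟩, ⟨h3.1.le, h3.2.le⟩⟩

theorem integrable_bumpProfile : Integrable bumpProfile :=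
  continuous_bumpProfile.integrable_of_hasCompactSupport hasCompactSupport_bumpProfile

theorem integral_bumpProfile_pos : 0 < ∫ x, bumpProfile x := by
  refine continuous_bumpProfile.integral_pos_of_hasCompactSupport_nonneg_nonzero
    hasCompactSupport_bumpProfile bumpProfile_nonneg (x := 0) ?_
  have : bump 0 1 0 = 1 := bump_eq_one one_pos (by norm_num)
  simp [bumpProfile, this]

instance isAddHaarMeasure_volume_prod : (volume : Measure (ℝ × ℝ × ℝ)).IsAddHaarMeasure := by
  have : (volume : Measure (ℝ × ℝ)).IsAddHaarMeasure := by
    rw [Measure.volume_eq_prod]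
    infer_instance
  rw [Measure.volume_eq_prod]
  infer_instance

theorem integral_comp_affine (F : ℝ × ℝ × ℝ → ℂ) (c : ℝ × ℝ × ℝ) {γ : ℝ} (hγ : 0 < γ) :
    ∫ z, F z = γ ^ 3 * ∫ x, F (c + γ • x) := by
  have h1 := Measure.integral_comp_smul (volume : Measure (ℝ × ℝ × ℝ)) (fun z => F (c + z)) γ
  rw [integral_add_left_eq_self F c] at h1
  rw [h1]
  have h2 : Module.finrank ℝ (ℝ × ℝ × ℝ) = 3 := by simp
  rw [h2, abs_of_pos (by positivity), Complex.real_smul, ← mul_assoc]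
  push_cast
  rw [mul_inv_cancel₀, one_mul]
  exact_mod_cast (by positivity : γ ^ 3 ≠ 0)

theorem bump_affine (c : ℝ) {γ : ℝ} (hγ : 0 < γ) (y : ℝ) : bump c γ (c + γ * y) = bump 0 1 y := by
  rw [bump, bump]
  congr 1
  field_simp
  ring

/-- In units of N the coefficient β becomes β/N², so the limit N → ∞ sees β = 0. -/
theorem resFactor_scale (α β s₁ s₂ a b : ℝ) {N : ℝ} (hN : N ≠ 0) :
    resFactor α β (s₁ * N + a) (s₂ * N + b) =
      N ^ 2 * resFactor α (β * N⁻¹ ^ 2) (s₁ + a / N) (s₂ + b / N) := by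
  simp only [resFactor]
  field_simp

/-- The integrand of the cubic form for four bumps. -/
def bumpIntegrand (α β T s₁ s₂ s₃ N γ : ℝ) (z : ℝ × ℝ × ℝ) : ℂ :=
  ampCubic (fun ξ => (bump (s₁ * N) γ ξ : ℝ)) (fun ξ => (bump (s₂ * N) γ ξ : ℝ))
    (fun ξ => (bump (s₃ * N) γ ξ : ℝ)) (fun ξ => (bump (-N) γ ξ : ℝ)) z *
      doubleOsc T (phaseVV α β z) (phaseUV' α β z)

theorem continuous_ampCubic {k₁ k₂ k₃ h : ℝ → ℂ} (h₁ : Continuous k₁) (h₂ : Continuous k₂)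
    (h₃ : Continuous k₃) (h₄ : Continuous h) : Continuous (ampCubic k₁ k₂ k₃ h) := by
  unfold ampCubic
  fun_prop

theorem continuous_bumpIntegrand (α β T s₁ s₂ s₃ N γ : ℝ) :
    Continuous (bumpIntegrand α β T s₁ s₂ s₃ N γ) := by
  have h1 : Continuous fun z => doubleOsc T (phaseVV α β z) (phaseUV' α β z) :=
    Continuous.comp (g := fun p : ℝ × ℝ => doubleOsc T p.1 p.2)
      (f := fun z => (phaseVV α β z, phaseUV' α β z)) (continuous_doubleOsc T)
      ((continuous_phaseVV α β).prodMk (continuous_phaseUV' α β))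
  have h2 : ∀ c, Continuous fun ξ => ((bump c γ ξ : ℝ) : ℂ) := fun c =>
    Complex.continuous_ofReal.comp (continuous_bump c γ)
  exact (continuous_ampCubic (h2 _) (h2 _) (h2 _) (h2 _)).mul h1

/-- The phase point of the scaled variable `x`. -/
def scaledPoint (s₁ s₂ s₃ N γ : ℝ) (x : ℝ × ℝ × ℝ) : ℝ × ℝ × ℝ :=
  (-(s₁ + s₂) * N, s₁ * N, s₃ * N) + γ • x

section scaled

variable (α β T : ℝ) {s₁ s₂ s₃ N γ : ℝ} (x : ℝ × ℝ × ℝ)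

theorem scaledPoint_fst : (scaledPoint s₁ s₂ s₃ N γ x).1 = -(s₁ + s₂) * N + γ * x.1 := rfl

theorem scaledPoint_snd_fst : (scaledPoint s₁ s₂ s₃ N γ x).2.1 = s₁ * N + γ * x.2.1 := rfl

theorem scaledPoint_snd_snd : (scaledPoint s₁ s₂ s₃ N γ x).2.2 = s₃ * N + γ * x.2.2 := rfl

theorem neg_scaledPoint_sub : -(scaledPoint s₁ s₂ s₃ N γ x).1 - (scaledPoint s₁ s₂ s₃ N γ x).2.1 =
    s₂ * N + γ * (-x.1 - x.2.1) := by
  rw [scaledPoint_fst, scaledPoint_snd_fst]; ring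

theorem scaledPoint_sub (hs : s₁ + s₂ + s₃ = 1) :
    (scaledPoint s₁ s₂ s₃ N γ x).1 - (scaledPoint s₁ s₂ s₃ N γ x).2.2 =
    -N + γ * (x.1 - x.2.2) := by
  rw [scaledPoint_fst, scaledPoint_snd_snd]
  linear_combination -N * hs

theorem bumpIntegrand_scaledPoint (hs : s₁ + s₂ + s₃ = 1) (hγ : 0 < γ) :
    bumpIntegrand α β T s₁ s₂ s₃ N γ (scaledPoint s₁ s₂ s₃ N γ x) =
      (2 * Real.pi * Complex.I) ^ 2 * (-N + γ * (x.1 - x.2.2) : ℝ) * bumpProfile x *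
        ((scaledPoint s₁ s₂ s₃ N γ x).1 * doubleOsc T (phaseVV α β (scaledPoint s₁ s₂ s₃ N γ x))
          (phaseUV' α β (scaledPoint s₁ s₂ s₃ N γ x))) := by
  rw [bumpIntegrand, ampCubic, neg_scaledPoint_sub, scaledPoint_sub x hs, scaledPoint_snd_fst,
    scaledPoint_snd_snd, bump_affine _ hγ, bump_affine _ hγ, bump_affine _ hγ, bump_affine _ hγ,
    bumpProfile]
  push_cast
  ring

theorem resFactor_scaledPoint (hN : N ≠ 0) : resFactor α β (scaledPoint s₁ s₂ s₃ N γ x).2.1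
      (-(scaledPoint s₁ s₂ s₃ N γ x).1 - (scaledPoint s₁ s₂ s₃ N γ x).2.1) =
    N ^ 2 * resFactor α (β * N⁻¹ ^ 2) (s₁ + γ * x.2.1 / N) (s₂ + γ * (-x.1 - x.2.1) / N) := by
  rw [neg_scaledPoint_sub, scaledPoint_snd_fst, resFactor_scale _ _ _ _ _ _ hN]

/-- The derivative on h gives N and the reciprocal of `resFactor` gives N^{-2}; multiplication by N
leaves an expression with a limit, namely a smooth amplitude times the difference of two oscillating
integrals. -/
theorem bumpIntegrand_scaled (hs : s₁ + s₂ + s₃ = 1) (hγ : 0 < γ) (hN : 0 < N)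
    (hE : resFactor α (β * N⁻¹ ^ 2) (s₁ + γ * x.2.1 / N) (s₂ + γ * (-x.1 - x.2.1) / N) ≠ 0) :
    N * bumpIntegrand α β T s₁ s₂ s₃ N γ (scaledPoint s₁ s₂ s₃ N γ x) =
      (((1 - γ * (x.1 - x.2.2) / N) /
          resFactor α (β * N⁻¹ ^ 2) (s₁ + γ * x.2.1 / N) (s₂ + γ * (-x.1 - x.2.1) / N) *
          (4 * Real.pi ^ 2 * bumpProfile x) : ℝ) : ℂ) * Complex.I *
        (osc T (phaseUV' α β (scaledPoint s₁ s₂ s₃ N γ x) +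
            phaseVV α β (scaledPoint s₁ s₂ s₃ N γ x)) -
          osc T (phaseUV' α β (scaledPoint s₁ s₂ s₃ N γ x))) := by
  have hR := resFactor_scaledPoint (s₃ := s₃) α β (s₁ := s₁) (s₂ := s₂) (γ := γ) x hN.ne'
  rw [bumpIntegrand_scaledPoint α β T x hs hγ]
  set z := scaledPoint s₁ s₂ s₃ N γ x with hz
  have hE' : resFactor α β z.2.1 (-z.1 - z.2.1) ≠ 0 := by
    rw [hR]; exact mul_ne_zero (by positivity) hE
  have hD := mul_doubleOsc_eq T hE'
  rw [hR] at hD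
  rw [hD]
  set D := osc T (phaseUV' α β z + phaseVV α β z) - osc T (phaseUV' α β z)
  set R := resFactor α (β * N⁻¹ ^ 2) (s₁ + γ * x.2.1 / N) (s₂ + γ * (-x.1 - x.2.1) / N) with hRdef
  have hRc : (R : ℂ) ≠ 0 := by exact_mod_cast hE
  have hNc : (N : ℂ) ≠ 0 := by exact_mod_cast hN.ne'
  push_cast
  field_simp
  rw [Complex.I_sq]
  ring

end scaled

end MajdaBiello
end

/-! ### The limit of the cubic form for one sign pattern. -/

noncomputable section

namespace MajdaBiello

open FourierTransform ComplexConjugate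

section limits

variable {α β s₁ s₂ s₃ : ℝ} {γ : ℝ → ℝ}

theorem tendsto_scaled_div (hγ : Tendsto γ atTop (𝓝 0)) (a : ℝ) :
    Tendsto (fun N => γ N * a / N) atTop (𝓝 0) :=
  (hγ.mul_const a).div_atTop tendsto_id

theorem continuous_resFactor_perturbed : Continuous fun p : ℝ × ℝ × ℝ =>
    resFactor α (β * p.1 ^ 2) (s₁ + p.2.1) (s₂ + p.2.2) := by
  unfold resFactor; fun_prop

theorem tendsto_resFactor (hγ : Tendsto γ atTop (𝓝 0)) (a b : ℝ) :
    Tendsto (fun N => resFactor α (β * N⁻¹ ^ 2) (s₁ + γ N * a / N) (s₂ + γ N * b / N)) atTop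
      (𝓝 (resFactor α 0 s₁ s₂)) := by
  have h := (continuous_resFactor_perturbed (α := α) (β := β) (s₁ := s₁)
    (s₂ := s₂)).tendsto (0, 0, 0)
  simp only [add_zero, ne_eq, OfNat.ofNat_ne_zero, not_false_eq_true, zero_pow, mul_zero] at h
  have h1 : Tendsto (fun N : ℝ => (N⁻¹, γ N * a / N, γ N * b / N)) atTop (𝓝 (0, 0, 0)) :=
    tendsto_inv_atTop_zero.prodMk_nhds
      ((tendsto_scaled_div hγ a).prodMk_nhds (tendsto_scaled_div hγ b))
  refine (h.comp h1).congr fun N => ?_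
  simp only [Function.comp_apply]

/-- Joint continuity in 1/N and the two frequency perturbations gives a lower bound uniform over the
bumps, as needed for a dominating function. -/
theorem eventually_lt_abs_resFactor (hγ : Tendsto γ atTop (𝓝 0))
    (he : resFactor α 0 s₁ s₂ ≠ 0) : ∀ᶠ N in atTop, ∀ a b : ℝ, |a| ≤ 1 → |b| ≤ 1 →
      |resFactor α 0 s₁ s₂| / 2 <
        |resFactor α (β * N⁻¹ ^ 2) (s₁ + γ N * a / N) (s₂ + γ N * b / N)| := by
  have h := (continuous_resFactor_perturbed (α := α) (β := β) (s₁ := s₁)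
    (s₂ := s₂)).tendsto (0, 0, 0)
  simp only [add_zero, ne_eq, OfNat.ofNat_ne_zero, not_false_eq_true, zero_pow, mul_zero] at h
  have he' := abs_pos.2 he
  obtain ⟨ρ, hρ, hball⟩ := Metric.eventually_nhds_iff.1
    (h.abs.eventually_const_lt (by linarith : |resFactor α 0 s₁ s₂| / 2 < _))
  have h1 := (tendsto_scaled_div hγ 1).norm.eventually_lt_const (by simpa using hρ : ‖(0 : ℝ)‖ < ρ)
  have h2 := (tendsto_inv_atTop_zero (𝕜 := ℝ)).norm.eventually_lt_const
    (by simpa using hρ : ‖(0 : ℝ)‖ < ρ)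
  filter_upwards [h1, h2] with N h1 h2 a b ha hb
  have h3 : ∀ a : ℝ, |a| ≤ 1 → ‖γ N * a / N‖ < ρ := fun a ha => by
    refine lt_of_le_of_lt ?_ h1
    rw [norm_div, norm_div, norm_mul, norm_mul, norm_one]
    gcongr
    exact ha
  refine hball (y := (N⁻¹, γ N * a / N, γ N * b / N)) ?_
  change dist _ (0 : ℝ × ℝ × ℝ) < ρ
  rw [dist_zero_right, Prod.norm_def, Prod.norm_def]
  exact max_lt h2 (max_lt (h3 a ha) (h3 b hb))

/-- The hypotheses say that at least two of the three pairwise sums vanish. In the product of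
pairwise sums the terms N³ and N²γ then disappear, leaving Nγ² and γ³. -/
theorem tendsto_phase_sum (hγ : Tendsto γ atTop (𝓝 0))
    (hγ' : Tendsto (fun N => N * γ N ^ 2) atTop (𝓝 0)) (h₁ : (s₁ + s₂) * (s₂ + s₃) = 0)
    (h₂ : (s₁ + s₂) * (s₁ + s₃) = 0) (h₃ : (s₂ + s₃) * (s₁ + s₃) = 0) (x : ℝ × ℝ × ℝ) :
    Tendsto (fun N => phaseUV' α β (scaledPoint s₁ s₂ s₃ N (γ N) x) +
      phaseVV α β (scaledPoint s₁ s₂ s₃ N (γ N) x)) atTop (𝓝 0) := by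
  have e : ∀ N, phaseUV' α β (scaledPoint s₁ s₂ s₃ N (γ N) x) +
      phaseVV α β (scaledPoint s₁ s₂ s₃ N (γ N) x) = 3 * α * (2 * Real.pi) ^ 3 *
      (N * γ N ^ 2 * (-(s₁ + s₂) * (-x.1 - x.2.1 + x.2.2) * (x.2.1 + x.2.2) +
        x.1 * (s₂ + s₃) * (x.2.1 + x.2.2) + x.1 * (-x.1 - x.2.1 + x.2.2) * (s₁ + s₃)) +
        γ N ^ 3 * (x.1 * (-x.1 - x.2.1 + x.2.2) * (x.2.1 + x.2.2))) := fun N => by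
    rw [phaseUV'_add_phaseVV, neg_scaledPoint_sub, scaledPoint_fst, scaledPoint_snd_fst,
      scaledPoint_snd_snd]
    linear_combination 3 * α * (2 * Real.pi) ^ 3 *
      (-(N ^ 2 * (N * (s₁ + s₃) + γ N * (x.2.1 + x.2.2))) * h₁ -
        N ^ 2 * γ N * (-x.1 - x.2.1 + x.2.2) * h₂ + N ^ 2 * γ N * x.1 * h₃)
  simp_rw [e]
  have := ((hγ'.mul_const (-(s₁ + s₂) * (-x.1 - x.2.1 + x.2.2) * (x.2.1 + x.2.2) +
        x.1 * (s₂ + s₃) * (x.2.1 + x.2.2) + x.1 * (-x.1 - x.2.1 + x.2.2) * (s₁ + s₃))).add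
    ((hγ.pow 3).mul_const (x.1 * (-x.1 - x.2.1 + x.2.2) * (x.2.1 + x.2.2)))).const_mul
      (3 * α * (2 * Real.pi) ^ 3)
  simpa using this

theorem tendsto_abs_phase (hγ : Tendsto γ atTop (𝓝 0))
    (hγ' : Tendsto (fun N => N * γ N ^ 2) atTop (𝓝 0))
    (hγ'' : Tendsto (fun N => N ^ 2 * γ N) atTop atTop) (h₁ : (s₁ + s₂) * (s₂ + s₃) = 0)
    (h₂ : (s₁ + s₂) * (s₁ + s₃) = 0) (h₃ : (s₂ + s₃) * (s₁ + s₃) = 0)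
    (he : resFactor α 0 s₁ s₂ ≠ 0) (x : ℝ × ℝ × ℝ) (hx : x.1 ≠ 0) :
    Tendsto (fun N => |phaseUV' α β (scaledPoint s₁ s₂ s₃ N (γ N) x)|) atTop atTop := by
  have hx' : 0 < |x.1| := abs_pos.2 hx
  have h4 : Tendsto (fun N => N ^ 2 * |-(s₁ + s₂) * N + γ N * x.1|) atTop atTop := by
    -- If s₁ + s₂ = 0, the intermediate frequency is only γx.1 and the growth comes from N²γ;
    -- otherwise it is of size N and the growth is N³.
    by_cases hp : s₁ + s₂ = 0
    · have h5 : Tendsto (fun N => |N ^ 2 * γ N| * |x.1|) atTop atTop :=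
        (tendsto_abs_atTop_atTop.comp hγ'').atTop_mul_const hx'
      refine h5.congr fun N => ?_
      rw [hp, neg_zero, zero_mul, zero_add, abs_mul, abs_mul, abs_pow, sq_abs, mul_assoc]
    · have h5 : Tendsto (fun N => |-(s₁ + s₂) + γ N * x.1 / N|) atTop (𝓝 |-(s₁ + s₂) + 0|) :=
        ((tendsto_scaled_div hγ x.1).const_add _).abs
      have h6 : 0 < |-(s₁ + s₂) + 0| := by
        rw [add_zero, abs_neg]; exact abs_pos.2 hp
      have h7 : Tendsto (fun N : ℝ => N ^ 3) atTop atTop := tendsto_pow_atTop (by norm_num)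
      refine (h7.atTop_mul_pos h6 h5).congr' ?_
      filter_upwards [eventually_gt_atTop 0] with N hN
      have : -(s₁ + s₂) * N + γ N * x.1 = N * (-(s₁ + s₂) + γ N * x.1 / N) := by field_simp
      rw [this, abs_mul, abs_of_pos hN]
      ring
  have h5 : Tendsto (fun N => |phaseVV α β (scaledPoint s₁ s₂ s₃ N (γ N) x)|) atTop atTop := by
    refine (h4.atTop_mul_pos (abs_pos.2 he)
      (tendsto_resFactor (β := β) hγ x.2.1 (-x.1 - x.2.1)).abs).congr' ?_
    filter_upwards [eventually_gt_atTop 0] with N hN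
    rw [phaseVV_eq, resFactor_scaledPoint α β x hN.ne', scaledPoint_fst, abs_mul, abs_mul, abs_neg,
      abs_of_pos (by positivity : 0 < N ^ 2)]
    ring
  have h6 := (tendsto_phase_sum (α := α) (β := β) hγ hγ' h₁ h₂ h₃ x).abs.eventually_lt_const
    (by simp : |(0 : ℝ)| < 1)
  refine tendsto_atTop_mono' _ ?_ (tendsto_atTop_add_const_right _ (-1) h5)
  filter_upwards [h6] with N h6
  have := abs_sub_abs_le_abs_sub (phaseVV α β (scaledPoint s₁ s₂ s₃ N (γ N) x))
    (-phaseUV' α β (scaledPoint s₁ s₂ s₃ N (γ N) x))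
  rw [abs_neg, sub_neg_eq_add, add_comm (phaseVV α β _)] at this
  linarith

/-- Dominated convergence in variables scaled by γ, whose Jacobian is γ³. The total phase tends to
zero, so its `osc` tends to T; the phase of the second interaction alone is unbounded, so its `osc`
tends to zero. The secular term T thus survives. -/
theorem tendsto_integral_bumpIntegrand {T : ℝ} (hT : 0 ≤ T) (hs : s₁ + s₂ + s₃ = 1)
    (hγ₀ : ∀ᶠ N in atTop, 0 < γ N) (hγ : Tendsto γ atTop (𝓝 0))
    (hγ' : Tendsto (fun N => N * γ N ^ 2) atTop (𝓝 0))
    (hγ'' : Tendsto (fun N => N ^ 2 * γ N) atTop atTop) (h₁ : (s₁ + s₂) * (s₂ + s₃) = 0)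
    (h₂ : (s₁ + s₂) * (s₁ + s₃) = 0) (h₃ : (s₂ + s₃) * (s₁ + s₃) = 0)
    (he : resFactor α 0 s₁ s₂ ≠ 0) :
    Tendsto (fun N : ℝ => (N / γ N ^ 3 : ℂ) * ∫ z, bumpIntegrand α β T s₁ s₂ s₃ N (γ N) z) atTop
      (𝓝 ((resFactor α 0 s₁ s₂ : ℂ)⁻¹ *
        (4 * Real.pi ^ 2 * (∫ x, bumpProfile x : ℝ) * Complex.I * T))) := by
  have he' := abs_pos.2 he
  set e := resFactor α 0 s₁ s₂ with hedef
  have hmain : Tendsto (fun N : ℝ => ∫ x, N * bumpIntegrand α β T s₁ s₂ s₃ N (γ N)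
      (scaledPoint s₁ s₂ s₃ N (γ N) x)) atTop
      (𝓝 (∫ x, ((e⁻¹ * (4 * Real.pi ^ 2 * bumpProfile x) : ℝ) : ℂ) * Complex.I * T)) := by
    refine tendsto_integral_filter_of_dominated_convergence
      (fun x => 3 / (|e| / 2) * (4 * Real.pi ^ 2 * bumpProfile x) * (2 * T)) ?_ ?_ ?_ ?_
    · refine .of_forall fun N => Continuous.aestronglyMeasurable ?_
      refine continuous_const.mul ((continuous_bumpIntegrand _ _ _ _ _ _ _ _).comp ?_)
      unfold scaledPoint
      fun_prop
    · filter_upwards [eventually_lt_abs_resFactor (β := β) hγ he, hγ₀, eventually_ge_atTop 1,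
        hγ.eventually_lt_const one_pos] with N hR hg0 hN hg1
      refine .of_forall fun x => ?_
      have hN0 : 0 < N := by linarith
      by_cases hP : bumpProfile x = 0
      · rw [bumpIntegrand_scaledPoint α β T x hs hg0, hP]
        simp
      obtain ⟨k1, k2, k3, k4⟩ := abs_lt_of_bumpProfile_ne_zero hP
      have hR' := hR _ _ k1.le k2.le
      rw [bumpIntegrand_scaled α β T x hs hg0 hN0 (abs_pos.1 (by linarith)), norm_mul, norm_mul,
        Complex.norm_I, mul_one, Complex.norm_real, norm_mul, norm_div,
        Real.norm_of_nonneg (mul_nonneg (by positivity) (bumpProfile_nonneg x))]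
      have hP0 := bumpProfile_nonneg x
      have hD : ‖osc T (phaseUV' α β (scaledPoint s₁ s₂ s₃ N (γ N) x) +
            phaseVV α β (scaledPoint s₁ s₂ s₃ N (γ N) x)) -
          osc T (phaseUV' α β (scaledPoint s₁ s₂ s₃ N (γ N) x))‖ ≤ 2 * T :=
        (norm_sub_le _ _).trans ((add_le_add (norm_osc_le hT _) (norm_osc_le hT _)).trans_eq
          (two_mul T).symm)
      have hz : ‖1 - γ N * (x.1 - x.2.2) / N‖ ≤ 3 := by
        refine (norm_sub_le _ _).trans ?_
        rw [norm_one, norm_div, norm_mul, Real.norm_of_nonneg hg0.le, Real.norm_of_nonneg hN0.le,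
          Real.norm_eq_abs]
        have : γ N * |x.1 - x.2.2| / N ≤ 1 * 1 / 1 := by gcongr
        linarith
      gcongr
      exact hR'.le
    · exact ((integrable_bumpProfile.const_mul _).const_mul _).mul_const _
    -- Where x.1 = 0 the intermediate frequency can vanish and the second phase need not grow; this
    -- is a null set.
    · have hae : ∀ᵐ x : ℝ × ℝ × ℝ, x.1 ≠ 0 := by
        rw [Measure.volume_eq_prod]
        exact Measure.quasiMeasurePreserving_fst.ae (Measure.ae_ne volume 0)
      filter_upwards [hae] with x hx
      have l1 := tendsto_resFactor (α := α) (β := β) (s₁ := s₁) (s₂ := s₂) hγ x.2.1 (-x.1 - x.2.1)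
      have l2 := tendsto_osc_zero T (tendsto_phase_sum (α := α) (β := β) hγ hγ' h₁ h₂ h₃ x)
      have l3 := tendsto_osc_atTop T
        (tendsto_abs_phase (α := α) (β := β) hγ hγ' hγ'' h₁ h₂ h₃ he x hx)
      have l4 := (((tendsto_scaled_div hγ (x.1 - x.2.2)).const_sub 1).div l1 he).mul_const
        (4 * Real.pi ^ 2 * bumpProfile x)
      have l5 := (((Complex.continuous_ofReal.tendsto _).comp l4).mul_const Complex.I).mul
        (l2.sub l3)
      rw [sub_zero, sub_zero, one_div] at l5
      refine l5.congr' ?_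
      filter_upwards [l1.abs.eventually_const_lt he', hγ₀, eventually_gt_atTop 0] with N hR hg0 hN
      rw [bumpIntegrand_scaled α β T x hs hg0 hN (abs_pos.1 hR)]
      rfl
  have e2 : ∫ x, ((e⁻¹ * (4 * Real.pi ^ 2 * bumpProfile x) : ℝ) : ℂ) * Complex.I * T =
      (e : ℂ)⁻¹ * (4 * Real.pi ^ 2 * (∫ x, bumpProfile x : ℝ) * Complex.I * T) := by
    rw [integral_mul_const, integral_mul_const, integral_complex_ofReal, integral_const_mul,
      integral_const_mul]
    push_cast
    ring
  rw [e2] at hmain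
  refine hmain.congr' ?_
  filter_upwards [hγ₀] with N hg0
  have h := integral_comp_affine (bumpIntegrand α β T s₁ s₂ s₃ N (γ N))
    (-(s₁ + s₂) * N, s₁ * N, s₃ * N) hg0
  have h0 : (γ N : ℂ) ≠ 0 := by exact_mod_cast hg0.ne'
  rw [h, integral_const_mul, ← mul_assoc, div_mul_cancel₀ _ (pow_ne_zero 3 h0)]
  rfl

end limits

end MajdaBiello
end

/-! ### Sum over the sign patterns and failure of C³ well-posedness. -/

noncomputable section

namespace MajdaBiello

open FourierTransform ComplexConjugate

theorem abs_lt_of_bump_ne_zero {c γ ξ : ℝ} (hγ : 0 < γ) (h : bump c γ ξ ≠ 0) : |ξ - c| < γ := by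
  by_contra h'
  exact h (bump_eq_zero hγ (not_lt.1 h'))

theorem integrable_bumpIntegrand (α β T s₁ s₂ s₃ N : ℝ) {γ : ℝ} (hγ : 0 < γ) :
    Integrable (bumpIntegrand α β T s₁ s₂ s₃ N γ) := by
  refine (continuous_bumpIntegrand α β T s₁ s₂ s₃ N γ).integrable_of_hasCompactSupport
    (HasCompactSupport.of_support_subset_isCompact
      ((isCompact_Icc (a := -(s₁ * N) - s₂ * N - 2 * γ) (b := -(s₁ * N) - s₂ * N + 2 * γ)).prod
        ((isCompact_Icc (a := s₁ * N - γ) (b := s₁ * N + γ)).prod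
          (isCompact_Icc (a := s₃ * N - γ) (b := s₃ * N + γ)))) ?_)
  intro z hz
  have h1 := abs_lt.1 (abs_lt_of_bump_ne_zero hγ (c := s₁ * N) (ξ := z.2.1) fun h0 =>
    hz (by simp [bumpIntegrand, ampCubic, h0]))
  have h2 := abs_lt.1 (abs_lt_of_bump_ne_zero hγ (c := s₂ * N) (ξ := -z.1 - z.2.1) fun h0 =>
    hz (by simp [bumpIntegrand, ampCubic, h0]))
  have h3 := abs_lt.1 (abs_lt_of_bump_ne_zero hγ (c := s₃ * N) (ξ := z.2.2) fun h0 =>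
    hz (by simp [bumpIntegrand, ampCubic, h0]))
  exact ⟨⟨by linarith, by linarith⟩, ⟨by linarith, by linarith⟩, ⟨by linarith, by linarith⟩⟩

theorem bump_mul_four_eq_zero {c₁ c₂ c₃ c₄ a b c d γ : ℝ} (hγ : 0 < γ) (h : a + b + c + d = 0)
    (hc : 4 * γ ≤ |c₁ + c₂ + c₃ + c₄|) :
    bump c₁ γ a * bump c₂ γ b * (bump c₃ γ c * bump c₄ γ d) = 0 := by
  by_contra h0
  simp only [mul_eq_zero, not_or] at h0
  have h1 := abs_lt.1 (abs_lt_of_bump_ne_zero hγ h0.1.1)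
  have h2 := abs_lt.1 (abs_lt_of_bump_ne_zero hγ h0.1.2)
  have h3 := abs_lt.1 (abs_lt_of_bump_ne_zero hγ h0.2.1)
  have h4 := abs_lt.1 (abs_lt_of_bump_ne_zero hγ h0.2.2)
  rcases abs_cases (c₁ + c₂ + c₃ + c₄) with h5 | h5 <;> linarith

/-- Of the eight sign choices for the three factors g, only those with two plus signs balance h at
-N. In the others the centres sum to at least 2N ≥ 4γ in modulus, so the bumps cannot meet. -/
theorem ampVVV_twoBump (α β T : ℝ) {N γ : ℝ} (hγ : 0 < γ) (hN : 2 * γ ≤ N) (z : ℝ × ℝ × ℝ) :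
    ampVVV (fun ξ => (twoBump N γ ξ : ℝ)) (fun ξ => (bump (-N) γ ξ : ℝ)) z *
        doubleOsc T (phaseVV α β z) (phaseUV' α β z) =
      bumpIntegrand α β T 1 (-1) 1 N γ z + bumpIntegrand α β T (-1) 1 1 N γ z +
        bumpIntegrand α β T 1 1 (-1) N γ z := by
  have hz : z.2.1 + (-z.1 - z.2.1) + z.2.2 + (z.1 - z.2.2) = 0 := by ring
  have hN0 : 0 < N := by linarith
  have key : twoBump N γ z.2.1 * twoBump N γ (-z.1 - z.2.1) *
      (twoBump N γ z.2.2 * bump (-N) γ (z.1 - z.2.2)) =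
      bump N γ z.2.1 * bump (-N) γ (-z.1 - z.2.1) *
        (bump N γ z.2.2 * bump (-N) γ (z.1 - z.2.2)) +
      bump (-N) γ z.2.1 * bump N γ (-z.1 - z.2.1) *
        (bump N γ z.2.2 * bump (-N) γ (z.1 - z.2.2)) +
      bump N γ z.2.1 * bump N γ (-z.1 - z.2.1) *
        (bump (-N) γ z.2.2 * bump (-N) γ (z.1 - z.2.2)) := by
    have e1 := bump_mul_four_eq_zero (c₁ := N) (c₂ := N) (c₃ := N) (c₄ := -N) hγ hz
      (by rw [abs_of_pos (by linarith)]; linarith)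
    have e2 := bump_mul_four_eq_zero (c₁ := N) (c₂ := -N) (c₃ := -N) (c₄ := -N) hγ hz
      (by rw [abs_of_neg (by linarith)]; linarith)
    have e3 := bump_mul_four_eq_zero (c₁ := -N) (c₂ := N) (c₃ := -N) (c₄ := -N) hγ hz
      (by rw [abs_of_neg (by linarith)]; linarith)
    have e4 := bump_mul_four_eq_zero (c₁ := -N) (c₂ := -N) (c₃ := N) (c₄ := -N) hγ hz
      (by rw [abs_of_neg (by linarith)]; linarith)
    have e5 := bump_mul_four_eq_zero (c₁ := -N) (c₂ := -N) (c₃ := -N) (c₄ := -N) hγ hz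
      (by rw [abs_of_neg (by linarith)]; linarith)
    simp only [twoBump]
    linear_combination e1 + e2 + e3 + e4 + e5
  have key' := congrArg (fun r : ℝ => (r : ℂ)) key
  push_cast at key'
  simp only [bumpIntegrand, ampCubic, ampVVV, one_mul, neg_mul]
  push_cast
  linear_combination (2 * Real.pi * Complex.I * z.1) * (2 * Real.pi * Complex.I * (z.1 - z.2.2)) *
    doubleOsc T (phaseVV α β z) (phaseUV' α β z) * key'

/-- Two patterns pass through an intermediate u of low frequency, with `resFactor` proportional to
3α, and one through frequency 2N, with α - 4. The coefficient is 2/(3α) + 1/(α - 4) up to the factor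
(2π)³. -/
theorem tendsto_integral_ampVVV {α : ℝ} (β : ℝ) {T : ℝ} {γ : ℝ → ℝ} (hT : 0 ≤ T)
    (h0 : α ≠ 0) (h4 : α ≠ 4) (hγ₀ : ∀ᶠ N in atTop, 0 < γ N) (hγ : Tendsto γ atTop (𝓝 0))
    (hγ' : Tendsto (fun N => N * γ N ^ 2) atTop (𝓝 0))
    (hγ'' : Tendsto (fun N => N ^ 2 * γ N) atTop atTop) :
    Tendsto (fun N : ℝ => (N / γ N ^ 3 : ℂ) * ∫ z, ampVVV (fun ξ => (twoBump N (γ N) ξ : ℝ))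
        (fun ξ => (bump (-N) (γ N) ξ : ℝ)) z * doubleOsc T (phaseVV α β z) (phaseUV' α β z)) atTop
      (𝓝 (((5 * α - 8) / (3 * α * (α - 4) * (2 * Real.pi) ^ 3) : ℝ) *
        (4 * Real.pi ^ 2 * (∫ x, bumpProfile x : ℝ) * Complex.I * T))) := by
  have hpi := Real.pi_pos
  have r1 : resFactor α 0 1 (-1) = (2 * Real.pi) ^ 3 * (3 * α) := by rw [resFactor]; ring
  have r2 : resFactor α 0 (-1) 1 = (2 * Real.pi) ^ 3 * (3 * α) := by rw [resFactor]; ring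
  have r3 : resFactor α 0 1 1 = (2 * Real.pi) ^ 3 * (α - 4) := by rw [resFactor]; ring
  have h4' : α - 4 ≠ 0 := sub_ne_zero.2 h4
  have l1 := tendsto_integral_bumpIntegrand (α := α) (β := β) (s₁ := 1) (s₂ := -1) (s₃ := 1) hT
    (by norm_num) hγ₀ hγ hγ' hγ'' (by norm_num) (by norm_num) (by norm_num)
    (by rw [r1]; positivity)
  have l2 := tendsto_integral_bumpIntegrand (α := α) (β := β) (s₁ := -1) (s₂ := 1) (s₃ := 1) hT
    (by norm_num) hγ₀ hγ hγ' hγ'' (by norm_num) (by norm_num) (by norm_num)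
    (by rw [r2]; positivity)
  have l3 := tendsto_integral_bumpIntegrand (α := α) (β := β) (s₁ := 1) (s₂ := 1) (s₃ := -1) hT
    (by norm_num) hγ₀ hγ hγ' hγ'' (by norm_num) (by norm_num) (by norm_num)
    (by rw [r3]; positivity)
  have l := (l1.add l2).add l3
  have e : ((5 * α - 8) / (3 * α * (α - 4) * (2 * Real.pi) ^ 3) : ℝ) =
      (resFactor α 0 1 (-1))⁻¹ + (resFactor α 0 (-1) 1)⁻¹ + (resFactor α 0 1 1)⁻¹ := by
    rw [r1, r2, r3]
    field_simp
    ring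
  rw [e]
  push_cast
  rw [add_mul, add_mul]
  refine l.congr' ?_
  filter_upwards [hγ₀, hγ.eventually_lt_const one_pos, eventually_ge_atTop 2] with N g0 g1 hN
  simp_rw [ampVVV_twoBump α β T g0 (by linarith : 2 * γ N ≤ N)]
  have i1 := integrable_bumpIntegrand α β T 1 (-1) 1 N g0
  have i2 := integrable_bumpIntegrand α β T (-1) 1 1 N g0
  have i3 := integrable_bumpIntegrand α β T 1 1 (-1) N g0
  have i12 : Integrable fun z => bumpIntegrand α β T 1 (-1) 1 N (γ N) z +
      bumpIntegrand α β T (-1) 1 1 N (γ N) z := i1.add i2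
  rw [integral_add i12 i3, integral_add i1 i2]
  ring

theorem not_isLocallyWellPosed_three {s : ℝ} {X : Submodule ℝ (Sobolev s)} (hX : IsAdmissible X)
    {α : ℝ} (β : ℝ) (h0 : α ≠ 0) (h4 : α ≠ 4) (h5 : 5 * α - 8 ≠ 0) (hs : s < -3 / 4) :
    ¬ IsLocallyWellPosed X α β 3 := by
  intro hwp
  obtain ⟨T, hT, C, hC0, hbound⟩ := hwp.exists_cubic_bound hX
  obtain ⟨C₁, hC₁, hw₁⟩ := exists_l2_weight_twoBump_le s two_pos
  obtain ⟨C₂, hC₂, hw₂⟩ := exists_l2_weight_bump_le (-s) two_pos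
  -- The width is N^{-κ}: κ > 1/2 gives Nγ² → 0, κ < 2 gives N²γ → ∞, and κ < -2s - 1 makes the
  -- upper bound decay. The three are compatible because s < -3/4.
  obtain ⟨κ, hκ1, hκ2⟩ := exists_between (lt_min (by norm_num : (1 / 2 : ℝ) < 2)
    (by linarith : (1 / 2 : ℝ) < -2 * s - 1))
  rw [lt_min_iff] at hκ2
  have hγ₀ : ∀ᶠ N : ℝ in atTop, 0 < N ^ (-κ) := by
    filter_upwards [eventually_gt_atTop 0] with N hN using Real.rpow_pos_of_pos hN _
  have hγ : Tendsto (fun N : ℝ => N ^ (-κ)) atTop (𝓝 0) := tendsto_rpow_neg_atTop (by linarith)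
  have hγ' : Tendsto (fun N : ℝ => N * (N ^ (-κ)) ^ 2) atTop (𝓝 0) := by
    refine (tendsto_rpow_neg_atTop (y := 2 * κ - 1) (by linarith)).congr' ?_
    filter_upwards [eventually_gt_atTop 0] with N hN
    rw [← Real.rpow_natCast, ← Real.rpow_mul hN.le, ← Real.rpow_one_add' hN.le]
    · congr 1; push_cast; ring
    · push_cast; linarith
  have hγ'' : Tendsto (fun N : ℝ => N ^ 2 * N ^ (-κ)) atTop atTop := by
    refine (tendsto_rpow_atTop (y := 2 - κ) (by linarith)).congr' ?_
    filter_upwards [eventually_gt_atTop 0] with N hN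
    rw [← Real.rpow_natCast, ← Real.rpow_add hN]
    congr 1
  have hlim := tendsto_integral_ampVVV β hT.le h0 h4 hγ₀ hγ hγ' hγ''
  have hzero : Tendsto (fun N : ℝ => C * C₁ ^ 3 * C₂ * N ^ (-(-2 * s - 1 - κ))) atTop (𝓝 0) := by
    simpa using (tendsto_rpow_neg_atTop (y := -2 * s - 1 - κ) (by linarith)).const_mul
      (C * C₁ ^ 3 * C₂)
  have hlim0 := squeeze_zero_norm' (a := fun N : ℝ => C * C₁ ^ 3 * C₂ * N ^ (-(-2 * s - 1 - κ)))
    (f := fun N : ℝ => (N / ((N ^ (-κ) : ℝ) : ℂ) ^ 3 : ℂ) *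
      ∫ z, ampVVV (fun ξ => (twoBump N (N ^ (-κ)) ξ : ℝ))
        (fun ξ => (bump (-N) (N ^ (-κ)) ξ : ℝ)) z * doubleOsc T (phaseVV α β z) (phaseUV' α β z))
    ?_ hzero
  · have h := tendsto_nhds_unique hlim hlim0
    have hJ := integral_bumpProfile_pos
    have h4' : α - 4 ≠ 0 := sub_ne_zero.2 h4
    have hpi := Real.pi_pos
    simp only [mul_eq_zero, Complex.ofReal_eq_zero, div_eq_zero_iff, h5, h0, h4', Complex.I_ne_zero,
      hT.ne', hJ.ne', pow_eq_zero_iff, OfNat.ofNat_ne_zero, hpi.ne', ne_eq, not_false_eq_true,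
      or_self] at h
  · filter_upwards [hγ₀, hγ.eventually_lt_const one_pos, eventually_ge_atTop 2] with N g0 g1 hN
    have hN0 : 0 < N := by linarith
    have l1 := hw₁ N N _ (by linarith) g0 (by rw [abs_of_pos hN0]; linarith)
      (by rw [abs_of_pos hN0]; linarith)
    have l2' := hw₂ N (-N) _ (by linarith) g0 (by rw [abs_neg, abs_of_pos hN0]; linarith)
      (by rw [abs_neg, abs_of_pos hN0]; linarith)
    have key := hbound _ _ (isProfile_twoBump N g0) (isProfile_bump (-N) g0)
      (isHermitian_twoBump N _)
    -- After multiplication by N/γ³ the permitted size N^{2s}γ² becomes N^{2s+1}/γ, which tends to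
    -- zero, whereas the form tends to a nonzero limit.
    have e : N ^ (-(-2 * s - 1 - κ)) = N * (N ^ s) ^ 2 / N ^ (-κ) := by
      rw [← Real.rpow_natCast, ← Real.rpow_mul hN0.le, eq_div_iff g0.ne', ← Real.rpow_add hN0,
        ← Real.rpow_one_add' hN0.le]
      · congr 1; push_cast; ring
      · push_cast; linarith
    rw [e]
    rw [Real.rpow_neg hN0.le s] at l2'
    have hy0 : 0 < N ^ s := Real.rpow_pos_of_pos hN0 _
    set y := N ^ s
    set γ := N ^ (-κ)
    have hsq : √γ ^ 2 = γ := Real.sq_sqrt g0.le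
    have h3 := key.trans (b := _) (c := C * (C₁ * y * √γ) ^ 3 * (C₂ * y⁻¹ * √γ)) (by
      have := l2_nonneg (fun ξ => Sobolev.weight s ξ * (twoBump N γ ξ : ℝ))
      have := l2_nonneg (fun ξ => Sobolev.weight (-s) ξ * (bump (-N) γ ξ : ℝ))
      gcongr)
    rw [norm_mul, norm_div, norm_pow, Complex.norm_real, Complex.norm_real,
      Real.norm_of_nonneg hN0.le, Real.norm_of_nonneg g0.le]
    refine (mul_le_mul_of_nonneg_left h3 (by positivity)).trans (le_of_eq ?_)
    have e4 : C * (C₁ * y * √γ) ^ 3 * (C₂ * y⁻¹ * √γ) = C * C₁ ^ 3 * C₂ * y ^ 2 * (√γ ^ 2) ^ 2 := by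
      field_simp
    rw [e4, hsq]
    field_simp

end MajdaBiello
end

open MajdaBiello in
/-- Failure of `C^k` local well-posedness of the modified Majda-Biello system in `H^s × H^s`, both
for complex-valued data (`⊤`, all of `H^s`) and for real-valued data. -/
theorem theorem1p2 (α β s : ℝ) :
    (0 < α ∧ α < 4 ∧ α ≠ 1 → s < 0 →
      ¬ IsLocallyWellPosed (⊤ : Submodule ℝ (Sobolev s)) α β 2 ∧
      ¬ IsLocallyWellPosed (Sobolev.realValued s) α β 2) ∧
    (α < 0 ∨ 4 < α ∨ α = 1 → s < -3 / 4 →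
      ¬ IsLocallyWellPosed (⊤ : Submodule ℝ (Sobolev s)) α β 3 ∧
      ¬ IsLocallyWellPosed (Sobolev.realValued s) α β 3) := by
  refine ⟨fun ⟨h0, h4, h1⟩ hs => ⟨?_, ?_⟩, fun h hs => ?_⟩
  · exact not_isLocallyWellPosed_two (isAdmissible_top s) β h0 h4 h1 hs
  · exact not_isLocallyWellPosed_two (isAdmissible_realValued s) β h0 h4 h1 hs
  · have h0 : α ≠ 0 := by rintro rfl; norm_num at h
    have h4 : α ≠ 4 := by rintro rfl; norm_num at h
    -- The exceptional value 8/5 lies strictly between 1 and 4, outside all three cases.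
    have h5 : 5 * α - 8 ≠ 0 := by rcases h with h | h | h <;> intro h' <;> linarith
    exact ⟨not_isLocallyWellPosed_three (isAdmissible_top s) β h0 h4 h5 hs,
      not_isLocallyWellPosed_three (isAdmissible_realValued s) β h0 h4 h5 hs⟩
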